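/- **Setting.** Let $L>0$, $N\ge 1$ and $x_i^-<x_i^+<x_{i+1}^-$ with $x^\pm_{i+N}=x^\pm_i+L$ for $i\in\mathbb Z$. For $1\le i\le N$, $m\in\mathbb Z$ let $D_i^m=(x_i^-+mL,\,x_i^++mL)$ (the $i$-th resonator of the $m$-th cell), $\ell_i=x_i^+-x_i^-$, $D=\bigcup_{m,i}D_i^m$, $D^m=\bigcup_iD_i^m$. Write $w|_\pm(x)=\lim_{h\downarrow0}w(x\pm h)$. For $\alpha\in Y^*=(-\pi/L,\pi/L]$ the capacitance matrix is $$C^\alpha_{ij}=\frac{dV_j^\alpha}{dx}\Big|_-(x_i^-)-\frac{dV_j^\alpha}{dx}\Big|_+(x_i^+),$$ where $V_j^\alpha$ is continuous, $V_j^\alpha{}''=0$ off $\overline D$, $V_j^\alpha=\delta_{ij}$ on $D_i=D_i^0$ for all $i$, and $V_j^\alpha(x+mL)=e^{i\alpha mL}V_j^\alpha(x)$ for all $m\in\mathbb Z$. **Wave problem.** Let $v_0>0$, $\kappa_r>0$, let $\rho_r^{m,i}>0$ and $\delta^{m,i}>0$ be the densities and the contrasts of the resonators $D_i^m$ (spatial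 defect: both may depend on $m$ and $i$; the case $\delta^{m,i}=\delta^m$ is included), and let $\kappa_i(t),s_i(t)>0$ be modulations of frequency $\Omega>0$ with $1/\kappa_i(t)=\sum_{|n|\le M}k_{i,n}e^{in\Omega t}$ and $1/s_i(t)=\sum_{|n|\le M}s_{i,n}e^{in\Omega t}$. Consider a classical solution $u(x,t)$, of class $C^2$ up to the boundary on each resonator and on each gap between resonators, with quasifrequency $\omega\in\mathbb C$ (that is, $u(x,t)e^{-i\omega t}$ is $2\pi/\Omega$-periodic in $t$), of $$\partial_t^2u-v_0^2\partial_x^2u=0\ \ (x\notin\overline D),\qquad \partial_t\Big(\frac1{\kappa_i(t)}\partial_tu\Big)-\frac{\kappa_r}{\rho_r^{m,i}}\partial_x^2u=0\ \ (x\in D_i^m),$$ $$u|_\pm=\frac1{s_i(t)}u|_\mp,\qquad \delta^{m,i}\,\partial_xu|_\pm=\frac1{s_i(t)}\partial_xu|_\mp\qquad\text{at } x_i^\pm+mL .$$ Let $v_n(x)=\frac{\Omega}{2\pi}\int_0^{2\pi/\Omega}u(x,t)e^{-i(\omega+n\Omega)t}\,dt$ be its modes, $v_{i,n}^m=\frac1{\ell_i}\int_{D_i^m}v_n\,dx$,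 and $\|u\|=\sum_{n,m}\|v_n\|_{L^2(D^m)}$. The solution is *localised* if $\sum_{n,m}(1+|\omega+n\Omega|^2)\|v_n\|_{L^2(D^m)}<\infty$. **Regime.** Let $\gamma\in(0,1)$ and $C>0$. For small $\delta>0$ suppose that $\delta/C\le\delta^{m,i}\le C\delta$, $\rho_r^{m,i}/\kappa_r\le C$, $\Omega\le C\delta^{1/2}$, $M\le C\delta^{-\gamma/2}$; that $\sum_n|k_{i,n}|\le C$, $\sum_n|s_{i,n}|\le C$, and $s_i(t)$ has itself a Fourier series whose coefficients have absolute sum at most $C$; and that $\omega$ is *subwavelength*: $|\omega|\le C\delta^{(1-\gamma)/2}$ and $u$ is essentially supported in the low-frequency regime, $$\sum_{|n|>M}\sum_m\Big(1+\frac{|\omega+n\Omega|^2}{\delta}\Big)\|v_n\|_{L^2(D^m)}\le C\delta^{(1-\gamma)/2}\|u\| .$$ **Proposition.** There are $K$ and $\delta_0>0$, depending only on the geometry $(x_i^\pm),L,N$ and on $v_0,\gamma,C$, such that for all $\delta\in(0,\delta_0)$, all materials as above and all localised solutions $u$ with subwavelength quasifrequency $\omega$ the following holds. The modes are approximately constant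 in the resonators: $|v_n(x)-v_{i,n}^m|\le K\delta^{(1-\gamma)/2}\|u\|$ for $x\in D_i^m$ and all $n,m,i$. Moreover, for all $\alpha\in Y^*$ and $i=1,\dots,N$, the series below converge absolutely, the derivatives exist, and, at leading order as $\delta\to0$, $$\sum_{j=1}^NC^\alpha_{ij}\,\frac1{s_j(t)}\sum_{n\in\mathbb Z}\Big(\sum_{m\in\mathbb Z}v_{j,n}^me^{-i\alpha mL}\Big)e^{i(\omega+n\Omega)t} =-\frac{\ell_i}{s_i(t)\kappa_r}\frac{d}{dt}\left(\frac1{\kappa_i(t)}\frac{d}{dt}\sum_{n\in\mathbb Z}\Big(\sum_{m\in\mathbb Z}v_{i,n}^me^{-i\alpha mL}\frac{\rho_r^{m,i}}{\delta^{m,i}}\Big)e^{i(\omega+n\Omega)t}\right),$$ in the sense that for all $t\in\mathbb R$ the two sides differ by at most $K\delta^{(1-\gamma)/2}\,\|u\|\,|e^{i\omega t}|$. -/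

import Mathlib

open Complex Function

noncomputable section

namespace SpaceTimeResonators

/-- Geometry of the chain with `N` resonators `(xl i, xr i)`, `0 ≤ i < N`, in the unit cell, and
its `L`-periodic extension to all indices `i : ℤ`. The `i`-th resonator of the cell `m` is
`(xl i + m L, xr i + m L)`. -/
structure Chain (N : ℕ) where
  L : ℝ
  xl : ℤ → ℝ
  xr : ℤ → ℝ
  L_pos : 0 < L
  xl_lt_xr : ∀ i, xl i < xr i
  xr_lt_xl : ∀ i, xr i < xl (i + 1)
  xl_add : ∀ i, xl (i + N) = xl i + L
  xr_add : ∀ i, xr (i + N) = xr i + L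

namespace Chain

variable {N : ℕ} (G : Chain N)

/-- Left end point of `D_i^m`. -/
def left (m : ℤ) (i : Fin N) : ℝ := G.xl (i : ℕ) + m * G.L

/-- Right end point of `D_i^m`. -/
def right (m : ℤ) (i : Fin N) : ℝ := G.xr (i : ℕ) + m * G.L

/-- Length `ℓ_i` of the resonator `D_i`. -/
def len (i : Fin N) : ℝ := G.xr (i : ℕ) - G.xl (i : ℕ)

/-- `V` solves the problem defining `V_j^α`: it is continuous, harmonic between the resonators,
equal to `1` on `D_j` and to `0` on the other resonators of the unit cell, and `α`-quasiperiodic. -/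
structure IsPotential (α : ℝ) (j : Fin N) (V : ℝ → ℂ) : Prop where
  continuous : Continuous V
  harmonic : ∀ i : ℤ, ∀ x ∈ Set.Ioo (G.xr i) (G.xl (i + 1)),
    DifferentiableAt ℝ V x ∧ HasDerivAt (deriv V) 0 x
  value : ∀ i : Fin N, ∀ x ∈ Set.Ioo (G.left 0 i) (G.right 0 i), V x = if i = j then 1 else 0
  quasiperiodic : ∀ (x : ℝ) (m : ℤ), V (x + m * G.L) = exp (I * α * m * G.L) * V x

/-- The function `V_j^α`. -/
def potential (α : ℝ) (j : Fin N) : ℝ → ℂ := Classical.epsilon (G.IsPotential α j)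

/-- `I_{∂D_i}[f] = f'|₋(x_i^-) - f'|₊(x_i^+)`. -/
def boundaryFlux (i : Fin N) (f : ℝ → ℂ) : ℂ :=
  leftLim (deriv f) (G.left 0 i) - rightLim (deriv f) (G.right 0 i)

/-- The quasiperiodic capacitance matrix, `C_{ij}^α = I_{∂D_i}[V_j^α]`. -/
def capacitance (α : ℝ) : Matrix (Fin N) (Fin N) ℂ :=
  Matrix.of fun i j => G.boundaryFlux i (G.potential α j)

end Chain

/-- Material data: the factor `κ_r` of the bulk modulus, the densities `ρ m i` of the resonators
`D_i^m`, their contrasts `δ m i`, the modulations `κ i` and `s i` of frequency `Ω`. -/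
structure Material (N : ℕ) where
  κr : ℝ
  ρ : ℤ → Fin N → ℝ
  δ : ℤ → Fin N → ℝ
  Ω : ℝ
  κ : Fin N → ℝ → ℝ
  s : Fin N → ℝ → ℝ

/-- `f(t) = ∑_{|n| ≤ M} c_n exp(i n Ω t)` with `∑ |c_n| ≤ C`. -/
def IsTrigSum (Ω : ℝ) (M : ℕ) (C : ℝ) (f : ℝ → ℝ) : Prop :=
  ∃ c : ℤ → ℂ, ∑ n ∈ Finset.Icc (-(M : ℤ)) M, ‖c n‖ ≤ C ∧
    ∀ t : ℝ, (f t : ℂ) = ∑ n ∈ Finset.Icc (-(M : ℤ)) M, c n * exp (I * n * Ω * t)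

/-- `f(t) = ∑_n c_n exp(i n Ω t)` with `∑ |c_n| ≤ C`. -/
def IsWiener (Ω : ℝ) (C : ℝ) (f : ℝ → ℝ) : Prop :=
  ∃ c : ℤ → ℂ, Summable (fun n => ‖c n‖) ∧ ∑' n, ‖c n‖ ≤ C ∧
    ∀ t : ℝ, (f t : ℂ) = ∑' n : ℤ, c n * exp (I * n * Ω * t)

/-- High-contrast regime of size `d`: all contrasts are comparable to `d`, the wave speeds
`√(κ_r / ρ m i)` in the resonators are bounded below, the modulation is slow, and the modulations
are positive, with `1 / s i` and `1 / κ i` of finite Fourier expansion up to the order `M`. -/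
structure Material.IsHighContrast {N : ℕ} (P : Material N) (C d : ℝ) (M : ℕ) : Prop where
  κr_pos : 0 < P.κr
  ρ_pos : ∀ m i, 0 < P.ρ m i
  ρ_le : ∀ m i, P.ρ m i ≤ C * P.κr
  δ_ge : ∀ m i, d ≤ C * P.δ m i
  δ_le : ∀ m i, P.δ m i ≤ C * d
  Ω_pos : 0 < P.Ω
  Ω_le : P.Ω ≤ C * √d
  κ_pos : ∀ i t, 0 < P.κ i t
  s_pos : ∀ i t, 0 < P.s i t
  κ_inv : ∀ i, IsTrigSum P.Ω M C (fun t => 1 / P.κ i t)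
  s_inv : ∀ i, IsTrigSum P.Ω M C (fun t => 1 / P.s i t)
  s_wiener : ∀ i, IsWiener P.Ω C (P.s i)

/-- `u` is of class `C²` on `[a, b] × ℝ`, up to the boundary (its values at `x = a, b`, where a
wave field jumps, are irrelevant). -/
def IsC2UpToBoundary (u : ℝ → ℝ → ℂ) (a b : ℝ) : Prop :=
  ∃ U : ℝ × ℝ → ℂ, ContDiff ℝ 2 U ∧ ∀ x ∈ Set.Ioo a b, ∀ t, u x t = U (x, t)

/-- Classical solutions `u(x, t)` with quasifrequency `ω` of the wave equation in the chain, with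
wave speed `v₀` in the background. -/
structure IsSolution {N : ℕ} (G : Chain N) (v₀ : ℝ) (P : Material N) (ω : ℂ)
    (u : ℝ → ℝ → ℂ) : Prop where
  periodic : ∀ x, Periodic (fun t : ℝ => u x t * exp (-(I * ω * t))) (2 * Real.pi / P.Ω)
  c2_background : ∀ i : ℤ, IsC2UpToBoundary u (G.xr i) (G.xl (i + 1))
  c2_resonator : ∀ m i, IsC2UpToBoundary u (G.left m i) (G.right m i)
  background : ∀ i : ℤ, ∀ x ∈ Set.Ioo (G.xr i) (G.xl (i + 1)), ∀ t : ℝ,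
    deriv (deriv (u x)) t - (v₀ : ℂ) ^ 2 * deriv (deriv fun y => u y t) x = 0
  resonator : ∀ m i, ∀ x ∈ Set.Ioo (G.left m i) (G.right m i), ∀ t : ℝ,
    deriv (fun τ => ((1 / P.κ i τ : ℝ) : ℂ) * deriv (u x) τ) t
      - ((P.κr / P.ρ m i : ℝ) : ℂ) * deriv (deriv fun y => u y t) x = 0
  trace_left : ∀ m i t, leftLim (fun y => u y t) (G.left m i)
    = ((1 / P.s i t : ℝ) : ℂ) * rightLim (fun y => u y t) (G.left m i)
  trace_right : ∀ m i t, rightLim (fun y => u y t) (G.right m i)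
    = ((1 / P.s i t : ℝ) : ℂ) * leftLim (fun y => u y t) (G.right m i)
  flux_left : ∀ m i t, (P.δ m i : ℂ) * leftLim (deriv fun y => u y t) (G.left m i)
    = ((1 / P.s i t : ℝ) : ℂ) * rightLim (deriv fun y => u y t) (G.left m i)
  flux_right : ∀ m i t, (P.δ m i : ℂ) * rightLim (deriv fun y => u y t) (G.right m i)
    = ((1 / P.s i t : ℝ) : ℂ) * leftLim (deriv fun y => u y t) (G.right m i)

/-- The Fourier modes `v_n(x)` in `u(x, t) = ∑_n v_n(x) exp(i (ω + n Ω) t)`. -/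
def mode (Ω : ℝ) (ω : ℂ) (u : ℝ → ℝ → ℂ) (n : ℤ) (x : ℝ) : ℂ :=
  (Ω / (2 * Real.pi) : ℝ) * ∫ t in (0 : ℝ)..(2 * Real.pi / Ω), u x t * exp (-(I * (ω + n * Ω) * t))

section

variable {N : ℕ} (G : Chain N) (Ω : ℝ) (ω : ℂ) (u : ℝ → ℝ → ℂ)

/-- `v_{i,n}^m`, the mean value of `v_n` over `D_i^m`. -/
def cellMode (m : ℤ) (i : Fin N) (n : ℤ) : ℂ :=
  (1 / G.len i : ℝ) * ∫ x in (G.left m i)..(G.right m i), mode Ω ω u n x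

/-- The norm of `v_n` in `L²(D^m)`, where `D^m` is the union of the resonators in the cell `m`. -/
def modeNorm (n m : ℤ) : ℝ :=
  √(∑ i, ∫ x in (G.left m i)..(G.right m i), ‖mode Ω ω u n x‖ ^ 2)

/-- The size `∑_n ∑_m ‖v_n‖_{L²(D^m)}` of a wave field. -/
def size : ℝ := ∑' p : ℤ × ℤ, modeNorm G Ω ω u p.1 p.2

/-- Localised wave fields: the norms of the modes (and of their first two time derivatives)
are summable over all cells. -/
def IsLocalised : Prop :=
  Summable fun p : ℤ × ℤ => (1 + ‖ω + p.1 * Ω‖ ^ 2) * modeNorm G Ω ω u p.1 p.2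

/-- Subwavelength quasifrequency: `ω` is small, and the wave field is essentially supported in the
low-frequency regime `|n| ≤ M`, where time is measured on the scale `d ^ (-1 / 2)`. -/
structure IsSubwavelength (C γ d : ℝ) (M : ℕ) : Prop where
  ω_le : ‖ω‖ ≤ C * d ^ ((1 - γ) / 2)
  tail_le : ∑' p : ℤ × ℤ, (if (M : ℤ) < |p.1| then
      (1 + ‖ω + p.1 * Ω‖ ^ 2 / d) * modeNorm G Ω ω u p.1 p.2 else 0)
    ≤ C * d ^ ((1 - γ) / 2) * size G Ω ω u

/-- The summand of index `(n, m)` of the wave of Bloch sums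
`∑_n (∑_m v_{i,n}^m exp(-i α m L) a^m) exp(i (ω + n Ω) t)`, without its time factor. -/
def blochTerm (α : ℝ) (i : Fin N) (a : ℤ → ℝ) (n m : ℤ) : ℂ :=
  cellMode G Ω ω u m i n * exp (-(I * α * m * G.L)) * a m

/-- `∑_n (∑_m v_{i,n}^m exp(-i α m L) a^m) exp(i (ω + n Ω) t)`. -/
def blochWave (α : ℝ) (i : Fin N) (a : ℤ → ℝ) (t : ℝ) : ℂ :=
  ∑' n : ℤ, (∑' m : ℤ, blochTerm G Ω ω u α i a n m) * exp (I * (ω + n * Ω) * t)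

end

end SpaceTimeResonators

end

/-! Expand in time. With ω_n = ω + nΩ, the modes in a resonator satisfy A_n'' = -(ρ/κ_r) ω_n ∑_l k_l
ω_{n-l} A_{n-l}, those in a gap satisfy the Helmholtz equation, and the transmission conditions
become convolutions with the coefficients of 1/s. Put ε = δ^((1-γ)/2) and S = ‖u‖. Low frequencies
are O(ε) and the tail hypothesis pays for the others, so the sum of all (|ω_n|² + ε²)‖A_n‖ is O(ε²
S) (`sumBigO_W_b`). All estimates are ℓ¹ bounds over frequencies and resonators, which survive both
the convolutions and the Bloch sums.

Interpolation bounds A and A' in a resonator by the L¹ norms of A and A'' (`norm_A_le`), hence also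
the traces of B in the adjacent gaps. If |ω_n| ≤ c, a gap is far from resonance and B' is the slope
of the chord up to O(|ω_n|²). If |ω_n| > c, the flux condition bounds B' with a loss 1/δ, which the
tail hypothesis repays (`norm_B1_sub_slope_le`, `sumBigO_gapErr`). So the exterior fluxes are O(S).
The flux condition, solved for A', has a factor δ and yields A' = O(ε S) (`norm_A1_le`). Thus the
modes are almost constant in the resonators, and the exterior fluxes are, up to O(ε S), the slopes
between transferred mean values (`sumBigO_flux_sub`).

Two exact identities conclude. By the divergence theorem, the jump of the exterior flux across a
resonator gives the right-hand side of the capacitance equation (`fluxJump_eq`). Bloch sums are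
α-quasiperiodic in the index of the resonator, and on such sequences C^α is the jump of the slopes
(`sum_capacitance_mul`). The two sides therefore differ by a Bloch sum of the flux errors. -/

namespace SpaceTimeResonators

/-! ### Calculus of ℓ¹ bounds that are uniform in the data. -/

/-- A nonnegative summable family whose sum is at most `S`. -/
def SumLE {ι : Type*} (f : ι → ℝ) (S : ℝ) : Prop :=
  (∀ i, 0 ≤ f i) ∧ Summable f ∧ ∑' i, f i ≤ S

namespace SumLE

variable {ι κ : Type*} {f g : ι → ℝ} {S T : ℝ}

lemma mono (h : SumLE f S) (h0 : ∀ i, 0 ≤ g i) (hg : ∀ i, g i ≤ f i) (hST : S ≤ T) :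
    SumLE g T :=
  have hs := Summable.of_nonneg_of_le h0 hg h.2.1
  ⟨h0, hs, (hs.tsum_le_tsum hg h.2.1).trans (h.2.2.trans hST)⟩

lemma le_right (h : SumLE f S) (hST : S ≤ T) : SumLE f T :=
  ⟨h.1, h.2.1, h.2.2.trans hST⟩

lemma add (hf : SumLE f S) (hg : SumLE g T) : SumLE (fun i => f i + g i) (S + T) :=
  ⟨fun i => add_nonneg (hf.1 i) (hg.1 i), hf.2.1.add hg.2.1, by
    rw [hf.2.1.tsum_add hg.2.1]; exact add_le_add hf.2.2 hg.2.2⟩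

lemma const_mul (hf : SumLE f S) {a : ℝ} (ha : 0 ≤ a) : SumLE (fun i => a * f i) (a * S) :=
  ⟨fun i => mul_nonneg ha (hf.1 i), hf.2.1.mul_left a, by
    rw [tsum_mul_left]; exact mul_le_mul_of_nonneg_left hf.2.2 ha⟩

lemma comp_injective (hf : SumLE f S) {e : κ → ι} (he : Injective e) :
    SumLE (fun i => f (e i)) S :=
  ⟨fun _ => hf.1 _, hf.2.1.comp_injective he,
    (tsum_comp_le_tsum_of_inj hf.2.1 hf.1 he).trans hf.2.2⟩

lemma nonneg (hf : SumLE f S) : 0 ≤ S := (tsum_nonneg hf.1).trans hf.2.2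

lemma le (hf : SumLE f S) (i : ι) : f i ≤ S :=
  (hf.2.1.le_tsum i fun j _ => hf.1 j).trans hf.2.2

/-- Young's inequality ℓ¹ * ℓ¹ ⊆ ℓ¹ in the frequency variable: (p, l) ↦ (l, p - l) is a bijection,
so the double sum factorises. The second conclusion is kept because the pointwise convolution series
must be known to converge before a mode is compared with them. -/
lemma conv {f : ℤ × ℤ → ℝ} (hf : SumLE f S) {c : ℤ → ℝ} {C : ℝ} (hc : SumLE c C) :
    SumLE (fun p : ℤ × ℤ => ∑' l, c l * f (p.1 - l, p.2)) (C * S) ∧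
      ∀ p : ℤ × ℤ, Summable fun l => c l * f (p.1 - l, p.2) := by
  have h1 : Summable fun q : ℤ × (ℤ × ℤ) => c q.1 * f q.2 :=
    hc.2.1.mul_of_nonneg hf.2.1 hc.1 hf.1
  let e : (ℤ × ℤ) × ℤ ≃ ℤ × (ℤ × ℤ) :=
    { toFun := fun q => (q.2, (q.1.1 - q.2, q.1.2))
      invFun := fun q => ((q.2.1 + q.1, q.2.2), q.1)
      left_inv := fun q => by simp
      right_inv := fun q => by simp }
  have h2 : Summable fun q : (ℤ × ℤ) × ℤ => c q.2 * f (q.1.1 - q.2, q.1.2) :=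
    (e.summable_iff (f := fun q : ℤ × (ℤ × ℤ) => c q.1 * f q.2)).2 h1
  refine ⟨⟨fun p => tsum_nonneg fun l => mul_nonneg (hc.1 _) (hf.1 _), h2.prod, ?_⟩,
    fun p => h2.prod_factor p⟩
  rw [← h2.tsum_prod,
    show (∑' p : (ℤ × ℤ) × ℤ, c p.2 * f (p.1.1 - p.2, p.1.2)) = ∑' p : ℤ × (ℤ × ℤ), c p.1 * f p.2 from
      e.tsum_eq (fun q : ℤ × (ℤ × ℤ) => c q.1 * f q.2), h1.tsum_prod]
  simp only [tsum_mul_left, tsum_mul_right]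
  exact mul_le_mul hc.2.2 hf.2.2 (tsum_nonneg hf.1) hc.nonneg

lemma finset_conv {f : ℤ × ℤ → ℝ} (hf : SumLE f S) {c : ℤ → ℝ} {C : ℝ} {s : Finset ℤ}
    (hc0 : ∀ l, 0 ≤ c l) (hc : ∑ l ∈ s, c l ≤ C) :
    SumLE (fun p : ℤ × ℤ => ∑ l ∈ s, c l * f (p.1 - l, p.2)) (C * S) := by
  classical
  have h : SumLE (fun l => if l ∈ s then c l else 0) C := by
    refine ⟨fun l => by dsimp only; split_ifs <;> simp [hc0], ?_, ?_⟩
    · exact summable_of_ne_finset_zero (s := s) fun l hl => by simp [hl]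
    · rw [tsum_eq_sum (s := s) fun l hl => by simp [hl]]
      rwa [Finset.sum_congr rfl fun l hl => if_pos hl]
  refine (hf.conv h).1.mono
    (fun p => Finset.sum_nonneg fun l _ => mul_nonneg (hc0 l) (hf.1 _)) (fun p => ?_) le_rfl
  rw [tsum_eq_sum (s := s) fun l hl => by simp [hl]]
  exact (Finset.sum_congr rfl fun l hl => by simp [hl]).le

end SumLE

/-- The family `f x` is summable with sum `O(S x)`, uniformly in the data `x`. -/
def SumBigO {D ι : Type*} (f : D → ι → ℝ) (S : D → ℝ) : Prop :=
  ∃ K, 0 ≤ K ∧ ∀ x, SumLE (f x) (K * S x)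

namespace SumBigO

variable {D ι κ : Type*} {f g : D → ι → ℝ} {S T : D → ℝ}

lemma mono (h : SumBigO f S) (K : ℝ) (hK : 0 ≤ K) (h0 : ∀ x i, 0 ≤ g x i)
    (hg : ∀ x i, g x i ≤ K * f x i) : SumBigO g S := by
  obtain ⟨A, hA, h⟩ := h
  exact ⟨K * A, mul_nonneg hK hA, fun x =>
    ((h x).const_mul hK).mono (h0 x) (hg x) (by rw [mul_assoc])⟩

lemma mono_right (h : SumBigO f S) (K : ℝ) (hK : 0 ≤ K) (hST : ∀ x, S x ≤ K * T x) :
    SumBigO f T := by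
  obtain ⟨A, hA, h⟩ := h
  exact ⟨A * K, mul_nonneg hA hK, fun x => (h x).le_right (by
    rw [mul_assoc]; exact mul_le_mul_of_nonneg_left (hST x) hA)⟩

lemma add (hf : SumBigO f S) (hg : SumBigO g S) : SumBigO (fun x i => f x i + g x i) S := by
  obtain ⟨A, hA, hf⟩ := hf
  obtain ⟨B, hB, hg⟩ := hg
  exact ⟨A + B, add_nonneg hA hB, fun x => by rw [add_mul]; exact (hf x).add (hg x)⟩

lemma scale (hf : SumBigO f S) {a : D → ℝ} (ha : ∀ x, 0 ≤ a x) :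
    SumBigO (fun x i => a x * f x i) (fun x => a x * S x) := by
  obtain ⟨A, hA, hf⟩ := hf
  exact ⟨A, hA, fun x => by rw [mul_left_comm]; exact (hf x).const_mul (ha x)⟩

lemma comp_injective (hf : SumBigO f S) {e : κ → ι} (he : Injective e) :
    SumBigO (fun x i => f x (e i)) S := by
  obtain ⟨A, hA, hf⟩ := hf
  exact ⟨A, hA, fun x => (hf x).comp_injective he⟩

lemma conv {f : D → ℤ × ℤ → ℝ} (hf : SumBigO f S) {c : D → ℤ → ℝ} {C : ℝ} (hC : 0 ≤ C)
    (hc : ∀ x, SumLE (c x) C) :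
    SumBigO (fun x (p : ℤ × ℤ) => ∑' l, c x l * f x (p.1 - l, p.2)) S := by
  obtain ⟨A, hA, hf⟩ := hf
  exact ⟨C * A, mul_nonneg hC hA, fun x => by rw [mul_assoc]; exact ((hf x).conv (hc x)).1⟩

lemma finset_conv {f : D → ℤ × ℤ → ℝ} (hf : SumBigO f S) {c : D → ℤ → ℝ} {s : D → Finset ℤ}
    {C : ℝ} (hC : 0 ≤ C) (hc0 : ∀ x l, 0 ≤ c x l) (hc : ∀ x, ∑ l ∈ s x, c x l ≤ C) :
    SumBigO (fun x (p : ℤ × ℤ) => ∑ l ∈ s x, c x l * f x (p.1 - l, p.2)) S := by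
  obtain ⟨A, hA, hf⟩ := hf
  exact ⟨C * A, mul_nonneg hC hA, fun x => by
    rw [mul_assoc]; exact (hf x).finset_conv (hc0 x) (hc x)⟩

/-- Convolution with a finitely supported kernel in a weighted space whose weight varies slowly. -/
lemma weighted_conv {f : D → ℤ × ℤ → ℝ} {c : D → ℤ → ℝ} {s : D → Finset ℤ} {ψ φ : D → ℤ → ℝ}
    (hf : SumBigO (fun x p => φ x p.1 * f x p) S) (hf0 : ∀ x p, 0 ≤ f x p)
    {C K : ℝ} (hC : 0 ≤ C) (hK : 0 ≤ K) (hc0 : ∀ x l, 0 ≤ c x l)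
    (hc : ∀ x, ∑ l ∈ s x, c x l ≤ C) (hψ0 : ∀ x n, 0 ≤ ψ x n)
    (hψ : ∀ x, ∀ n, ∀ l ∈ s x, ψ x n ≤ K * φ x (n - l)) :
    SumBigO (fun x (p : ℤ × ℤ) => ψ x p.1 * ∑ l ∈ s x, c x l * f x (p.1 - l, p.2)) S := by
  refine (hf.finset_conv hC hc0 hc).mono K hK (fun x p => mul_nonneg (hψ0 _ _)
    (Finset.sum_nonneg fun l _ => mul_nonneg (hc0 x l) (hf0 _ _))) fun x p => ?_
  rw [Finset.mul_sum, Finset.mul_sum]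
  refine Finset.sum_le_sum fun l hl => ?_
  -- The weight at n is exchanged for the weight at n - l term by term, so that it can be absorbed
  -- into the convolved family.
  have := mul_le_mul_of_nonneg_right (hψ x p.1 l hl)
    (mul_nonneg (hc0 x l) (hf0 x (p.1 - l, p.2)))
  calc _ ≤ _ := this
    _ = _ := by ring

end SumBigO

end SpaceTimeResonators

/-! ### One-dimensional interpolation inequalities. -/

namespace SpaceTimeResonators

open Set MeasureTheory intervalIntegral

section Interpolation

variable {f f1 f2 : ℝ → ℂ} {a b : ℝ}

lemma norm_sub_le_integral_norm_deriv (h1 : ∀ x, HasDerivAt f1 (f2 x) x) (h2 : Continuous f2)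
    {x y : ℝ} (hx : x ∈ Icc a b) (hy : y ∈ Icc a b) :
    ‖f1 y - f1 x‖ ≤ ∫ s in a..b, ‖f2 s‖ := by
  rw [← integral_eq_sub_of_hasDerivAt (fun z _ => h1 z) (h2.intervalIntegrable x y)]
  refine norm_integral_le_abs_integral_norm.trans ?_
  have hab := hx.1.trans hx.2
  refine abs_integral_mono_interval (f := fun s => ‖f2 s‖) (c := a) (d := b) ?_ ?_ (h2.norm.intervalIntegrable _ _)
    |>.trans (le_of_eq ?_)
  · rw [uIoc_of_le hab]
    exact (Ioc_subset_Ioc (le_min hx.1 hy.1) (max_le hx.2 hy.2))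
  · exact Filter.Eventually.of_forall fun s => norm_nonneg _
  · exact abs_of_nonneg (integral_nonneg hab fun s _ => norm_nonneg _)

/-- Mean value inequality for f(s) - s z. The choice z = 0 gives a Lipschitz bound, and taking for z
a value of the derivative gives a first-order Taylor bound. -/
lemma norm_sub_sub_mul_le (h0 : ∀ x, HasDerivAt f (f1 x) x) {B : ℝ} {z : ℂ}
    (hB : ∀ x ∈ Icc a b, ‖f1 x - z‖ ≤ B) {x y : ℝ} (hx : x ∈ Icc a b) (hy : y ∈ Icc a b) :
    ‖f y - f x - (y - x) * z‖ ≤ B * |y - x| := by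
  have := (convex_Icc a b).norm_image_sub_le_of_norm_hasDerivWithin_le
    (f := fun s : ℝ => f s - s * z) (f' := fun s => f1 s - z) (C := B)
    (fun s _ => by
      have := ((h0 s).fun_sub ((ofRealCLM.hasDerivAt (x := s)).mul_const z)).hasDerivWithinAt
        (s := Icc a b)
      simpa using this)
    hB hx hy
  rw [Real.norm_eq_abs] at this
  refine le_of_eq_of_le ?_ this
  congr 1
  ring

/-- The difference quotient of f with step h/2 differs from f'(x) by at most ∫ |f''|. Averaging over
the starting point p in the left half, p and p + h/2 together sweep the interval once, which
produces the L¹ norm of f; the constant 4/h² is (h/2)⁻². -/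
lemma norm_deriv_le_interpolation (hab : a < b) (h0 : ∀ x, HasDerivAt f (f1 x) x)
    (h1 : ∀ x, HasDerivAt f1 (f2 x) x) (h2 : Continuous f2) {x : ℝ} (hx : x ∈ Icc a b) :
    ‖f1 x‖ ≤ 4 / (b - a) ^ 2 * (∫ s in a..b, ‖f s‖) + ∫ s in a..b, ‖f2 s‖ := by
  set B := ∫ s in a..b, ‖f2 s‖
  set h := b - a with hh
  have hpos : 0 < h := sub_pos.2 hab
  have hf : Continuous f := continuous_iff_continuousAt.2 fun x => (h0 x).continuousAt
  have key : ∀ p ∈ Icc a (a + h / 2), h / 2 * ‖f1 x‖ - B * (h / 2) ≤ ‖f p‖ + ‖f (p + h / 2)‖ := by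
    intro p hp
    have hp1 : p ∈ Icc a b := ⟨hp.1, by linarith [hp.2]⟩
    have hp2 : p + h / 2 ∈ Icc a b := ⟨by linarith [hp.1], by linarith [hp.2]⟩
    have := norm_sub_sub_mul_le h0 (z := f1 x)
      (fun y hy => norm_sub_le_integral_norm_deriv h1 h2 hx hy) hp1 hp2
    rw [add_sub_cancel_left, abs_of_pos (by positivity)] at this
    have e : ((p + h / 2 : ℝ) - p : ℂ) * f1 x = ((h / 2 : ℝ) : ℂ) * f1 x := by push_cast; ring
    rw [e] at this
    have n1 : ‖((h / 2 : ℝ) : ℂ) * f1 x‖ = h / 2 * ‖f1 x‖ := by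
      rw [norm_mul, norm_real, Real.norm_of_nonneg (by positivity)]
    have n2 : ‖((h / 2 : ℝ) : ℂ) * f1 x‖ ≤ ‖f (p + h / 2) - f p‖
        + ‖f (p + h / 2) - f p - ((h / 2 : ℝ) : ℂ) * f1 x‖ := by
      have := norm_sub_le (f (p + h / 2) - f p)
        (f (p + h / 2) - f p - ((h / 2 : ℝ) : ℂ) * f1 x)
      simpa using this
    linarith [norm_sub_le (f (p + h / 2)) (f p)]
  have i1 : IntervalIntegrable (fun p => ‖f p‖) volume a (a + h / 2) :=
    hf.norm.intervalIntegrable _ _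
  have i2 : IntervalIntegrable (fun p => ‖f (p + h / 2)‖) volume a (a + h / 2) :=
    (hf.comp (continuous_id.add continuous_const)).norm.intervalIntegrable _ _
  have int := integral_mono_on (by linarith : a ≤ a + h / 2)
    (continuous_const.intervalIntegrable _ _) (i1.add i2) key
  rw [intervalIntegral.integral_const, intervalIntegral.integral_add i1 i2,
    integral_comp_add_right (fun p => ‖f p‖) (h / 2), smul_eq_mul,
    show a + h / 2 + h / 2 = b by rw [hh]; ring,
    integral_add_adjacent_intervals i1 (hf.norm.intervalIntegrable _ _)] at int
  have e : (a + h / 2 - a) * (h / 2 * ‖f1 x‖ - B * (h / 2)) = (h / 2) ^ 2 * (‖f1 x‖ - B) := by ring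
  rw [e] at int
  have : ‖f1 x‖ - B ≤ (∫ s in a..b, ‖f s‖) / (h / 2) ^ 2 := by
    rw [le_div_iff₀ (by positivity)]; linarith
  have e2 : (∫ s in a..b, ‖f s‖) / (h / 2) ^ 2 = 4 / h ^ 2 * (∫ s in a..b, ‖f s‖) := by
    field_simp; ring
  linarith

lemma norm_le_interpolation (hab : a < b) (h0 : ∀ x, HasDerivAt f (f1 x) x) {B : ℝ}
    (hB : ∀ x ∈ Icc a b, ‖f1 x‖ ≤ B) {x : ℝ} (hx : x ∈ Icc a b) :
    ‖f x‖ ≤ 1 / (b - a) * (∫ s in a..b, ‖f s‖) + (b - a) * B := by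
  have hf : Continuous f := continuous_iff_continuousAt.2 fun x => (h0 x).continuousAt
  have hpos : 0 < b - a := sub_pos.2 hab
  have hB0 : 0 ≤ B := (norm_nonneg _).trans (hB x hx)
  have key : ∀ p ∈ Icc a b, ‖f x‖ - (b - a) * B ≤ ‖f p‖ := by
    intro p hp
    have := norm_sub_sub_mul_le h0 (z := 0) (fun y hy => by simpa using hB y hy) hp hx
    rw [mul_zero, sub_zero] at this
    have h3 : B * |x - p| ≤ (b - a) * B := by
      rw [mul_comm]
      exact mul_le_mul_of_nonneg_right
        (abs_sub_le_iff.2 ⟨by linarith [hx.2, hp.1], by linarith [hx.1, hp.2]⟩) hB0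
    have := norm_sub_norm_le (f x) (f p)
    linarith
  have int := integral_mono_on hab.le (continuous_const.intervalIntegrable (μ := volume) _ _)
    (hf.norm.intervalIntegrable _ _) key
  rw [intervalIntegral.integral_const, smul_eq_mul] at int
  have : ‖f x‖ - (b - a) * B ≤ (∫ s in a..b, ‖f s‖) / (b - a) := by
    rw [le_div_iff₀ hpos]; linarith
  rw [one_div, inv_mul_eq_div]
  linarith

lemma norm_sub_mean_le (hab : a < b) (h0 : ∀ x, HasDerivAt f (f1 x) x) {B : ℝ}
    (hB : ∀ x ∈ Icc a b, ‖f1 x‖ ≤ B) {x : ℝ} (hx : x ∈ Icc a b) :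
    ‖f x - (1 / (b - a) : ℝ) * ∫ s in a..b, f s‖ ≤ (b - a) * B := by
  have hf : Continuous f := continuous_iff_continuousAt.2 fun x => (h0 x).continuousAt
  have hpos : 0 < b - a := sub_pos.2 hab
  have hB0 : 0 ≤ B := (norm_nonneg _).trans (hB x hx)
  have hne : ((b - a : ℝ) : ℂ) ≠ 0 := by exact_mod_cast hpos.ne'
  have e : f x - (1 / (b - a) : ℝ) * ∫ s in a..b, f s
      = (1 / (b - a) : ℝ) * ∫ s in a..b, (f x - f s) := by
    rw [intervalIntegral.integral_sub (continuous_const.intervalIntegrable _ _)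
      (hf.intervalIntegrable _ _), intervalIntegral.integral_const, mul_sub, real_smul, ← mul_assoc, one_div,
      ofReal_inv, inv_mul_cancel₀ hne, one_mul]
  rw [e, norm_mul, norm_real, Real.norm_of_nonneg (by positivity)]
  have : ‖∫ s in a..b, (f x - f s)‖ ≤ (b - a) * B * |b - a| := by
    refine norm_integral_le_of_norm_le_const fun s hs => ?_
    rw [uIoc_of_le hab.le] at hs
    have hp : s ∈ Icc a b := ⟨hs.1.le, hs.2⟩
    have := norm_sub_sub_mul_le h0 (z := 0) (fun y hy => by simpa using hB y hy) hp hx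
    rw [mul_zero, sub_zero] at this
    refine this.trans ?_
    rw [mul_comm]
    exact mul_le_mul_of_nonneg_right
      (abs_sub_le_iff.2 ⟨by linarith [hx.2, hs.1], by linarith [hx.1, hs.2]⟩) hB0
  rw [abs_of_pos hpos] at this
  calc _ ≤ 1 / (b - a) * ((b - a) * B * (b - a)) := by gcongr
    _ = (b - a) * B := by field_simp

/-- A solution of `f'' = -μ f` with `|μ| (b - a)² ≤ 1/2` has almost constant slope. -/
lemma norm_deriv_sub_slope_le (hab : a < b) (h0 : ∀ x, HasDerivAt f (f1 x) x)
    (h1 : ∀ x, HasDerivAt f1 (f2 x) x) {μ : ℂ} (hμ : ‖μ‖ * (b - a) ^ 2 ≤ 1 / 2)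
    (h2 : ∀ x ∈ Icc a b, f2 x = -(μ * f x)) {x : ℝ} (hx : x ∈ Icc a b) :
    ‖f1 x - (f b - f a) / ((b - a : ℝ) : ℂ)‖ ≤ 4 * (b - a) * ‖μ‖ * (‖f a‖ + ‖f b‖) := by
  have hf : Continuous f := continuous_iff_continuousAt.2 fun x => (h0 x).continuousAt
  set h := b - a with hh
  have hpos : 0 < h := sub_pos.2 hab
  have hne : (h : ℂ) ≠ 0 := by exact_mod_cast hpos.ne'
  obtain ⟨x0, hx0, hmax⟩ := isCompact_Icc.exists_isMaxOn (nonempty_Icc.2 hab.le)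
    hf.norm.continuousOn
  set F := ‖f x0‖
  have hF : ∀ y ∈ Icc a b, ‖f y‖ ≤ F := fun y hy => hmax hy
  have ha : a ∈ Icc a b := left_mem_Icc.2 hab.le
  have hb : b ∈ Icc a b := right_mem_Icc.2 hab.le
  have hd : ∀ y ∈ Icc a b, ∀ z ∈ Icc a b, ‖f1 z - f1 y‖ ≤ h * (‖μ‖ * F) := by
    intro y hy z hz
    have := (convex_Icc a b).norm_image_sub_le_of_norm_hasDerivWithin_le
      (f := f1) (f' := f2) (C := ‖μ‖ * F) (fun s _ => (h1 s).hasDerivWithinAt)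
      (fun s hs => by
        rw [h2 s hs, norm_neg, norm_mul]
        exact mul_le_mul_of_nonneg_left (hF s hs) (norm_nonneg _)) hy hz
    refine this.trans ?_
    rw [mul_comm]
    refine mul_le_mul_of_nonneg_right ?_ (by positivity)
    rw [Real.norm_eq_abs]
    exact abs_sub_le_iff.2 ⟨by linarith [hz.2, hy.1], by linarith [hz.1, hy.2]⟩
  have hslope : ∀ y ∈ Icc a b, ‖f1 y - (f b - f a) / (h : ℂ)‖ ≤ h * (‖μ‖ * F) := by
    intro y hy
    have := norm_sub_sub_mul_le h0 (z := f1 y) (fun z hz => hd y hy z hz) ha hb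
    have e : f b - f a - (b - a) * f1 y = -((h : ℂ) * (f1 y - (f b - f a) / (h : ℂ))) := by
      rw [mul_sub, mul_div_cancel₀ _ hne, hh]; push_cast; ring
    rw [e, norm_neg, norm_mul, norm_real, Real.norm_of_nonneg hpos.le, abs_of_pos hpos,
      mul_comm] at this
    exact le_of_mul_le_mul_right this hpos
  have hsl : ‖(f b - f a) / (h : ℂ)‖ * h ≤ ‖f a‖ + ‖f b‖ := by
    rw [norm_div, norm_real, Real.norm_of_nonneg hpos.le, div_mul_cancel₀ _ hpos.ne']
    linarith [norm_sub_le (f b) (f a)]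
  -- Absorption: F ≤ ‖f a‖ + (‖f a‖ + ‖f b‖) + F/2, where the last term comes from |μ| h² ≤ 1/2.
  -- This is where closeness to a Dirichlet eigenvalue of the interval is excluded.
  have hF2 : F ≤ 4 * (‖f a‖ + ‖f b‖) := by
    have hB : ∀ y ∈ Icc a b, ‖f1 y - 0‖ ≤ ‖(f b - f a) / (h : ℂ)‖ + h * (‖μ‖ * F) := by
      intro y hy
      rw [sub_zero]
      have := norm_sub_norm_le (f1 y) ((f b - f a) / (h : ℂ))
      linarith [hslope y hy]
    have := norm_sub_sub_mul_le h0 (z := 0) hB ha hx0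
    rw [mul_zero, sub_zero] at this
    have h3 : |x0 - a| ≤ h := abs_sub_le_iff.2 ⟨by linarith [hx0.2], by linarith [hx0.1]⟩
    have h4 := mul_le_mul_of_nonneg_left h3
      ((norm_nonneg _).trans (hB a ha))
    have h5 := norm_sub_norm_le (f x0) (f a)
    have h6 : (‖(f b - f a) / (h : ℂ)‖ + h * (‖μ‖ * F)) * h
      ≤ (‖f a‖ + ‖f b‖) + 1 / 2 * F := by
      have : ‖μ‖ * h ^ 2 * F ≤ 1 / 2 * F := mul_le_mul_of_nonneg_right hμ (norm_nonneg _)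
      nlinarith
    have h7 : F - ‖f a‖ ≤ (‖f a‖ + ‖f b‖) + 1 / 2 * F := by linarith
    linarith [norm_nonneg (f b)]
  calc _ ≤ _ := hslope x hx
    _ ≤ h * (‖μ‖ * (4 * (‖f a‖ + ‖f b‖))) := by gcongr
    _ = _ := by ring

end Interpolation

end SpaceTimeResonators

/-! ### Mode systems and the sums of their majorants. -/

noncomputable section

namespace SpaceTimeResonators

open Set

/-- The modes `A k n` in the resonators `(xl k, xr k)` and `B k n` in the gaps
`(xr k, xl (k + 1))` of a wave field, with their first two derivatives, the Fourier coefficients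
`κ k`, `σ k` and `s k` of `1 / κ`, `1 / s` and `s`, and the equations and bounds that they
satisfy in the high-contrast subwavelength regime. -/
structure ModeSystem (xl xr : ℤ → ℝ) (v₀ c C : ℝ) where
  d : ℝ
  ε : ℝ
  S : ℝ
  w : ℤ → ℂ
  M : ℕ
  A : ℤ → ℤ → ℝ → ℂ
  A1 : ℤ → ℤ → ℝ → ℂ
  A2 : ℤ → ℤ → ℝ → ℂ
  B : ℤ → ℤ → ℝ → ℂ
  B1 : ℤ → ℤ → ℝ → ℂ
  B2 : ℤ → ℤ → ℝ → ℂ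
  δ : ℤ → ℝ
  r : ℤ → ℝ
  κ : ℤ → ℤ → ℂ
  σ : ℤ → ℤ → ℂ
  s : ℤ → ℤ → ℂ
  cκ : ℤ → ℝ
  cσ : ℤ → ℝ
  cs : ℤ → ℝ
  d_pos : 0 < d
  ε_pos : 0 < ε
  ε_le_one : ε ≤ 1
  d_le : d ≤ ε ^ 2
  S_nonneg : 0 ≤ S
  small : 8 * (C * ε) ≤ c
  shift : ∀ n, ∀ l ∈ Finset.Icc (-(M : ℤ)) M, ‖w n‖ ≤ ‖w (n - l)‖ + C * ε
  low : ∀ n : ℤ, ¬ (M : ℤ) < |n| → ‖w n‖ ≤ C * ε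
  r_nonneg : ∀ k, 0 ≤ r k
  r_le : ∀ k, r k ≤ C
  δ_le : ∀ k, δ k ≤ C * d
  δ_ge : ∀ k, d ≤ C * δ k
  κ_le : ∀ k l, ‖κ k l‖ ≤ cκ l
  σ_le : ∀ k l, ‖σ k l‖ ≤ cσ l
  s_le : ∀ k l, ‖s k l‖ ≤ cs l
  cκ_sum : ∑ l ∈ Finset.Icc (-(M : ℤ)) M, cκ l ≤ C
  cσ_sum : ∑ l ∈ Finset.Icc (-(M : ℤ)) M, cσ l ≤ C
  cs_sum : SumLE cs C
  hasDeriv_A : ∀ k n x, HasDerivAt (A k n) (A1 k n x) x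
  hasDeriv_A1 : ∀ k n x, HasDerivAt (A1 k n) (A2 k n x) x
  continuous_A2 : ∀ k n, Continuous (A2 k n)
  hasDeriv_B : ∀ k n x, HasDerivAt (B k n) (B1 k n x) x
  hasDeriv_B1 : ∀ k n x, HasDerivAt (B1 k n) (B2 k n x) x
  resonator : ∀ k n, ∀ x ∈ Icc (xl k) (xr k), A2 k n x
    = -(r k * (w n * ∑ l ∈ Finset.Icc (-(M : ℤ)) M, κ k l * (w (n - l) * A k (n - l) x)))
  background : ∀ k n, ∀ x ∈ Icc (xr k) (xl (k + 1)), B2 k n x = -((w n / v₀) ^ 2 * B k n x)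
  trace_right : ∀ k n, B k n (xr k)
    = ∑ l ∈ Finset.Icc (-(M : ℤ)) M, σ k l * A k (n - l) (xr k)
  trace_left : ∀ k n, B k n (xl (k + 1))
    = ∑ l ∈ Finset.Icc (-(M : ℤ)) M, σ (k + 1) l * A (k + 1) (n - l) (xl (k + 1))
  flux_right : ∀ k n, δ k * B1 k n (xr k)
    = ∑ l ∈ Finset.Icc (-(M : ℤ)) M, σ k l * A1 k (n - l) (xr k)
  flux_left : ∀ k n, δ (k + 1) * B1 k n (xl (k + 1))
    = ∑ l ∈ Finset.Icc (-(M : ℤ)) M, σ (k + 1) l * A1 (k + 1) (n - l) (xl (k + 1))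
  flux_right_inv : ∀ k n, A1 k n (xr k) = δ k * ∑' l, s k l * B1 k (n - l) (xr k)
  sum_le : SumLE (fun p : ℤ × ℤ => ∫ x in xl p.2..xr p.2, ‖A p.2 p.1 x‖) (C * S)
  tail_le : SumLE (fun p : ℤ × ℤ => if (M : ℤ) < |p.1| then
    (1 + ‖w p.1‖ ^ 2 / d) * ∫ x in xl p.2..xr p.2, ‖A p.2 p.1 x‖ else 0) (C * ε * S)

/-- The resonators and the gaps between them have lengths in `[h₀, h₁]`. -/
structure LengthBounds (xl xr : ℤ → ℝ) (h₀ h₁ : ℝ) : Prop where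
  pos : 0 < h₀
  le_len : ∀ k, h₀ ≤ xr k - xl k
  len_le : ∀ k, xr k - xl k ≤ h₁
  le_gap : ∀ k, h₀ ≤ xl (k + 1) - xr k
  gap_le : ∀ k, xl (k + 1) - xr k ≤ h₁

namespace ModeSystem

variable {xl xr : ℤ → ℝ} {v₀ c C h₀ h₁ : ℝ} (X : ModeSystem xl xr v₀ c C)

def b (p : ℤ × ℤ) : ℝ := ∫ x in xl p.2..xr p.2, ‖X.A p.2 p.1 x‖

/-- The weight `|ω_n|² + ε²`. -/
def W (n : ℤ) : ℝ := ‖X.w n‖ ^ 2 + X.ε ^ 2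

/-- The weight `min (|ω_n|² + ε², 1)`. -/
def minW (n : ℤ) : ℝ := min (X.W n) 1

/-- The indicator function of the frequencies `|ω_n| > t`. -/
def hi (t : ℝ) (n : ℤ) : ℝ := if t < ‖X.w n‖ then 1 else 0

def band : Finset ℤ := Finset.Icc (-(X.M : ℤ)) X.M

/-- Majorant of the `L¹` norm of `A2` in the resonators. -/
def q (p : ℤ × ℤ) : ℝ := ∑ l ∈ X.band, X.cκ l * (X.W (p.1 - l) * X.b (p.1 - l, p.2))

/-- Majorant of `A` and `A1` in the resonators. -/
def a (p : ℤ × ℤ) : ℝ := X.b p + X.q p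

/-- Majorant of the traces of `B` at the resonators. -/
def τ (p : ℤ × ℤ) : ℝ := ∑ l ∈ X.band, X.cσ l * X.a (p.1 - l, p.2)

/-- Majorant of the deviation of `B1` from a constant. -/
def gapErr (p : ℤ × ℤ) : ℝ :=
  (X.minW p.1 + 1 / X.d * X.hi c p.1) * (X.τ p + X.τ (p.1, p.2 + 1))

/-- Majorant of `B1` at the ends of the gaps. -/
def fluxMaj (p : ℤ × ℤ) : ℝ := X.gapErr p + (X.τ p + X.τ (p.1, p.2 + 1))

/-- Majorant of `A1` in the resonators, which takes the high contrast into account. -/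
def z (p : ℤ × ℤ) : ℝ := X.d * (∑' l, X.cs l * X.fluxMaj (p.1 - l, p.2)) + X.q p

def mean (k n : ℤ) : ℂ := (1 / (xr k - xl k) : ℝ) * ∫ x in xl k..xr k, X.A k n x

/-- The mean values of the modes, transferred to the exterior traces. -/
def outer (k n : ℤ) : ℂ := ∑ l ∈ X.band, X.σ k l * X.mean k (n - l)

def outerErr (p : ℤ × ℤ) : ℝ := ∑ l ∈ X.band, X.cσ l * X.z (p.1 - l, p.2)

section

include X

lemma d_le_one : X.d ≤ 1 :=
  X.d_le.trans (pow_le_one₀ X.ε_pos.le X.ε_le_one)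

lemma C_nonneg : 0 ≤ C := (Finset.sum_nonneg fun l _ => (norm_nonneg _).trans (X.κ_le 0 l)).trans
  X.cκ_sum

lemma cκ_nonneg (l : ℤ) : 0 ≤ X.cκ l := (norm_nonneg _).trans (X.κ_le 0 l)

lemma cσ_nonneg (l : ℤ) : 0 ≤ X.cσ l := (norm_nonneg _).trans (X.σ_le 0 l)

lemma b_nonneg (p : ℤ × ℤ) : 0 ≤ X.b p := X.sum_le.1 p

lemma W_nonneg (n : ℤ) : 0 ≤ X.W n := by unfold W; positivity

lemma minW_nonneg (n : ℤ) : 0 ≤ X.minW n := le_min (X.W_nonneg n) zero_le_one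

lemma hi_nonneg (t : ℝ) (n : ℤ) : 0 ≤ X.hi t n := by unfold hi; split_ifs <;> simp

/-- Convolution over the band moves |ω_n| by at most C ε ≤ c/8. The cutoffs c/2, 3c/4 and c below
leave room for one convolution each. -/
lemma hi_shift {t t' : ℝ} (ht : t' + C * X.ε ≤ t) (n : ℤ) : ∀ l ∈ X.band,
    X.hi t n ≤ 1 * X.hi t' (n - l) := by
  intro l hl
  have := X.shift n l hl
  unfold hi
  split_ifs <;> linarith

lemma Wb_nonneg (p : ℤ × ℤ) : 0 ≤ X.W p.1 * X.b p := mul_nonneg (X.W_nonneg _) (X.b_nonneg _)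

lemma q_nonneg (p : ℤ × ℤ) : 0 ≤ X.q p :=
  Finset.sum_nonneg fun l _ => mul_nonneg (X.cκ_nonneg l) (X.Wb_nonneg (p.1 - l, p.2))

lemma a_nonneg (p : ℤ × ℤ) : 0 ≤ X.a p := add_nonneg (X.b_nonneg p) (X.q_nonneg p)

lemma τ_nonneg (p : ℤ × ℤ) : 0 ≤ X.τ p :=
  Finset.sum_nonneg fun l _ => mul_nonneg (X.cσ_nonneg l) (X.a_nonneg _)

lemma gapErr_nonneg (p : ℤ × ℤ) : 0 ≤ X.gapErr p :=
  mul_nonneg (add_nonneg (X.minW_nonneg _)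
    (mul_nonneg (one_div_nonneg.2 X.d_pos.le) (X.hi_nonneg _ _)))
    (add_nonneg (X.τ_nonneg _) (X.τ_nonneg _))

lemma fluxMaj_nonneg (p : ℤ × ℤ) : 0 ≤ X.fluxMaj p :=
  add_nonneg (X.gapErr_nonneg p) (add_nonneg (X.τ_nonneg _) (X.τ_nonneg _))

lemma z_nonneg (p : ℤ × ℤ) : 0 ≤ X.z p :=
  add_nonneg (mul_nonneg X.d_pos.le (tsum_nonneg fun l =>
    mul_nonneg (X.cs_sum.1 l) (X.fluxMaj_nonneg _))) (X.q_nonneg p)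

end

section Sums

variable (hC : 0 ≤ C)
include hC

lemma sumBigO_b : SumBigO (fun (X : ModeSystem xl xr v₀ c C) p => X.b p) fun X => X.S :=
  ⟨C, hC, fun X => X.sum_le⟩

lemma sumBigO_tail : SumBigO (fun (X : ModeSystem xl xr v₀ c C) (p : ℤ × ℤ) =>
    if (X.M : ℤ) < |p.1| then (1 + ‖X.w p.1‖ ^ 2 / X.d) * X.b p else 0) fun X => X.ε * X.S :=
  ⟨C, hC, fun X => by rw [← mul_assoc]; exact X.tail_le⟩

/-- For |n| ≤ M the weight itself is O(ε²). For |n| > M one has |ω_n|² ≤ d (1 + |ω_n|²/d), so d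
times the tail bound applies, and d ε S ≤ ε² S. -/
lemma sumBigO_W_b : SumBigO (fun (X : ModeSystem xl xr v₀ c C) p => X.W p.1 * X.b p)
    fun X => X.ε ^ 2 * X.S := by
  have h1 := (sumBigO_b (xl := xl) (xr := xr) (v₀ := v₀) (c := c) hC).scale
    (a := fun X => X.ε ^ 2) fun X => by positivity
  have h2 := ((sumBigO_tail (xl := xl) (xr := xr) (v₀ := v₀) (c := c) hC).scale
    (a := fun X => X.d) fun X => X.d_pos.le).mono_right (T := fun X => X.ε ^ 2 * X.S) 1 zero_le_one
    fun X => by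
      rw [one_mul]
      refine mul_le_mul X.d_le ?_ (mul_nonneg X.ε_pos.le X.S_nonneg) (by positivity)
      exact mul_le_of_le_one_left X.S_nonneg X.ε_le_one
  refine (h1.add h2).mono (C ^ 2 + 1) (by positivity) (fun X p => X.Wb_nonneg p) fun X p => ?_
  have hb := X.b_nonneg p
  have hd := X.d_pos
  split_ifs with h
  · have e : X.d * ((1 + ‖X.w p.1‖ ^ 2 / X.d) * X.b p) = (X.d + ‖X.w p.1‖ ^ 2) * X.b p := by
      field_simp
    rw [e, W]
    have h3 : (‖X.w p.1‖ ^ 2 + X.ε ^ 2) * X.b p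
      ≤ X.ε ^ 2 * X.b p + (X.d + ‖X.w p.1‖ ^ 2) * X.b p := by nlinarith
    refine h3.trans (le_mul_of_one_le_left (by positivity) (by nlinarith [sq_nonneg C]))
  · have := X.low _ h
    have h4 : ‖X.w p.1‖ ^ 2 ≤ (C * X.ε) ^ 2 := pow_le_pow_left₀ (norm_nonneg _) this 2
    rw [mul_zero, add_zero, ← mul_assoc, W]
    exact mul_le_mul_of_nonneg_right (by nlinarith) hb

/-- Frequencies above c/2 lie in the tail |n| > M, since the others are at most C ε ≤ c/8. There
|ω_n|² is bounded below, so the weight |ω_n|²/d of the tail hypothesis yields a gain of a factor d.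
This gain later compensates the division by the contrast. -/
lemma sumBigO_hi_b (hc : 0 < c) : SumBigO (fun (X : ModeSystem xl xr v₀ c C) p =>
    X.hi (c / 2) p.1 * (X.b p + X.W p.1 * X.b p)) fun X => X.d * (X.ε * X.S) := by
  refine ((sumBigO_tail (xl := xl) (xr := xr) (v₀ := v₀) (c := c) hC).scale
    (a := fun X => X.d) fun X => X.d_pos.le).mono (8 / c ^ 2 + 1) (by positivity)
    (fun X p => mul_nonneg (X.hi_nonneg _ _) (add_nonneg (X.b_nonneg p) (X.Wb_nonneg p)))
    fun X p => ?_
  have hb := X.b_nonneg p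
  have hd := X.d_pos
  have hsm := X.small
  have hε := X.ε_pos
  unfold hi
  split_ifs with h h2 h2
  · have e : X.d * ((1 + ‖X.w p.1‖ ^ 2 / X.d) * X.b p) = (X.d + ‖X.w p.1‖ ^ 2) * X.b p := by
      field_simp
    rw [e, W, one_mul, ← mul_assoc, ← one_add_mul]
    refine mul_le_mul_of_nonneg_right ?_ hb
    have h5 : c ^ 2 / 4 ≤ ‖X.w p.1‖ ^ 2 := by
      have := pow_le_pow_left₀ (by positivity) h.le 2
      linarith [show (c / 2) ^ 2 = c ^ 2 / 4 by ring]
    have h6 : 2 ≤ 8 / c ^ 2 * ‖X.w p.1‖ ^ 2 := by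
      rw [div_mul_eq_mul_div, le_div_iff₀ (by positivity)]; linarith
    have h7 : X.ε ^ 2 ≤ 1 := pow_le_one₀ hε.le X.ε_le_one
    have h8 : 0 ≤ (8 / c ^ 2 + 1) * X.d := by positivity
    nlinarith
  · have := X.low _ h2
    have : 0 ≤ C * X.ε := by positivity
    linarith
  · rw [zero_mul]; positivity
  · simp

lemma sumBigO_q : SumBigO (fun (X : ModeSystem xl xr v₀ c C) p => X.q p)
    fun X => X.ε ^ 2 * X.S :=
  (sumBigO_W_b hC).finset_conv hC (fun X => X.cκ_nonneg) fun X => X.cκ_sum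

lemma sumBigO_hi_q (hc : 0 < c) : SumBigO (fun (X : ModeSystem xl xr v₀ c C) p =>
    X.hi (3 / 4 * c) p.1 * X.q p) fun X => X.d * (X.ε * X.S) := by
  refine SumBigO.weighted_conv (f := fun (X : ModeSystem xl xr v₀ c C) p => X.W p.1 * X.b p)
    (φ := fun X => X.hi (c / 2)) (K := 1) ?_ (fun X p => X.Wb_nonneg p) hC zero_le_one
    (fun X => X.cκ_nonneg) (fun X => X.cκ_sum) (fun X => X.hi_nonneg _) fun X n l hl => ?_
  · refine (sumBigO_hi_b hC hc).mono 1 zero_le_one (fun X p =>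
      mul_nonneg (X.hi_nonneg _ _) (X.Wb_nonneg p)) fun X p => ?_
    rw [one_mul]
    exact mul_le_mul_of_nonneg_left (le_add_of_nonneg_left (X.b_nonneg p)) (X.hi_nonneg _ _)
  · exact X.hi_shift (by linarith [X.small]) n l hl

lemma sumBigO_a : SumBigO (fun (X : ModeSystem xl xr v₀ c C) p => X.a p) fun X => X.S :=
  (sumBigO_b hC).add ((sumBigO_q hC).mono_right 1 zero_le_one fun X => by
    rw [one_mul]
    exact mul_le_of_le_one_left X.S_nonneg (pow_le_one₀ X.ε_pos.le X.ε_le_one))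

lemma sumBigO_hi_a (hc : 0 < c) : SumBigO (fun (X : ModeSystem xl xr v₀ c C) p =>
    X.hi (3 / 4 * c) p.1 * X.a p) fun X => X.d * (X.ε * X.S) := by
  refine ((sumBigO_hi_b hC hc).add (sumBigO_hi_q hC hc)).mono 1 zero_le_one (fun X p =>
      mul_nonneg (X.hi_nonneg _ _) (X.a_nonneg p)) fun X p => ?_
  rw [one_mul, a, mul_add]
  refine add_le_add_left ?_ _
  refine mul_le_mul ?_ (le_add_of_nonneg_right (X.Wb_nonneg p)) (X.b_nonneg p) (X.hi_nonneg _ _)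
  unfold hi
  split_ifs <;> linarith

/-- The truncation of the weight at 1 is needed for the part `q`, which is already O(ε² S) but for
which no further power of the frequency is controlled. -/
lemma sumBigO_minW_a : SumBigO (fun (X : ModeSystem xl xr v₀ c C) p =>
    X.minW p.1 * X.a p) fun X => X.ε ^ 2 * X.S := by
  refine ((sumBigO_W_b hC).add (sumBigO_q hC)).mono 1 zero_le_one (fun X p =>
      mul_nonneg (X.minW_nonneg _) (X.a_nonneg p)) fun X p => ?_
  rw [one_mul, a, mul_add]
  exact add_le_add (mul_le_mul_of_nonneg_right (min_le_left _ _) (X.b_nonneg p))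
    (mul_le_of_le_one_left (X.q_nonneg p) (min_le_right _ _))

lemma sumBigO_τ : SumBigO (fun (X : ModeSystem xl xr v₀ c C) p => X.τ p) fun X => X.S :=
  (sumBigO_a hC).finset_conv hC (fun X => X.cσ_nonneg) fun X => X.cσ_sum

lemma sumBigO_hi_τ (hc : 0 < c) : SumBigO (fun (X : ModeSystem xl xr v₀ c C) p =>
    X.hi c p.1 * X.τ p) fun X => X.d * (X.ε * X.S) := by
  refine SumBigO.weighted_conv (K := 1) (sumBigO_hi_a hC hc) (fun X p => X.a_nonneg p) hC
    zero_le_one (fun X => X.cσ_nonneg) (fun X => X.cσ_sum) (fun X => X.hi_nonneg _)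
    fun X n l hl => X.hi_shift (by linarith [X.small, mul_nonneg hC X.ε_pos.le]) n l hl

lemma sumBigO_minW_τ : SumBigO (fun (X : ModeSystem xl xr v₀ c C) p =>
    X.minW p.1 * X.τ p) fun X => X.ε ^ 2 * X.S := by
  refine SumBigO.weighted_conv (K := 2 * C ^ 2 + 2) (sumBigO_minW_a hC) (fun X p => X.a_nonneg p)
    hC (by positivity) (fun X => X.cσ_nonneg) (fun X => X.cσ_sum) (fun X => X.minW_nonneg)
    fun X n l hl => ?_
  have h := X.shift n l hl
  -- The summand ε² in the weight makes it vary slowly over the band: |ω_n|² ≤ 2 |ω_{n-l}|² + 2 C²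
  -- ε².
  have h1 : X.W n ≤ (2 * C ^ 2 + 2) * X.W (n - l) := by
    unfold W
    have := pow_le_pow_left₀ (norm_nonneg _) h 2
    nlinarith [sq_nonneg (‖X.w (n - l)‖ - C * X.ε), sq_nonneg (C * ‖X.w (n - l)‖), sq_nonneg X.ε]
  unfold minW
  rcases le_total (X.W (n - l)) 1 with h2 | h2
  · rw [min_eq_left h2]
    exact (min_le_left _ _).trans h1
  · rw [min_eq_right h2]
    refine (min_le_right _ _).trans ?_
    nlinarith [sq_nonneg C]

/-- The low frequencies contribute O(ε² S). In the high ones the loss 1/d meets the bound d ε S of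
`sumBigO_hi_τ`. -/
lemma sumBigO_gapErr (hc : 0 < c) : SumBigO (fun (X : ModeSystem xl xr v₀ c C) p => X.gapErr p)
    fun X => X.ε * X.S := by
  have hinj : Injective fun p : ℤ × ℤ => (p.1, p.2 + 1) := by
    intro p q h
    simp only [Prod.mk.injEq, add_left_inj] at h
    exact Prod.ext h.1 h.2
  have h1 : SumBigO (fun (X : ModeSystem xl xr v₀ c C) p =>
      (X.minW p.1 + 1 / X.d * X.hi c p.1) * X.τ p) fun X => X.ε * X.S := by
    refine (((sumBigO_minW_τ hC).mono_right (T := fun X => X.ε * X.S) 1 zero_le_one fun X => ?_).add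
      (((sumBigO_hi_τ hC hc).scale (a := fun X => 1 / X.d)
        fun X => one_div_nonneg.2 X.d_pos.le).mono_right (T := fun X => X.ε * X.S)
        1 zero_le_one fun X => ?_)).mono 1 zero_le_one (fun X p => ?_) fun X p => ?_
    · rw [one_mul, sq, mul_assoc]
      exact mul_le_of_le_one_left (mul_nonneg X.ε_pos.le X.S_nonneg) X.ε_le_one
    · rw [one_mul, one_div, inv_mul_cancel_left₀ X.d_pos.ne']
    · exact mul_nonneg (add_nonneg (X.minW_nonneg _)
        (mul_nonneg (one_div_nonneg.2 X.d_pos.le) (X.hi_nonneg _ _))) (X.τ_nonneg _)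
    · exact le_of_eq (by ring)
  refine (h1.add (h1.comp_injective hinj)).mono 1 zero_le_one
    (fun X p => X.gapErr_nonneg p) fun X p => ?_
  rw [one_mul, gapErr, mul_add]

lemma sumBigO_fluxMaj (hc : 0 < c) : SumBigO (fun (X : ModeSystem xl xr v₀ c C) p => X.fluxMaj p)
    fun X => X.S := by
  have hinj : Injective fun p : ℤ × ℤ => (p.1, p.2 + 1) := by
    intro p q h
    simp only [Prod.mk.injEq, add_left_inj] at h
    exact Prod.ext h.1 h.2
  exact ((sumBigO_gapErr hC hc).mono_right 1 zero_le_one fun X => by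
    rw [one_mul]; exact mul_le_of_le_one_left X.S_nonneg X.ε_le_one).add
      ((sumBigO_τ hC).add ((sumBigO_τ hC).comp_injective hinj))

/-- Fluxes of size O(S) acquire the factor d ≤ ε² from the contrast, and `q` is O(ε² S); both exceed
the precision ε S that is needed. -/
lemma sumBigO_z (hc : 0 < c) : SumBigO (fun (X : ModeSystem xl xr v₀ c C) p => X.z p)
    fun X => X.ε * X.S := by
  have hε : ∀ X : ModeSystem xl xr v₀ c C, X.ε ^ 2 * X.S ≤ 1 * (X.ε * X.S) := fun X => by
    rw [one_mul, sq, mul_assoc]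
    exact mul_le_of_le_one_left (mul_nonneg X.ε_pos.le X.S_nonneg) X.ε_le_one
  exact ((((sumBigO_fluxMaj hC hc).conv hC fun X => X.cs_sum).scale fun X => X.d_pos.le).mono_right
    1 zero_le_one fun X => (mul_le_mul_of_nonneg_right X.d_le X.S_nonneg).trans (hε X)).add
    ((sumBigO_q hC).mono_right 1 zero_le_one hε)

lemma sumBigO_outerErr (hc : 0 < c) : SumBigO (fun (X : ModeSystem xl xr v₀ c C) p => X.outerErr p)
    fun X => X.ε * X.S :=
  (sumBigO_z hC hc).finset_conv hC (fun X => X.cσ_nonneg) fun X => X.cσ_sum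

end Sums

end ModeSystem

end SpaceTimeResonators

end

/-! ### Pointwise bounds of the modes by the majorants. -/

noncomputable section

namespace SpaceTimeResonators

open Set

namespace ModeSystem

variable {xl xr : ℤ → ℝ} {v₀ c C h₀ h₁ : ℝ}

section Pointwise

variable (X : ModeSystem xl xr v₀ c C) (hg : LengthBounds xl xr h₀ h₁)
include hg

lemma integral_norm_A2_le (k n : ℤ) :
    ∫ x in xl k..xr k, ‖X.A2 k n x‖ ≤ C * (1 + C) * X.q (n, k) := by
  have hC := X.C_nonneg
  have hle : xl k ≤ xr k := by linarith [hg.le_len k, hg.pos]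
  have hA : ∀ n, Continuous (X.A k n) := fun n =>
    continuous_iff_continuousAt.2 fun x => (X.hasDeriv_A k n x).continuousAt
  have key : ∀ x ∈ Icc (xl k) (xr k), ‖X.A2 k n x‖
      ≤ ∑ l ∈ X.band, C * (1 + C) * (X.cκ l * X.W (n - l)) * ‖X.A k (n - l) x‖ := by
    intro x hx
    rw [X.resonator k n x hx, norm_neg, norm_mul, norm_real, Real.norm_of_nonneg (X.r_nonneg k),
      Finset.mul_sum]
    refine (mul_le_mul (X.r_le k) (norm_sum_le _ _) (norm_nonneg _) hC).trans ?_
    rw [Finset.mul_sum]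
    refine Finset.sum_le_sum fun l hl => ?_
    rw [norm_mul, norm_mul, norm_mul]
    have h1 := X.shift n l hl
    -- Replacing |ω_n| by |ω_{n-l}| + C ε leaves |ω_{n-l}|² + C ε |ω_{n-l}|, so both frequency
    -- factors are charged to the mode n - l.
    have h2 : ‖X.w n‖ * ‖X.w (n - l)‖ ≤ (1 + C) * X.W (n - l) := by
      have := mul_le_mul_of_nonneg_right h1 (norm_nonneg (X.w (n - l)))
      unfold W
      nlinarith [mul_nonneg hC (sq_nonneg (‖X.w (n - l)‖ - X.ε)),
        mul_nonneg hC (sq_nonneg (‖X.w (n - l)‖)), mul_nonneg hC (sq_nonneg X.ε),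
        sq_nonneg X.ε]
    calc C * (‖X.w n‖ * (‖X.κ k l‖ * (‖X.w (n - l)‖ * ‖X.A k (n - l) x‖)))
        = C * ((‖X.w n‖ * ‖X.w (n - l)‖) * ‖X.κ k l‖ * ‖X.A k (n - l) x‖) := by ring
      _ ≤ C * (((1 + C) * X.W (n - l)) * X.cκ l * ‖X.A k (n - l) x‖) := by
          gcongr
          exacts [mul_nonneg (by linarith) (X.W_nonneg _), X.κ_le k l]
      _ = _ := by ring
  have hint : ∀ l, Continuous fun x =>
      C * (1 + C) * (X.cκ l * X.W (n - l)) * ‖X.A k (n - l) x‖ :=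
    fun l => continuous_const.mul (hA _).norm
  refine (intervalIntegral.integral_mono_on hle ((X.continuous_A2 k n).norm.intervalIntegrable _ _)
    ((continuous_finsetSum _ fun l _ => hint l).intervalIntegrable _ _) key).trans (le_of_eq ?_)
  rw [intervalIntegral.integral_finsetSum fun l _ => (hint l).intervalIntegrable _ _, q,
    Finset.mul_sum]
  refine Finset.sum_congr rfl fun l _ => ?_
  rw [intervalIntegral.integral_const_mul, b]
  ring

/-- The constant in the bound of the modes in the resonators. -/
def interiorConst (h₀ h₁ C : ℝ) : ℝ :=
  (1 + h₁) * (4 / h₀ ^ 2 + C * (1 + C)) + 1 / h₀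

lemma interiorConst_nonneg (hC : 0 ≤ C) : 0 ≤ interiorConst h₀ h₁ C := by
  have h0 := hg.pos
  have h1 : 0 < h₁ := by linarith [hg.le_len 0, hg.len_le 0]
  unfold interiorConst; positivity

lemma norm_A_le {k : ℤ} (n : ℤ) {x : ℝ} (hx : x ∈ Icc (xl k) (xr k)) :
    ‖X.A k n x‖ ≤ interiorConst h₀ h₁ C * X.a (n, k) ∧
      ‖X.A1 k n x‖ ≤ interiorConst h₀ h₁ C * X.a (n, k) := by
  have hC := X.C_nonneg
  have h0 := hg.pos
  have hlen := hg.le_len k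
  have hlen1 := hg.len_le k
  have hpos : 0 < xr k - xl k := by linarith
  have h1 : 0 < h₁ := by linarith
  have hlt : xl k < xr k := by linarith
  have hb := X.b_nonneg (n, k)
  have hq := X.q_nonneg (n, k)
  set Q := 4 / h₀ ^ 2 + C * (1 + C) with hQ
  have hd : ∀ y ∈ Icc (xl k) (xr k), ‖X.A1 k n y‖ ≤ Q * X.a (n, k) := by
    intro y hy
    refine (norm_deriv_le_interpolation hlt (X.hasDeriv_A k n) (X.hasDeriv_A1 k n)
      (X.continuous_A2 k n) hy).trans ?_
    have h2 := X.integral_norm_A2_le hg k n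
    have h3 : 4 / (xr k - xl k) ^ 2 ≤ 4 / h₀ ^ 2 := by gcongr
    have h4 : 4 / (xr k - xl k) ^ 2 * X.b (n, k) ≤ 4 / h₀ ^ 2 * X.b (n, k) := by gcongr
    have h5 : 0 ≤ 4 / h₀ ^ 2 * X.q (n, k) := by positivity
    have h6 : 0 ≤ C * (1 + C) * X.b (n, k) := by positivity
    rw [a, hQ]
    unfold b at *
    nlinarith
  have ha := X.a_nonneg (n, k)
  have hQ0 : 0 ≤ Q := by positivity
  constructor
  · refine (norm_le_interpolation hlt (X.hasDeriv_A k n) hd hx).trans ?_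
    have h3 : 1 / (xr k - xl k) ≤ 1 / h₀ := by gcongr
    have h4 : 1 / (xr k - xl k) * X.b (n, k) ≤ 1 / h₀ * X.a (n, k) :=
      mul_le_mul h3 (le_add_of_nonneg_right hq) hb (by positivity)
    have h5 : (xr k - xl k) * (Q * X.a (n, k)) ≤ (1 + h₁) * (Q * X.a (n, k)) :=
      mul_le_mul_of_nonneg_right (by linarith) (by positivity)
    unfold interiorConst b at *
    linarith
  · refine (hd x hx).trans (mul_le_mul_of_nonneg_right ?_ ha)
    have : 0 ≤ 1 / h₀ := by positivity
    have : 0 ≤ h₁ * Q := by positivity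
    unfold interiorConst
    linarith

lemma xl_mem (k : ℤ) : xl k ∈ Icc (xl k) (xr k) :=
  ⟨le_rfl, by linarith [hg.le_len k, hg.pos]⟩

lemma xr_mem (k : ℤ) : xr k ∈ Icc (xl k) (xr k) :=
  ⟨by linarith [hg.le_len k, hg.pos], le_rfl⟩

omit hg in
lemma norm_sum_σ_le {f : ℤ → ℂ} {k n : ℤ} {g : ℤ × ℤ → ℝ} {K : ℝ}
    (hf : ∀ n, ‖f n‖ ≤ K * g (n, k)) :
    ‖∑ l ∈ X.band, X.σ k l * f (n - l)‖ ≤ K * ∑ l ∈ X.band, X.cσ l * g (n - l, k) := by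
  refine (norm_sum_le _ _).trans ?_
  rw [Finset.mul_sum]
  refine Finset.sum_le_sum fun l _ => ?_
  rw [norm_mul, mul_left_comm]
  exact mul_le_mul (X.σ_le k l) (hf _) (norm_nonneg _) (X.cσ_nonneg l)

lemma norm_B_right_le (k n : ℤ) : ‖X.B k n (xr k)‖ ≤ interiorConst h₀ h₁ C * X.τ (n, k) := by
  rw [X.trace_right k n]
  exact X.norm_sum_σ_le (f := fun n => X.A k n (xr k)) (g := X.a)
    fun n => (X.norm_A_le hg n (xr_mem hg k)).1

lemma norm_B_left_le (k n : ℤ) :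
    ‖X.B k n (xl (k + 1))‖ ≤ interiorConst h₀ h₁ C * X.τ (n, k + 1) := by
  rw [X.trace_left k n]
  exact X.norm_sum_σ_le (g := X.a) (f := fun n => X.A (k + 1) n (xl (k + 1)))
    fun n => (X.norm_A_le hg n (xl_mem hg (k + 1))).1

omit hg in
-- Dividing the exterior flux by the contrast costs a factor C/d.
lemma norm_le_of_flux {k : ℤ} {z : ℂ} {T : ℝ} (h : ‖(X.δ k : ℂ) * z‖ ≤ T) :
    ‖z‖ ≤ C * (1 / X.d * T) := by
  have hC := X.C_nonneg
  have hd := X.d_pos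
  have h1 : X.δ k * ‖z‖ ≤ T := by
    rw [norm_mul, norm_real] at h
    exact (mul_le_mul_of_nonneg_right (le_abs_self _) (norm_nonneg _)).trans h
  have h2 : X.d * ‖z‖ ≤ C * T := by
    have := mul_le_mul_of_nonneg_right (X.δ_ge k) (norm_nonneg z)
    have := mul_le_mul_of_nonneg_left h1 hC
    linarith
  rw [one_div, mul_left_comm, inv_mul_eq_div, le_div_iff₀ hd]
  linarith

lemma norm_B1_right_le (k n : ℤ) :
    ‖X.B1 k n (xr k)‖ ≤ C * (1 / X.d * (interiorConst h₀ h₁ C * X.τ (n, k))) := by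
  refine X.norm_le_of_flux (k := k) ?_
  rw [X.flux_right k n]
  exact X.norm_sum_σ_le (f := fun n => X.A1 k n (xr k)) (g := X.a)
    fun n => (X.norm_A_le hg n (xr_mem hg k)).2

lemma norm_B1_left_le (k n : ℤ) :
    ‖X.B1 k n (xl (k + 1))‖ ≤ C * (1 / X.d * (interiorConst h₀ h₁ C * X.τ (n, k + 1))) := by
  refine X.norm_le_of_flux (k := k + 1) ?_
  rw [X.flux_left k n]
  exact X.norm_sum_σ_le (g := X.a) (f := fun n => X.A1 (k + 1) n (xl (k + 1)))
    fun n => (X.norm_A_le hg n (xl_mem hg (k + 1))).2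

/-- Slope of the chord of `B k n`. -/
def slope (k n : ℤ) : ℂ :=
  (X.B k n (xl (k + 1)) - X.B k n (xr k)) / ((xl (k + 1) - xr k : ℝ) : ℂ)

lemma norm_slope_le (k n : ℤ) :
    ‖X.slope k n‖ ≤ interiorConst h₀ h₁ C / h₀ * (X.τ (n, k) + X.τ (n, k + 1)) := by
  have hgap := hg.le_gap k
  have h0 := hg.pos
  rw [slope, norm_div, norm_real, Real.norm_of_nonneg (by linarith), div_le_iff₀ (by linarith)]
  have h1 := X.norm_B_right_le hg k n
  have h2 := X.norm_B_left_le hg k n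
  have h3 : 0 ≤ interiorConst h₀ h₁ C / h₀ * (X.τ (n, k) + X.τ (n, k + 1)) :=
    mul_nonneg (div_nonneg (interiorConst_nonneg hg X.C_nonneg) h0.le)
      (add_nonneg (X.τ_nonneg _) (X.τ_nonneg _))
  have h4 := mul_le_mul_of_nonneg_left hgap h3
  have h5 : interiorConst h₀ h₁ C / h₀ * (X.τ (n, k) + X.τ (n, k + 1)) * h₀
    = interiorConst h₀ h₁ C * (X.τ (n, k) + X.τ (n, k + 1)) := by field_simp
  linarith [norm_sub_le (X.B k n (xl (k + 1))) (X.B k n (xr k))]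

/-- In the bracket, C and 1/h₀ account for the flux and the chord at high frequencies, and 4 h₁/v₀²
for the Helmholtz term at low frequencies. -/
def gapConst (v₀ h₀ h₁ C : ℝ) : ℝ := interiorConst h₀ h₁ C * (C + 1 / h₀ + 4 * h₁ / v₀ ^ 2)

lemma gapConst_nonneg (hC : 0 ≤ C) : 0 ≤ gapConst v₀ h₀ h₁ C := by
  have h0 := hg.pos
  have h1 : 0 < h₁ := by linarith [hg.le_len 0, hg.len_le 0]
  have := interiorConst_nonneg hg hC
  unfold gapConst; positivity

/-- Below the cutoff c, the Helmholtz equation in the gap is a small perturbation of harmonicity and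
its end values determine B' to leading order. Above c the gap may resonate and B' cannot be read off
from the traces; it is bounded by the interior flux divided by the contrast, and the slope of the
chord is then not even needed as an approximation. -/
lemma norm_B1_sub_slope_le (hv : 0 < v₀) (hc1 : c ≤ 1) (hc : (c / v₀) ^ 2 * h₁ ^ 2 ≤ 1 / 2)
    (k n : ℤ) {x : ℝ} (hx : x = xr k ∨ x = xl (k + 1)) :
    ‖X.B1 k n x - X.slope k n‖ ≤ gapConst v₀ h₀ h₁ C * X.gapErr (n, k) := by
  have hC := X.C_nonneg
  have hK := interiorConst_nonneg hg hC
  set K := interiorConst h₀ h₁ C with hKd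
  have h0 := hg.pos
  have hg0 := hg.le_gap k
  have hg1 := hg.gap_le k
  have h1 : 0 < h₁ := by linarith
  have hd := X.d_pos
  have ht := add_nonneg (X.τ_nonneg (n, k)) (X.τ_nonneg (n, k + 1))
  set T := X.τ (n, k) + X.τ (n, k + 1) with hT
  have hlt : xr k < xl (k + 1) := by linarith
  have hm := X.minW_nonneg n
  rcases lt_or_ge c ‖X.w n‖ with h | h
  · have hhi : X.hi c n = 1 := if_pos h
    have hB1 : ‖X.B1 k n x‖ ≤ C * (1 / X.d * (K * T)) := by
      rcases hx with rfl | rfl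
      · refine (X.norm_B1_right_le hg k n).trans ?_
        gcongr
        exact le_add_of_nonneg_right (X.τ_nonneg _)
      · refine (X.norm_B1_left_le hg k n).trans ?_
        gcongr
        exact le_add_of_nonneg_left (X.τ_nonneg _)
    have hsl := X.norm_slope_le hg k n
    have hd1 : 1 ≤ 1 / X.d := by rw [le_div_iff₀ hd]; linarith [X.d_le_one]
    have h2 : K / h₀ * T ≤ K / h₀ * (1 / X.d * T) := by
      gcongr
      exact le_mul_of_one_le_left ht hd1
    have h3 : K * (C + 1 / h₀) * (1 / X.d * T) ≤ gapConst v₀ h₀ h₁ C * X.gapErr (n, k) := by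
      unfold gapConst gapErr
      rw [hhi]
      have e1 : C + 1 / h₀ ≤ C + 1 / h₀ + 4 * h₁ / v₀ ^ 2 := by
        have : 0 ≤ 4 * h₁ / v₀ ^ 2 := by positivity
        linarith
      gcongr
      linarith
    refine (norm_sub_le _ _).trans ?_
    calc ‖X.B1 k n x‖ + ‖X.slope k n‖ ≤ C * (1 / X.d * (K * T)) + K / h₀ * (1 / X.d * T) := by
          linarith
      _ = K * (C + 1 / h₀) * (1 / X.d * T) := by ring
      _ ≤ _ := h3
  · have hhi : X.hi c n = 0 := if_neg (not_lt.2 h)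
    have hμ : ‖(X.w n / v₀) ^ 2‖ = ‖X.w n‖ ^ 2 / v₀ ^ 2 := by
      rw [norm_pow, norm_div, norm_real, Real.norm_of_nonneg hv.le, div_pow]
    have hwc : ‖X.w n‖ ^ 2 ≤ c ^ 2 := pow_le_pow_left₀ (norm_nonneg _) h 2
    have hc0 : 0 ≤ c := (norm_nonneg _).trans h
    have hx' : x ∈ Icc (xr k) (xl (k + 1)) := by
      rcases hx with rfl | rfl
      exacts [⟨le_rfl, hlt.le⟩, ⟨hlt.le, le_rfl⟩]
    have hmain := norm_deriv_sub_slope_le hlt (X.hasDeriv_B k n) (X.hasDeriv_B1 k n)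
      (μ := (X.w n / v₀) ^ 2) (by
        rw [hμ]
        refine le_trans ?_ hc
        rw [div_pow]
        have hp : 0 ≤ xl (k + 1) - xr k := by linarith
        gcongr) (X.background k n) hx'
    refine hmain.trans ?_
    rw [hμ]
    have h2 := X.norm_B_right_le hg k n
    have h3 := X.norm_B_left_le hg k n
    -- Here c ≤ 1 makes the truncation of the weight harmless.
    have hw : ‖X.w n‖ ^ 2 ≤ X.minW n := by
      refine le_min ?_ (hwc.trans (pow_le_one₀ hc0 hc1))
      unfold W
      linarith [sq_nonneg X.ε]
    have e1 : 4 * h₁ / v₀ ^ 2 ≤ C + 1 / h₀ + 4 * h₁ / v₀ ^ 2 := by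
      have : 0 ≤ 1 / h₀ := by positivity
      linarith
    have h4 : ‖X.B k n (xr k)‖ + ‖X.B k n (xl (k + 1))‖ ≤ K * T := by
      rw [hT, mul_add]
      exact add_le_add h2 h3
    calc 4 * (xl (k + 1) - xr k) * (‖X.w n‖ ^ 2 / v₀ ^ 2)
          * (‖X.B k n (xr k)‖ + ‖X.B k n (xl (k + 1))‖)
        ≤ 4 * h₁ * (X.minW n / v₀ ^ 2) * (K * T) := by
          gcongr
      _ = K * (4 * h₁ / v₀ ^ 2) * (X.minW n * T) := by ring
      _ ≤ K * (C + 1 / h₀ + 4 * h₁ / v₀ ^ 2) * (X.minW n * T) := by gcongr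
      _ = gapConst v₀ h₀ h₁ C * X.gapErr (n, k) := by
          unfold gapConst gapErr; rw [hhi, mul_zero, add_zero]

def fluxConst (v₀ h₀ h₁ C : ℝ) : ℝ := gapConst v₀ h₀ h₁ C + interiorConst h₀ h₁ C / h₀

lemma fluxConst_nonneg (hC : 0 ≤ C) : 0 ≤ fluxConst v₀ h₀ h₁ C :=
  add_nonneg (gapConst_nonneg hg hC) (div_nonneg (interiorConst_nonneg hg hC) hg.pos.le)

lemma norm_B1_le (hv : 0 < v₀) (hc1 : c ≤ 1) (hc : (c / v₀) ^ 2 * h₁ ^ 2 ≤ 1 / 2)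
    (k n : ℤ) {x : ℝ} (hx : x = xr k ∨ x = xl (k + 1)) :
    ‖X.B1 k n x‖ ≤ fluxConst v₀ h₀ h₁ C * X.fluxMaj (n, k) := by
  have h1 := X.norm_B1_sub_slope_le hg hv hc1 hc k n hx
  have h2 := X.norm_slope_le hg k n
  have h3 := norm_sub_norm_le (X.B1 k n x) (X.slope k n)
  have h4 := mul_nonneg (gapConst_nonneg (v₀ := v₀) hg X.C_nonneg)
    (add_nonneg (X.τ_nonneg (n, k)) (X.τ_nonneg (n, k + 1)))
  have h5 := mul_nonneg (div_nonneg (interiorConst_nonneg hg X.C_nonneg) hg.pos.le)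
    (X.gapErr_nonneg (n, k))
  unfold fluxConst fluxMaj
  linarith

def zConst (v₀ h₀ h₁ C : ℝ) : ℝ := C * fluxConst v₀ h₀ h₁ C + C * (1 + C)

lemma zConst_nonneg (hC : 0 ≤ C) : 0 ≤ zConst v₀ h₀ h₁ C := by
  have := fluxConst_nonneg (v₀ := v₀) hg hC
  unfold zConst; positivity

/-- Second, sharper bound of A'. At the right end, A' = δ (s * B'), and B' is already bounded
without loss, so the high contrast gives the factor d. Inside the resonator A' changes by at most ∫
|A''|. -/
lemma norm_A1_le (hv : 0 < v₀) (hc0 : 0 < c) (hc1 : c ≤ 1)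
    (hc : (c / v₀) ^ 2 * h₁ ^ 2 ≤ 1 / 2) {k : ℤ} (n : ℤ) {x : ℝ} (hx : x ∈ Icc (xl k) (xr k)) :
    ‖X.A1 k n x‖ ≤ zConst v₀ h₀ h₁ C * X.z (n, k) := by
  have hC := X.C_nonneg
  have hF := fluxConst_nonneg (v₀ := v₀) hg hC
  set F := fluxConst v₀ h₀ h₁ C with hFd
  have hd := X.d_pos
  -- Only the convergence of the convolution series is used; the value of R does not enter the
  -- constant.
  obtain ⟨R, -, hR⟩ := sumBigO_fluxMaj (xl := xl) (xr := xr) (v₀ := v₀) hC hc0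
  have hs := ((hR X).conv X.cs_sum).2 (n, k)
  set T := ∑' l, X.cs l * X.fluxMaj (n - l, k)
  have hT : 0 ≤ T := tsum_nonneg fun l => mul_nonneg (X.cs_sum.1 l) (X.fluxMaj_nonneg _)
  have h1 : ‖X.A1 k n (xr k)‖ ≤ C * X.d * (F * T) := by
    rw [X.flux_right_inv k n, norm_mul, norm_real]
    have hδ : ‖X.δ k‖ ≤ C * X.d := by
      have h := X.δ_ge k
      rw [Real.norm_of_nonneg]
      · exact X.δ_le k
      · by_contra! hneg
        nlinarith
    refine mul_le_mul hδ ?_ (norm_nonneg _) (by positivity)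
    rw [← tsum_mul_left]
    refine tsum_of_norm_bounded (hs.mul_left F).hasSum fun l => ?_
    rw [norm_mul, mul_left_comm]
    exact mul_le_mul (X.s_le k l) (X.norm_B1_le hg hv hc1 hc k (n - l) (Or.inl rfl))
      (norm_nonneg _) (X.cs_sum.1 l)
  have h2 := (norm_sub_le_integral_norm_deriv (X.hasDeriv_A1 k n) (X.continuous_A2 k n)
    (xr_mem hg k) hx).trans (X.integral_norm_A2_le hg k n)
  have h3 := norm_sub_norm_le (X.A1 k n x) (X.A1 k n (xr k))
  have hq := X.q_nonneg (n, k)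
  have h4 : 0 ≤ C * F * X.q (n, k) := by positivity
  have h5 : 0 ≤ C * (1 + C) * (X.d * T) := by positivity
  have h6 : zConst v₀ h₀ h₁ C * X.z (n, k)
    = (C * F + C * (1 + C)) * (X.d * T + X.q (n, k)) := rfl
  rw [h6]
  nlinarith

lemma norm_A_sub_mean_le (hv : 0 < v₀) (hc0 : 0 < c) (hc1 : c ≤ 1)
    (hc : (c / v₀) ^ 2 * h₁ ^ 2 ≤ 1 / 2) {k : ℤ} (n : ℤ) {x : ℝ} (hx : x ∈ Icc (xl k) (xr k)) :
    ‖X.A k n x - X.mean k n‖ ≤ h₁ * zConst v₀ h₀ h₁ C * X.z (n, k) := by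
  have h0 := hg.pos
  have := norm_sub_mean_le (by linarith [hg.le_len k] : xl k < xr k) (X.hasDeriv_A k n)
    (fun y hy => X.norm_A1_le hg hv hc0 hc1 hc n hy) hx
  refine this.trans ?_
  rw [mul_assoc]
  exact mul_le_mul_of_nonneg_right (hg.len_le k)
    (mul_nonneg (zConst_nonneg hg X.C_nonneg) (X.z_nonneg _))

lemma norm_B_sub_outer_le (hv : 0 < v₀) (hc0 : 0 < c) (hc1 : c ≤ 1)
    (hc : (c / v₀) ^ 2 * h₁ ^ 2 ≤ 1 / 2) (k n : ℤ) :
    ‖X.B k n (xr k) - X.outer k n‖ ≤ h₁ * zConst v₀ h₀ h₁ C * X.outerErr (n, k) ∧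
    ‖X.B k n (xl (k + 1)) - X.outer (k + 1) n‖
      ≤ h₁ * zConst v₀ h₀ h₁ C * X.outerErr (n, k + 1) := by
  constructor
  · rw [X.trace_right k n, outer, band, ← Finset.sum_sub_distrib]
    simp only [← mul_sub]
    exact X.norm_sum_σ_le (g := X.z) (f := fun n => X.A k n (xr k) - X.mean k n)
      fun n => X.norm_A_sub_mean_le hg hv hc0 hc1 hc n (xr_mem hg k)
  · rw [X.trace_left k n, outer, band, ← Finset.sum_sub_distrib]
    simp only [← mul_sub]
    exact X.norm_sum_σ_le (g := X.z) (f := fun n => X.A (k + 1) n (xl (k + 1)) - X.mean (k + 1) n)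
      fun n => X.norm_A_sub_mean_le hg hv hc0 hc1 hc n (xl_mem hg (k + 1))

/-- Slope between the values of `outer` at the ends of a gap. -/
def outerSlope (k n : ℤ) : ℂ :=
  (X.outer (k + 1) n - X.outer k n) / ((xl (k + 1) - xr k : ℝ) : ℂ)

/-- Two errors add up: that of the chord of B, and that of replacing its end values by transferred
means, which `norm_A_sub_mean_le` controls. -/
lemma norm_B1_sub_outerSlope_le (hv : 0 < v₀) (hc0 : 0 < c) (hc1 : c ≤ 1)
    (hc : (c / v₀) ^ 2 * h₁ ^ 2 ≤ 1 / 2) (k n : ℤ) {x : ℝ} (hx : x = xr k ∨ x = xl (k + 1)) :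
    ‖X.B1 k n x - X.outerSlope k n‖ ≤ (gapConst v₀ h₀ h₁ C + h₁ * zConst v₀ h₀ h₁ C / h₀)
      * (X.gapErr (n, k) + (X.outerErr (n, k) + X.outerErr (n, k + 1))) := by
  have hC := X.C_nonneg
  have h0 := hg.pos
  have hgap := hg.le_gap k
  have h1 : 0 < h₁ := by linarith [hg.gap_le k]
  have hZ := zConst_nonneg (v₀ := v₀) hg hC
  have hG := gapConst_nonneg (v₀ := v₀) hg hC
  obtain ⟨ha, hb⟩ := X.norm_B_sub_outer_le hg hv hc0 hc1 hc k n
  have hO : ∀ p, 0 ≤ X.outerErr p := fun p => Finset.sum_nonneg fun l _ =>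
    mul_nonneg (X.cσ_nonneg l) (X.z_nonneg _)
  have hOO := add_nonneg (hO (n, k)) (hO (n, k + 1))
  set T := X.outerErr (n, k) + X.outerErr (n, k + 1) with hT
  have hs : ‖X.slope k n - X.outerSlope k n‖ ≤ h₁ * zConst v₀ h₀ h₁ C / h₀ * T := by
    rw [slope, outerSlope, ← sub_div, norm_div, norm_real, Real.norm_of_nonneg (by linarith),
      div_le_iff₀ (by linarith)]
    have e : X.B k n (xl (k + 1)) - X.B k n (xr k) - (X.outer (k + 1) n - X.outer k n)
      = (X.B k n (xl (k + 1)) - X.outer (k + 1) n) - (X.B k n (xr k) - X.outer k n) := by ring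
    rw [e]
    refine (norm_sub_le _ _).trans ((add_le_add hb ha).trans ?_)
    calc _ = h₁ * zConst v₀ h₀ h₁ C / h₀ * T * h₀ := by rw [hT]; field_simp; ring
      _ ≤ _ := by gcongr
  have h2 := X.norm_B1_sub_slope_le hg hv hc1 hc k n hx
  have h3 := norm_sub_le_norm_sub_add_norm_sub (X.B1 k n x) (X.slope k n) (X.outerSlope k n)
  have h4 : 0 ≤ gapConst v₀ h₀ h₁ C * T := by positivity
  have h5 : 0 ≤ h₁ * zConst v₀ h₀ h₁ C / h₀ * X.gapErr (n, k) :=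
    mul_nonneg (by positivity) (X.gapErr_nonneg _)
  linarith

end Pointwise

/-- The modes are almost constant in the resonators. -/
theorem exists_norm_A_sub_mean_le (hg : LengthBounds xl xr h₀ h₁) (hC : 0 ≤ C) (hv : 0 < v₀)
    (hc0 : 0 < c) (hc1 : c ≤ 1) (hc : (c / v₀) ^ 2 * h₁ ^ 2 ≤ 1 / 2) :
    ∃ K, 0 ≤ K ∧ ∀ X : ModeSystem xl xr v₀ c C, ∀ k n, ∀ x ∈ Icc (xl k) (xr k),
      ‖X.A k n x - X.mean k n‖ ≤ K * (X.ε * X.S) := by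
  obtain ⟨Z, hZ, h⟩ := sumBigO_z (xl := xl) (xr := xr) (v₀ := v₀) hC hc0
  have h1 : 0 < h₁ := by linarith [hg.le_len 0, hg.len_le 0, hg.pos]
  have hz := zConst_nonneg (v₀ := v₀) hg hC
  refine ⟨h₁ * zConst v₀ h₀ h₁ C * Z, by positivity, fun X k n x hx => ?_⟩
  refine (X.norm_A_sub_mean_le hg hv hc0 hc1 hc n hx).trans ?_
  rw [mul_assoc _ Z]
  exact mul_le_mul_of_nonneg_left ((h X).le (n, k)) (by positivity)

/-- The exterior fluxes are, at leading order, the slopes between the mean values of the modes. -/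
theorem sumBigO_flux_sub (hg : LengthBounds xl xr h₀ h₁) (hC : 0 ≤ C) (hv : 0 < v₀)
    (hc0 : 0 < c) (hc1 : c ≤ 1) (hc : (c / v₀) ^ 2 * h₁ ^ 2 ≤ 1 / 2) :
    SumBigO (fun (X : ModeSystem xl xr v₀ c C) (p : ℤ × ℤ) =>
      ‖(X.B1 (p.2 - 1) p.1 (xl p.2) - X.B1 p.2 p.1 (xr p.2))
        - (X.outerSlope (p.2 - 1) p.1 - X.outerSlope p.2 p.1)‖) fun X => X.ε * X.S := by
  have hinj : ∀ j : ℤ, Injective fun p : ℤ × ℤ => (p.1, p.2 + j) := by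
    intro j p q h
    simp only [Prod.mk.injEq, add_left_inj] at h
    exact Prod.ext h.1 h.2
  have hO := sumBigO_outerErr (xl := xl) (xr := xr) (v₀ := v₀) hC hc0
  have hG := (sumBigO_gapErr (xl := xl) (xr := xr) (v₀ := v₀) hC hc0).add
    (hO.add (hO.comp_injective (hinj 1)))
  have h1 : 0 < h₁ := by linarith [hg.le_len 0, hg.len_le 0, hg.pos]
  have hz := zConst_nonneg (v₀ := v₀) hg hC
  have hgc := gapConst_nonneg (v₀ := v₀) hg hC
  have h0 := hg.pos
  refine ((hG.comp_injective (hinj (-1))).add hG).mono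
    (gapConst v₀ h₀ h₁ C + h₁ * zConst v₀ h₀ h₁ C / h₀) (by positivity)
    (fun X p => norm_nonneg _) fun X p => ?_
  have ha := X.norm_B1_sub_outerSlope_le hg hv hc0 hc1 hc (p.2 - 1) p.1
    (x := xl p.2) (Or.inr (by rw [sub_add_cancel]))
  have hb := X.norm_B1_sub_outerSlope_le hg hv hc0 hc1 hc p.2 p.1 (x := xr p.2) (Or.inl rfl)
  have e : (X.B1 (p.2 - 1) p.1 (xl p.2) - X.B1 p.2 p.1 (xr p.2))
      - (X.outerSlope (p.2 - 1) p.1 - X.outerSlope p.2 p.1)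
    = (X.B1 (p.2 - 1) p.1 (xl p.2) - X.outerSlope (p.2 - 1) p.1)
      - (X.B1 p.2 p.1 (xr p.2) - X.outerSlope p.2 p.1) := by ring
  rw [e, mul_add]
  exact (norm_sub_le _ _).trans (add_le_add ha hb)

end ModeSystem

end SpaceTimeResonators

end

/-! ### Geometry of the chain, the potentials and the capacitance matrix. -/

noncomputable section

namespace SpaceTimeResonators

open Set Filter Topology

namespace Chain

variable {N : ℕ} (G : Chain N)

include G in
lemma ne_zero : N ≠ 0 := by
  rintro rfl
  have := G.xl_add 0
  simp at this
  exact G.L_pos.ne' this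

lemma xl_add_mul (k m : ℤ) : G.xl (k + m * N) = G.xl k + m * G.L := by
  induction m using Int.induction_on with
  | zero => simp
  | succ m ih =>
    rw [add_one_mul, ← add_assoc, G.xl_add, ih]; push_cast; ring
  | pred m ih =>
    have := G.xl_add (k + (-(m : ℤ) - 1) * N)
    rw [sub_one_mul, add_assoc, sub_add_cancel, ih] at this
    rw [sub_one_mul]; push_cast at this ⊢; linarith

lemma xr_add_mul (k m : ℤ) : G.xr (k + m * N) = G.xr k + m * G.L := by
  induction m using Int.induction_on with
  | zero => simp
  | succ m ih =>
    rw [add_one_mul, ← add_assoc, G.xr_add, ih]; push_cast; ring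
  | pred m ih =>
    have := G.xr_add (k + (-(m : ℤ) - 1) * N)
    rw [sub_one_mul, add_assoc, sub_add_cancel, ih] at this
    rw [sub_one_mul]; push_cast at this ⊢; linarith

/-- The cell and the index in the unit cell of the resonator of index `k`. -/
def index [NeZero N] : ℤ ≃ ℤ × Fin N := Int.divModEquiv N

lemma index_symm [NeZero N] (m : ℤ) (i : Fin N) :
    (index (N := N)).symm (m, i) = (i : ℕ) + m * N := by
  simp [index, Int.divModEquiv, add_comm]

lemma index_eta [NeZero N] (k : ℤ) :
    (((index (N := N) k).2 : ℕ) : ℤ) + (index (N := N) k).1 * N = k := by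
  rw [← index_symm]; exact (index (N := N)).symm_apply_apply k

lemma index_add_mul [NeZero N] (k m : ℤ) :
    index (N := N) (k + m * N) = ((index (N := N) k).1 + m, (index (N := N) k).2) := by
  rw [← Equiv.eq_symm_apply, index_symm]
  conv_lhs => rw [← index_eta (N := N) k]
  ring

lemma index_val [NeZero N] (i : Fin N) : index (N := N) ((i : ℕ) : ℤ) = (0, i) := by
  rw [← Equiv.eq_symm_apply, index_symm]; simp

lemma xl_index [NeZero N] (k : ℤ) :
    G.xl k = G.left (index (N := N) k).1 (index (N := N) k).2 := by
  conv_lhs => rw [← index_eta (N := N) k, xl_add_mul]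
  rfl

lemma xr_index [NeZero N] (k : ℤ) :
    G.xr k = G.right (index (N := N) k).1 (index (N := N) k).2 := by
  conv_lhs => rw [← index_eta (N := N) k, xr_add_mul]
  rfl

lemma left_eq (m : ℤ) (i : Fin N) : G.left m i = G.xl ((i : ℕ) + m * N) :=
  (G.xl_add_mul _ _).symm

lemma right_eq (m : ℤ) (i : Fin N) : G.right m i = G.xr ((i : ℕ) + m * N) :=
  (G.xr_add_mul _ _).symm

lemma xl_strictMono : StrictMono G.xl :=
  strictMono_int_of_lt_succ fun k => (G.xl_lt_xr k).trans (G.xr_lt_xl k)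

lemma xr_strictMono : StrictMono G.xr :=
  strictMono_int_of_lt_succ fun k => (G.xr_lt_xl k).trans (G.xl_lt_xr (k + 1))

lemma exists_lengthBounds : ∃ h₀ h₁, LengthBounds G.xl G.xr h₀ h₁ := by
  have : NeZero N := ⟨G.ne_zero⟩
  obtain ⟨i1, h1⟩ := Finite.exists_min fun i : Fin N => G.xr i - G.xl i
  obtain ⟨i2, h2⟩ := Finite.exists_max fun i : Fin N => G.xr i - G.xl i
  obtain ⟨i3, h3⟩ := Finite.exists_min fun i : Fin N => G.xl (i + 1) - G.xr i
  obtain ⟨i4, h4⟩ := Finite.exists_max fun i : Fin N => G.xl (i + 1) - G.xr i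
  have e1 : ∀ k, G.xr k - G.xl k
      = G.xr ((index (N := N) k).2 : ℕ) - G.xl ((index (N := N) k).2 : ℕ) := fun k => by
    conv_lhs => rw [← index_eta (N := N) k, xr_add_mul, xl_add_mul]
    ring
  have e2 : ∀ k, G.xl (k + 1) - G.xr k = G.xl (((index (N := N) k).2 : ℕ) + 1)
      - G.xr ((index (N := N) k).2 : ℕ) := fun k => by
    conv_lhs => rw [← index_eta (N := N) k, xr_add_mul, add_right_comm, xl_add_mul]
    ring
  refine ⟨min (G.xr i1 - G.xl i1) (G.xl (i3 + 1) - G.xr i3),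
    max (G.xr i2 - G.xl i2) (G.xl (i4 + 1) - G.xr i4), ⟨?_, ?_, ?_, ?_, ?_⟩⟩
  · exact lt_min (sub_pos.2 (G.xl_lt_xr _)) (sub_pos.2 (G.xr_lt_xl _))
  · exact fun k => (min_le_left _ _).trans (by rw [e1 k]; exact h1 _)
  · exact fun k => le_trans (by rw [e1 k]; exact h2 _) (le_max_left _ _)
  · exact fun k => (min_le_right _ _).trans (by rw [e2 k]; exact h3 _)
  · exact fun k => le_trans (by rw [e2 k]; exact h4 _) (le_max_right _ _)

/-- The continuous function which is `1` on the resonator `k`, `0` on the other resonators, and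
affine between the resonators. -/
def hat (k : ℤ) (x : ℝ) : ℝ :=
  max 0 (min 1 (min ((x - G.xr (k - 1)) / (G.xl k - G.xr (k - 1)))
    ((G.xl (k + 1) - x) / (G.xl (k + 1) - G.xr k))))

lemma gap_pos (k : ℤ) : 0 < G.xl (k + 1) - G.xr k := sub_pos.2 (G.xr_lt_xl k)

lemma gap_pos' (k : ℤ) : 0 < G.xl k - G.xr (k - 1) := by
  have := G.gap_pos (k - 1); rwa [sub_add_cancel] at this

lemma continuous_hat (k : ℤ) : Continuous (G.hat k) := by
  unfold hat; fun_prop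

lemma hat_eq_zero {k : ℤ} {x : ℝ} (h : x ≤ G.xr (k - 1) ∨ G.xl (k + 1) ≤ x) : G.hat k x = 0 := by
  refine max_eq_left ((min_le_right _ _).trans ?_)
  rcases h with h | h
  · exact (min_le_left _ _).trans
      (div_nonpos_of_nonpos_of_nonneg (by linarith) (G.gap_pos' k).le)
  · exact (min_le_right _ _).trans
      (div_nonpos_of_nonpos_of_nonneg (by linarith) (G.gap_pos k).le)

lemma hat_resonator {k : ℤ} {x : ℝ} (h : x ∈ Icc (G.xl k) (G.xr k)) : G.hat k x = 1 := by
  unfold hat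
  rw [min_eq_left, max_eq_right zero_le_one]
  refine le_min ?_ ?_
  · rw [one_le_div (G.gap_pos' k)]; linarith [h.1]
  · rw [one_le_div (G.gap_pos k)]; linarith [h.2]

lemma hat_gap {k : ℤ} {x : ℝ} (h : x ∈ Icc (G.xr k) (G.xl (k + 1))) :
    G.hat k x = (G.xl (k + 1) - x) / (G.xl (k + 1) - G.xr k) := by
  unfold hat
  have h0 := G.gap_pos k
  have h1 : (G.xl (k + 1) - x) / (G.xl (k + 1) - G.xr k) ≤ 1 := by
    rw [div_le_one h0]; linarith [h.1]
  have h2 : 1 ≤ (x - G.xr (k - 1)) / (G.xl k - G.xr (k - 1)) := by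
    rw [one_le_div (G.gap_pos' k)]; linarith [h.1, G.xl_lt_xr k]
  have h3 : 0 ≤ (G.xl (k + 1) - x) / (G.xl (k + 1) - G.xr k) :=
    div_nonneg (by linarith [h.2]) h0.le
  rw [min_eq_right (h1.trans h2), min_eq_right h1, max_eq_right h3]

lemma hat_gap_succ {k : ℤ} {x : ℝ} (h : x ∈ Icc (G.xr k) (G.xl (k + 1))) :
    G.hat (k + 1) x = (x - G.xr k) / (G.xl (k + 1) - G.xr k) := by
  unfold hat
  rw [add_sub_cancel_right]
  have h0 := G.gap_pos k
  have h1 : (x - G.xr k) / (G.xl (k + 1) - G.xr k) ≤ 1 := by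
    rw [div_le_one h0]; linarith [h.2]
  have h2 : 1 ≤ (G.xl (k + 1 + 1) - x) / (G.xl (k + 1 + 1) - G.xr (k + 1)) := by
    rw [one_le_div (G.gap_pos (k + 1))]; linarith [h.2, G.xl_lt_xr (k + 1)]
  have h3 : 0 ≤ (x - G.xr k) / (G.xl (k + 1) - G.xr k) :=
    div_nonneg (by linarith [h.1]) h0.le
  rw [min_eq_left (h1.trans h2), min_eq_right h1, max_eq_right h3]

lemma hat_add_mul (k m : ℤ) (x : ℝ) : G.hat (k + m * N) (x + m * G.L) = G.hat k x := by
  unfold hat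
  rw [show k + m * N - 1 = (k - 1) + m * N by ring, show k + m * N + 1 = (k + 1) + m * N by ring]
  simp only [xl_add_mul, xr_add_mul, add_sub_add_right_eq_sub]

lemma locallyFinite_hat : LocallyFinite fun k => support (G.hat k) := by
  intro x
  refine ⟨Ioo (x - 1) (x + 1), Ioo_mem_nhds (by linarith) (by linarith), ?_⟩
  obtain ⟨m, hm⟩ := exists_nat_gt ((x + 1 - G.xl 0) / G.L)
  obtain ⟨m', hm'⟩ := exists_nat_gt ((G.xl 0 - (x - 1)) / G.L)
  rw [div_lt_iff₀ G.L_pos] at hm hm'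
  refine (finite_Icc (-(m' : ℤ) * N - 1) (m * N + 1)).subset ?_
  rintro k ⟨y, hy, hy1, hy2⟩
  have h1 : G.xr (k - 1) < y ∧ y < G.xl (k + 1) := by
    by_contra h
    refine hy (G.hat_eq_zero ?_)
    by_contra! h'
    exact h h'
  have e1 := G.xl_add_mul 0 m
  have e2 := G.xl_add_mul 0 (-(m' : ℤ))
  push_cast at e1 e2
  rw [zero_add] at e1 e2
  have h2 : k - 1 < m * N := G.xl_strictMono.lt_iff_lt.1 (by
    linarith [G.xl_lt_xr (k - 1), h1.1])
  have h3 : -(m' : ℤ) * N < k + 1 := G.xl_strictMono.lt_iff_lt.1 (by linarith [h1.2])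
  constructor <;> linarith

/-- The piecewise affine function with the value `φ k` on the resonator `k`. -/
def interp (φ : ℤ → ℂ) (x : ℝ) : ℂ := ∑ᶠ k, (G.hat k x : ℂ) * φ k

lemma continuous_interp (φ : ℤ → ℂ) : Continuous (G.interp φ) := by
  refine continuous_finsum (fun k => (continuous_ofReal.comp (G.continuous_hat k)).mul
    continuous_const) (G.locallyFinite_hat.subset fun k x hx => ?_)
  intro h
  exact hx (by simp [h])

lemma interp_resonator (φ : ℤ → ℂ) {k : ℤ} {x : ℝ} (h : x ∈ Icc (G.xl k) (G.xr k)) :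
    G.interp φ x = φ k := by
  have h0 : ∀ j, j ≠ k → (G.hat j x : ℂ) * φ j = 0 := by
    intro j hj
    rw [G.hat_eq_zero, ofReal_zero, zero_mul]
    rcases lt_or_gt_of_ne hj with hj | hj
    · exact Or.inr ((G.xl_strictMono.monotone (by omega)).trans h.1)
    · exact Or.inl (h.2.trans (G.xr_strictMono.monotone (by omega)))
  rw [interp, finsum_eq_single _ k h0, G.hat_resonator h, ofReal_one, one_mul]

lemma interp_gap (φ : ℤ → ℂ) {k : ℤ} {x : ℝ} (h : x ∈ Icc (G.xr k) (G.xl (k + 1))) :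
    G.interp φ x = φ k + (φ (k + 1) - φ k) / ((G.xl (k + 1) - G.xr k : ℝ) : ℂ)
      * ((x - G.xr k : ℝ) : ℂ) := by
  have hs : (support fun j => (G.hat j x : ℂ) * φ j) ⊆ (({k, k + 1} : Finset ℤ) : Set ℤ) := by
    intro j hj
    by_contra hjk
    simp only [Finset.coe_insert, Finset.coe_singleton, mem_insert_iff, mem_singleton_iff,
      not_or] at hjk
    refine hj ?_
    dsimp only
    rw [G.hat_eq_zero, ofReal_zero, zero_mul]
    rcases lt_or_gt_of_ne hjk.1 with hj | hj
    · exact Or.inr (((G.xl_strictMono.monotone (by omega)).trans (G.xl_lt_xr k).le).trans h.1)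
    · exact Or.inl ((h.2.trans (G.xl_lt_xr _).le).trans (G.xr_strictMono.monotone (by omega)))
  rw [interp, finsum_eq_sum_of_support_subset _ hs, Finset.sum_pair (by omega), G.hat_gap h,
    G.hat_gap_succ h]
  have h0 : ((G.xl (k + 1) - G.xr k : ℝ) : ℂ) ≠ 0 := by exact_mod_cast (G.gap_pos k).ne'
  push_cast at h0 ⊢
  field_simp
  ring

lemma interp_add_mul {φ : ℤ → ℂ} {m : ℤ} {z : ℂ} (hφ : ∀ k, φ (k + m * N) = z * φ k) (x : ℝ) :
    G.interp φ (x + m * G.L) = z * G.interp φ x := by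
  unfold interp
  rw [mul_finsum', ← finsum_comp_equiv (Equiv.addRight (m * N : ℤ))]
  · refine finsum_congr fun k => ?_
    rw [Equiv.coe_addRight, hat_add_mul, hφ]; ring
  · refine (G.locallyFinite_hat.point_finite x).subset fun k hk => ?_
    intro h
    exact hk (by simp [h])

/-- The values of `V_j^α` on the resonators. -/
def blochValue [NeZero N] (α : ℝ) (j : Fin N) (k : ℤ) : ℂ :=
  exp (I * α * (index (N := N) k).1 * G.L) * if (index (N := N) k).2 = j then 1 else 0

lemma blochValue_add_mul [NeZero N] (α : ℝ) (j : Fin N) (m k : ℤ) :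
    G.blochValue α j (k + m * N) = exp (I * α * m * G.L) * G.blochValue α j k := by
  unfold blochValue
  rw [index_add_mul, ← mul_assoc, ← Complex.exp_add]
  congr 2
  push_cast; ring

/-- Existence of a solution, without which the choice in `potential` would carry no information.
Between resonators the function is affine, hence harmonic, and its quasiperiodicity is that of the
nodal values. -/
lemma isPotential_interp [NeZero N] (α : ℝ) (j : Fin N) :
    G.IsPotential α j (G.interp (G.blochValue α j)) where
  continuous := G.continuous_interp _
  harmonic i x hx := by
    set φ := G.blochValue α j
    have hd : ∀ y ∈ Ioo (G.xr i) (G.xl (i + 1)), HasDerivAt (G.interp φ)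
        ((φ (i + 1) - φ i) / ((G.xl (i + 1) - G.xr i : ℝ) : ℂ)) y := by
      intro y hy
      have h1 : HasDerivAt (fun z : ℝ => φ i + (φ (i + 1) - φ i)
          / ((G.xl (i + 1) - G.xr i : ℝ) : ℂ) * ((z - G.xr i : ℝ) : ℂ))
          ((φ (i + 1) - φ i) / ((G.xl (i + 1) - G.xr i : ℝ) : ℂ)) y := by
        have := ((((hasDerivAt_id y).sub_const (G.xr i)).ofReal_comp).const_mul
          ((φ (i + 1) - φ i) / ((G.xl (i + 1) - G.xr i : ℝ) : ℂ))).const_add (φ i)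
        simpa using this
      refine h1.congr_of_eventuallyEq ?_
      filter_upwards [Ioo_mem_nhds hy.1 hy.2] with z hz
      exact G.interp_gap φ ⟨hz.1.le, hz.2.le⟩
    refine ⟨(hd x hx).differentiableAt, (hasDerivAt_const x
      ((φ (i + 1) - φ i) / ((G.xl (i + 1) - G.xr i : ℝ) : ℂ))).congr_of_eventuallyEq ?_⟩
    filter_upwards [Ioo_mem_nhds hx.1 hx.2] with z hz
    exact (hd z hz).deriv
  value i x hx := by
    rw [left_eq, right_eq] at hx
    rw [G.interp_resonator _ ⟨hx.1.le, hx.2.le⟩]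
    simp [blochValue, index_val]
  quasiperiodic x m := G.interp_add_mul (fun k => G.blochValue_add_mul α j m k) x

lemma isPotential_potential [NeZero N] (α : ℝ) (j : Fin N) :
    G.IsPotential α j (G.potential α j) :=
  Classical.epsilon_spec (p := G.IsPotential α j) ⟨_, G.isPotential_interp α j⟩

namespace IsPotential

variable {G} {α : ℝ} {j : Fin N} {V : ℝ → ℂ} (hV : G.IsPotential α j V)
include hV

/-- The value is prescribed in the unit cell only. Quasiperiodicity transports it to the other
cells, and continuity to the end points of the resonators. -/
lemma eq_blochValue [NeZero N] {k : ℤ} {x : ℝ} (hx : x ∈ Icc (G.xl k) (G.xr k)) :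
    V x = G.blochValue α j k := by
  have h : EqOn V (fun _ => G.blochValue α j k) (Ioo (G.xl k) (G.xr k)) := by
    intro y hy
    have e := index_eta (N := N) k
    set m := (index (N := N) k).1 with hm
    set i := (index (N := N) k).2 with hi
    have h1 := hV.quasiperiodic (y - m * G.L) m
    rw [sub_add_cancel, hV.value i (y - m * G.L)] at h1
    · rw [h1, blochValue]
    · rw [left, right, Int.cast_zero, zero_mul, add_zero, add_zero]
      rw [← e, xl_add_mul, xr_add_mul] at hy
      exact ⟨by linarith [hy.1], by linarith [hy.2]⟩
  have := h.closure hV.continuous continuous_const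
  rw [closure_Ioo (G.xl_lt_xr k).ne] at this
  exact this hx

/-- In one dimension a harmonic function is affine on the gap, and its end values fix the slope. The
capacitance matrix depends on the potential only through these slopes, so no separate uniqueness
statement is required. -/
lemma deriv_gap [NeZero N] (k : ℤ) : ∀ x ∈ Ioo (G.xr k) (G.xl (k + 1)),
    deriv V x = (G.blochValue α j (k + 1) - G.blochValue α j k)
      / ((G.xl (k + 1) - G.xr k : ℝ) : ℂ) := by
  intro x hx
  have hconst : ∀ y ∈ Ioo (G.xr k) (G.xl (k + 1)), deriv V y = deriv V x := fun y hy =>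
    isOpen_Ioo.is_const_of_deriv_eq_zero isPreconnected_Ioo
      (fun z hz => (hV.harmonic k z hz).2.differentiableAt.differentiableWithinAt)
      (fun z hz => (hV.harmonic k z hz).2.deriv) hy hx
  have h := intervalIntegral.integral_eq_sub_of_hasDerivAt_of_le (G.xr_lt_xl k).le
    hV.continuous.continuousOn (f' := fun _ => deriv V x)
    (fun y hy => by rw [← hconst y hy]; exact (hV.harmonic k y hy).1.hasDerivAt)
    (continuous_const.intervalIntegrable _ _)
  rw [intervalIntegral.integral_const,
    hV.eq_blochValue (k := k + 1) ⟨le_rfl, (G.xl_lt_xr _).le⟩,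
    hV.eq_blochValue (k := k) ⟨(G.xl_lt_xr _).le, le_rfl⟩, real_smul] at h
  have h0 : ((G.xl (k + 1) - G.xr k : ℝ) : ℂ) ≠ 0 := by exact_mod_cast (G.gap_pos k).ne'
  rw [← h, mul_div_cancel_left₀ _ h0]

end IsPotential

/-- The neighbours i - 1 and i + 1 may lie in adjacent cells, or even be translates of the resonator
i if N = 1; `blochValue` on all of ℤ carries the phase in every case. -/
lemma capacitance_apply [NeZero N] (α : ℝ) (i j : Fin N) : G.capacitance α i j
    = (G.blochValue α j i - G.blochValue α j (i - 1)) / ((G.xl i - G.xr (i - 1) : ℝ) : ℂ)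
      - (G.blochValue α j (i + 1) - G.blochValue α j i) / ((G.xl (i + 1) - G.xr i : ℝ) : ℂ) := by
  have hV := G.isPotential_potential α j
  have e0 : G.left 0 i = G.xl i := by simp [left]
  have e1 : G.right 0 i = G.xr i := by simp [right]
  rw [capacitance, Matrix.of_apply, boundaryFlux, e0, e1]
  congr 1
  · have h := hV.deriv_gap ((i : ℕ) - 1 : ℤ)
    rw [sub_add_cancel] at h
    refine leftLim_eq_of_tendsto (tendsto_const_nhds.congr' ?_)
    have : G.xr (i - 1) < G.xl i := sub_pos.1 (G.gap_pos' _)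
    filter_upwards [Ioo_mem_nhdsLT this] with x hx
    exact (h x hx).symm
  · refine rightLim_eq_of_tendsto (tendsto_const_nhds.congr' ?_)
    filter_upwards [Ioo_mem_nhdsGT (G.xr_lt_xl i)] with x hx
    exact (hV.deriv_gap i x hx).symm

/-- `∑_m w (k + m N) exp(-i α m L)`. -/
def blochSum (α : ℝ) (w : ℤ → ℂ) (k : ℤ) : ℂ :=
  ∑' m : ℤ, w (k + m * N) * exp (-(I * α * m * G.L))

lemma blochSum_add_mul (α : ℝ) (w : ℤ → ℂ) (k c : ℤ) :
    G.blochSum α w (k + c * N) = exp (I * α * c * G.L) * G.blochSum α w k := by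
  unfold blochSum
  rw [← tsum_mul_left, ← (Equiv.addRight c).tsum_eq
    fun m : ℤ => exp (I * α * c * G.L) * (w (k + m * N) * exp (-(I * α * m * G.L)))]
  refine tsum_congr fun m => ?_
  rw [Equiv.coe_addRight, mul_left_comm, ← Complex.exp_add]
  congr 2
  · ring
  · push_cast; ring

/-- The sequence of Bloch sums is α-quasiperiodic, so its value at k is the phase of the cell of k
times its value in the unit cell. -/
lemma sum_blochValue_mul [NeZero N] (α : ℝ) (w : ℤ → ℂ) (k : ℤ) :
    ∑ j : Fin N, G.blochValue α j k * G.blochSum α w j = G.blochSum α w k := by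
  have e := index_eta (N := N) k
  conv_rhs => rw [← e, blochSum_add_mul]
  simp [blochValue]

/-- On Bloch sums the matrix acts as a second difference along the whole chain, with the gap lengths
as denominators. -/
lemma sum_capacitance_mul [NeZero N] (α : ℝ) (w : ℤ → ℂ) (i : Fin N) :
    ∑ j, G.capacitance α i j * G.blochSum α w j
      = (G.blochSum α w i - G.blochSum α w (i - 1)) / ((G.xl i - G.xr (i - 1) : ℝ) : ℂ)
        - (G.blochSum α w (i + 1) - G.blochSum α w i)
          / ((G.xl (i + 1) - G.xr i : ℝ) : ℂ) := by
  rw [← sum_blochValue_mul G α w i, ← sum_blochValue_mul G α w (i - 1),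
    ← sum_blochValue_mul G α w (i + 1), ← Finset.sum_sub_distrib, ← Finset.sum_sub_distrib,
    Finset.sum_div, Finset.sum_div, ← Finset.sum_sub_distrib]
  refine Finset.sum_congr rfl fun j _ => ?_
  rw [capacitance_apply]; ring

end Chain

end SpaceTimeResonators

end

/-! ### Fourier coefficients in time and the equations of the modes. -/

noncomputable section

namespace SpaceTimeResonators

open Set Filter Topology MeasureTheory

/-- The `n`-th Fourier coefficient of a function with quasifrequency `ω`. -/
def coef (Ω : ℝ) (ω : ℂ) (n : ℤ) (f : ℝ → ℂ) : ℂ :=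
  (Ω / (2 * Real.pi) : ℝ) * ∫ t in (0 : ℝ)..(2 * Real.pi / Ω), f t * exp (-(I * (ω + n * Ω) * t))

section Coef

variable {Ω : ℝ} {ω : ℂ} {f f' : ℝ → ℂ}

lemma coef_const_mul (z : ℂ) (n : ℤ) : coef Ω ω n (fun t => z * f t) = z * coef Ω ω n f := by
  unfold coef
  simp only [mul_assoc z, intervalIntegral.integral_const_mul]
  ring

lemma continuous_mul_exp (hf : Continuous f) (n : ℤ) :
    Continuous fun t : ℝ => f t * exp (-(I * (ω + n * Ω) * t)) := by
  fun_prop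

lemma coef_deriv (hΩ : 0 < Ω) (h : ∀ t, HasDerivAt f (f' t) t) (hf' : Continuous f')
    (hp : f (2 * Real.pi / Ω) = exp (I * ω * (2 * Real.pi / Ω : ℝ)) * f 0) (n : ℤ) :
    coef Ω ω n f' = I * (ω + n * Ω) * coef Ω ω n f := by
  have hf : Continuous f := continuous_iff_continuousAt.2 fun x => (h x).continuousAt
  set z : ℂ := I * (ω + n * Ω) with hz
  have hd : ∀ t : ℝ, HasDerivAt (fun t : ℝ => f t * exp (-(z * t)))
      (f' t * exp (-(z * t)) - z * (f t * exp (-(z * t)))) t := by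
    intro t
    have h1 : HasDerivAt (fun t : ℝ => exp (-(z * t))) (exp (-(z * t)) * -(z * 1)) t :=
      ((ofRealCLM.hasDerivAt (x := t)).const_mul z).fun_neg.cexp
    refine ((h t).fun_mul h1).congr_deriv ?_
    ring
  have hc1 := continuous_mul_exp (ω := ω) (Ω := Ω) hf n
  have hc2 := continuous_mul_exp (ω := ω) (Ω := Ω) hf' n
  have hc3 : Continuous fun t : ℝ => z * (f t * exp (-(z * t))) := continuous_const.mul hc1
  have hint := intervalIntegral.integral_eq_sub_of_hasDerivAt (a := 0) (b := 2 * Real.pi / Ω)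
    (fun t _ => hd t) ((hc2.sub hc3).intervalIntegrable _ _)
  rw [intervalIntegral.integral_sub (hc2.intervalIntegrable _ _)
    (hc3.intervalIntegrable _ _),
    intervalIntegral.integral_const_mul, hp] at hint
  have e : exp (I * ω * (2 * Real.pi / Ω : ℝ)) * f 0 * exp (-(z * (2 * Real.pi / Ω : ℝ)))
      = f 0 := by
    rw [mul_right_comm, ← Complex.exp_add, hz]
    have hΩ' : (Ω : ℂ) ≠ 0 := by exact_mod_cast hΩ.ne'
    have : I * ω * (2 * Real.pi / Ω : ℝ) + -(I * (ω + n * Ω) * (2 * Real.pi / Ω : ℝ))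
        = (-n : ℤ) * (2 * Real.pi * I) := by
      push_cast; field_simp; ring
    rw [this, exp_int_mul_two_pi_mul_I, one_mul]
  rw [e] at hint
  simp only [ofReal_zero, mul_zero, neg_zero, Complex.exp_zero, mul_one, sub_self] at hint
  unfold coef
  rw [sub_eq_zero.1 hint]
  ring

/-- Multiplication by a periodic function with absolutely summable coefficients is convolution of
the coefficients; dominated convergence permits integration term by term. -/
lemma coef_mul_tsum {c : ℤ → ℂ} {g : ℝ → ℂ} (hc : Summable fun l => ‖c l‖)
    (hg : ∀ t : ℝ, g t = ∑' l : ℤ, c l * exp (I * l * Ω * t)) (hf : Continuous f) (n : ℤ) :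
    coef Ω ω n (fun t => g t * f t) = ∑' l, c l * coef Ω ω (n - l) f := by
  have hnorm : ∀ (l : ℤ) (t : ℝ), ‖exp (I * l * Ω * t)‖ = 1 := fun l t => by
    rw [show I * l * Ω * t = ((l * Ω * t : ℝ) : ℂ) * I by push_cast; ring, norm_exp_ofReal_mul_I]
  have key : HasSum (fun l => ∫ t in (0 : ℝ)..(2 * Real.pi / Ω),
      c l * (f t * exp (-(I * (ω + (n - l : ℤ) * Ω) * t))))
      (∫ t in (0 : ℝ)..(2 * Real.pi / Ω), g t * f t * exp (-(I * (ω + n * Ω) * t))) := by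
    have hm := (continuous_mul_exp (ω := ω) (Ω := Ω) hf n).norm
    refine intervalIntegral.hasSum_integral_of_dominated_convergence
      (fun l t => ‖c l‖ * ‖f t * exp (-(I * (ω + n * Ω) * t))‖)
      (fun l => (continuous_const.mul (continuous_mul_exp hf _)).aestronglyMeasurable)
      (fun l => Eventually.of_forall fun t _ => ?_)
      (Eventually.of_forall fun t _ => hc.mul_right _) ?_
      (Eventually.of_forall fun t _ => ?_)
    · have : exp (-(I * (ω + (n - l : ℤ) * Ω) * t))
          = exp (-(I * (ω + n * Ω) * t)) * exp (I * l * Ω * t) := by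
        rw [← Complex.exp_add]; congr 1; push_cast; ring
      rw [this, ← mul_assoc (f t), norm_mul, norm_mul, hnorm, mul_one]
    · simp only [tsum_mul_right]
      exact (continuous_const.mul hm).intervalIntegrable _ _
    · have hs : Summable fun l : ℤ => c l * exp (I * l * Ω * t) :=
        Summable.of_norm (by simpa [norm_mul, hnorm] using hc)
      have h1 := hs.hasSum.mul_right (f t * exp (-(I * (ω + n * Ω) * t)))
      rw [← hg t, ← mul_assoc (g t)] at h1
      refine h1.congr_fun fun l => ?_
      have : exp (-(I * (ω + (n - l : ℤ) * Ω) * t))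
          = exp (-(I * (ω + n * Ω) * t)) * exp (I * l * Ω * t) := by
        rw [← Complex.exp_add]; congr 1; push_cast; ring
      rw [this]; ring
  unfold coef
  rw [← key.tsum_eq, ← tsum_mul_left]
  refine tsum_congr fun l => ?_
  rw [intervalIntegral.integral_const_mul]; ring

lemma coef_mul_sum {c : ℤ → ℂ} {s : Finset ℤ} {g : ℝ → ℂ}
    (hg : ∀ t : ℝ, g t = ∑ l ∈ s, c l * exp (I * l * Ω * t)) (hf : Continuous f) (n : ℤ) :
    coef Ω ω n (fun t => g t * f t) = ∑ l ∈ s, c l * coef Ω ω (n - l) f := by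
  classical
  have h0 : ∀ l, l ∉ s → (if l ∈ s then c l else 0) = 0 := fun l hl => if_neg hl
  rw [coef_mul_tsum (c := fun l => if l ∈ s then c l else 0) (Ω := Ω)
    (summable_of_ne_finset_zero (s := s) fun l hl => by simp [hl]) (fun t => ?_) hf,
    tsum_eq_sum (s := s) fun l hl => by simp [hl]]
  · exact Finset.sum_congr rfl fun l hl => by simp [hl]
  · rw [hg, tsum_eq_sum (s := s) fun l hl => by simp [hl]]
    exact Finset.sum_congr rfl fun l hl => by simp [hl]

variable {F Fx : ℝ × ℝ → ℂ}

lemma continuous_coef (hF : Continuous F) (n : ℤ) :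
    Continuous fun x => coef Ω ω n fun t => F (x, t) := by
  unfold coef
  refine continuous_const.mul (intervalIntegral.continuous_parametric_intervalIntegral_of_continuous'
    ?_ _ _)
  simp only [uncurry_def]
  fun_prop

lemma hasDerivAt_coef (hF : Continuous F) (hFx : Continuous Fx)
    (h : ∀ x t, HasDerivAt (fun y => F (y, t)) (Fx (x, t)) x) (n : ℤ) (x : ℝ) :
    HasDerivAt (fun x => coef Ω ω n fun t => F (x, t)) (coef Ω ω n fun t => Fx (x, t)) x := by
  unfold coef
  refine HasDerivAt.const_mul _ ?_
  have hc : Continuous fun p : ℝ × ℝ => Fx p * exp (-(I * (ω + n * Ω) * (p.2 : ℝ))) := by fun_prop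
  obtain ⟨B, hB⟩ := ((isCompact_closedBall x 1).prod
    (isCompact_uIcc (a := (0 : ℝ)) (b := 2 * Real.pi / Ω))).exists_bound_of_continuousOn
    hc.continuousOn
  have hF1 : ∀ y, Continuous fun t : ℝ => F (y, t) * exp (-(I * (ω + n * Ω) * t)) := fun y => by
    fun_prop
  have hF2 : Continuous fun t : ℝ => Fx (x, t) * exp (-(I * (ω + n * Ω) * t)) := by
    fun_prop
  refine (intervalIntegral.hasDerivAt_integral_of_dominated_loc_of_deriv_le
    (F := fun y t => F (y, t) * exp (-(I * (ω + n * Ω) * (t : ℝ))))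
    (F' := fun y t => Fx (y, t) * exp (-(I * (ω + n * Ω) * (t : ℝ))))
    (bound := fun _ => B) (Metric.ball_mem_nhds x one_pos)
    (Eventually.of_forall fun y => (hF1 y).aestronglyMeasurable)
    ((hF1 x).intervalIntegrable _ _) hF2.aestronglyMeasurable
    (Eventually.of_forall fun t ht y hy => ?_) (continuous_const.intervalIntegrable _ _)
    (Eventually.of_forall fun t ht y hy => (h y t).mul_const _)).2
  exact hB (y, t) ⟨Metric.ball_subset_closedBall hy, uIoc_subset_uIcc ht⟩

end Coef

/-- A `C²` extension of `u` from `(a, b) × ℝ`, with its partial derivatives. -/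
structure Extension (u : ℝ → ℝ → ℂ) (a b : ℝ) where
  U : ℝ × ℝ → ℂ
  Ux : ℝ × ℝ → ℂ
  Uxx : ℝ × ℝ → ℂ
  Ut : ℝ × ℝ → ℂ
  Utt : ℝ × ℝ → ℂ
  lt : a < b
  continuous_U : Continuous U
  continuous_Ux : Continuous Ux
  continuous_Uxx : Continuous Uxx
  continuous_Ut : Continuous Ut
  continuous_Utt : Continuous Utt
  hasDeriv_x : ∀ x t, HasDerivAt (fun y => U (y, t)) (Ux (x, t)) x
  hasDeriv_xx : ∀ x t, HasDerivAt (fun y => Ux (y, t)) (Uxx (x, t)) x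
  hasDeriv_t : ∀ x t, HasDerivAt (fun τ => U (x, τ)) (Ut (x, t)) t
  hasDeriv_tt : ∀ x t, HasDerivAt (fun τ => Ut (x, τ)) (Utt (x, t)) t
  eq_on : ∀ x ∈ Ioo a b, ∀ t, u x t = U (x, t)

lemma IsC2UpToBoundary.nonempty_extension {u : ℝ → ℝ → ℂ} {a b : ℝ} (hab : a < b)
    (h : IsC2UpToBoundary u a b) : Nonempty (Extension u a b) := by
  obtain ⟨U, hU, he⟩ := h
  have hpart : ∀ (V : ℝ × ℝ → ℂ) (v : ℝ × ℝ) (k : WithTop ℕ∞), ContDiff ℝ (k + 1) V →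
      ContDiff ℝ k fun p => fderiv ℝ V p v := fun V v k hV =>
    (hV.fderiv_right (m := k) le_rfl).clm_apply contDiff_const
  have hx : ∀ (V : ℝ × ℝ → ℂ), ContDiff ℝ 1 V → ∀ x t,
      HasDerivAt (fun y => V (y, t)) (fderiv ℝ V (x, t) (1, 0)) x := fun V hV x t =>
    ((hV.differentiable one_ne_zero).differentiableAt.hasFDerivAt (x := (x, t))).comp_hasDerivAt x
      ((hasDerivAt_id x).prodMk (hasDerivAt_const x t))
  have ht : ∀ (V : ℝ × ℝ → ℂ), ContDiff ℝ 1 V → ∀ x t,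
      HasDerivAt (fun τ => V (x, τ)) (fderiv ℝ V (x, t) (0, 1)) t := fun V hV x t =>
    ((hV.differentiable one_ne_zero).differentiableAt.hasFDerivAt (x := (x, t))).comp_hasDerivAt t
      ((hasDerivAt_const t x).prodMk (hasDerivAt_id t))
  have hU2 : ContDiff ℝ (1 + 1) U := by rwa [one_add_one_eq_two]
  have hU1 : ContDiff ℝ 1 U := hU.of_le one_le_two
  have hUx := hpart U (1, 0) 1 hU2
  have hUt := hpart U (0, 1) 1 hU2
  exact ⟨⟨U, _, _, _, _, hab, hU.continuous, hUx.continuous,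
    (hpart _ (1, 0) 0 (by rwa [zero_add])).continuous, hUt.continuous,
    (hpart _ (0, 1) 0 (by rwa [zero_add])).continuous, hx U hU1, hx _ hUx, ht U hU1, ht _ hUt, he⟩⟩

namespace Extension

variable {u : ℝ → ℝ → ℂ} {a b : ℝ} (E : Extension u a b)

include E

lemma deriv_t {x : ℝ} (hx : x ∈ Ioo a b) (t : ℝ) : deriv (u x) t = E.Ut (x, t) := by
  rw [show u x = fun τ => E.U (x, τ) from funext (E.eq_on x hx)]
  exact (E.hasDeriv_t x t).deriv

lemma deriv_x {x : ℝ} (hx : x ∈ Ioo a b) (t : ℝ) : deriv (fun y => u y t) x = E.Ux (x, t) := by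
  refine ((E.hasDeriv_x x t).congr_of_eventuallyEq ?_).deriv
  filter_upwards [Ioo_mem_nhds hx.1 hx.2] with y hy using E.eq_on y hy t

lemma deriv_xx {x : ℝ} (hx : x ∈ Ioo a b) (t : ℝ) :
    deriv (deriv fun y => u y t) x = E.Uxx (x, t) := by
  refine ((E.hasDeriv_xx x t).congr_of_eventuallyEq ?_).deriv
  filter_upwards [Ioo_mem_nhds hx.1 hx.2] with y hy using E.deriv_x hy t

lemma leftLim_u (t : ℝ) : leftLim (fun y => u y t) b = E.U (b, t) := by
  have hc : Continuous fun y => E.U (y, t) := E.continuous_U.comp (Continuous.prodMk_left t)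
  refine leftLim_eq_of_tendsto ((hc.tendsto b).mono_left nhdsWithin_le_nhds |>.congr' ?_)
  filter_upwards [Ioo_mem_nhdsLT E.lt] with y hy using (E.eq_on y hy t).symm

lemma rightLim_u (t : ℝ) : rightLim (fun y => u y t) a = E.U (a, t) := by
  have hc : Continuous fun y => E.U (y, t) := E.continuous_U.comp (Continuous.prodMk_left t)
  refine rightLim_eq_of_tendsto ((hc.tendsto a).mono_left nhdsWithin_le_nhds |>.congr' ?_)
  filter_upwards [Ioo_mem_nhdsGT E.lt] with y hy using (E.eq_on y hy t).symm

lemma leftLim_deriv (t : ℝ) : leftLim (deriv fun y => u y t) b = E.Ux (b, t) := by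
  have hc : Continuous fun y => E.Ux (y, t) := E.continuous_Ux.comp (Continuous.prodMk_left t)
  refine leftLim_eq_of_tendsto ((hc.tendsto b).mono_left nhdsWithin_le_nhds |>.congr' ?_)
  filter_upwards [Ioo_mem_nhdsLT E.lt] with y hy using (E.deriv_x hy t).symm

lemma rightLim_deriv (t : ℝ) : rightLim (deriv fun y => u y t) a = E.Ux (a, t) := by
  have hc : Continuous fun y => E.Ux (y, t) := E.continuous_Ux.comp (Continuous.prodMk_left t)
  refine rightLim_eq_of_tendsto ((hc.tendsto a).mono_left nhdsWithin_le_nhds |>.congr' ?_)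
  filter_upwards [Ioo_mem_nhdsGT E.lt] with y hy using (E.deriv_x hy t).symm

lemma mode_eq {Ω : ℝ} {ω : ℂ} (n : ℤ) {x : ℝ} (hx : x ∈ Ioo a b) :
    mode Ω ω u n x = coef Ω ω n fun t => E.U (x, t) := by
  rw [← show u x = fun τ => E.U (x, τ) from funext (E.eq_on x hx)]
  rfl

variable {Ω : ℝ} {ω : ℂ}
  (hp : ∀ x, Periodic (fun t : ℝ => u x t * exp (-(I * ω * t))) (2 * Real.pi / Ω))

include hp

lemma quasiperiodic {x : ℝ} (hx : x ∈ Ioo a b) (t : ℝ) : E.U (x, t + 2 * Real.pi / Ω)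
    = exp (I * ω * (2 * Real.pi / Ω : ℝ)) * E.U (x, t) := by
  have h := hp x t
  dsimp only at h
  rw [E.eq_on x hx, E.eq_on x hx] at h
  have e : exp (-(I * ω * t)) = exp (-(I * ω * (t + 2 * Real.pi / Ω : ℝ)))
      * exp (I * ω * (2 * Real.pi / Ω : ℝ)) := by
    rw [← Complex.exp_add]; congr 1; push_cast; ring
  rw [e] at h
  refine mul_right_cancel₀ (Complex.exp_ne_zero (-(I * ω * (t + 2 * Real.pi / Ω : ℝ)))) (h.trans ?_)
  ring

lemma quasiperiodic_t {x : ℝ} (hx : x ∈ Ioo a b) (t : ℝ) : E.Ut (x, t + 2 * Real.pi / Ω)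
    = exp (I * ω * (2 * Real.pi / Ω : ℝ)) * E.Ut (x, t) := by
  have h1 : HasDerivAt (fun τ => E.U (x, τ + 2 * Real.pi / Ω)) (E.Ut (x, t + 2 * Real.pi / Ω)) t :=
    (E.hasDeriv_t x (t + 2 * Real.pi / Ω)).comp_add_const t _
  have h2 := (E.hasDeriv_t x t).const_mul (exp (I * ω * (2 * Real.pi / Ω : ℝ)))
  have e : (fun τ => E.U (x, τ + 2 * Real.pi / Ω))
      = fun τ => exp (I * ω * (2 * Real.pi / Ω : ℝ)) * E.U (x, τ) :=
    funext (E.quasiperiodic hp hx)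
  rw [e] at h1
  exact h1.unique h2

lemma coef_Ut (hΩ : 0 < Ω) {x : ℝ} (hx : x ∈ Ioo a b) (n : ℤ) :
    coef Ω ω n (fun t => E.Ut (x, t)) = I * (ω + n * Ω) * coef Ω ω n fun t => E.U (x, t) :=
  coef_deriv hΩ (E.hasDeriv_t x) (E.continuous_Ut.comp (Continuous.prodMk_right x))
    (by simpa using E.quasiperiodic hp hx 0) n

lemma coef_Utt (hΩ : 0 < Ω) {x : ℝ} (hx : x ∈ Ioo a b) (n : ℤ) :
    coef Ω ω n (fun t => E.Utt (x, t)) = I * (ω + n * Ω) * coef Ω ω n fun t => E.Ut (x, t) :=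
  coef_deriv hΩ (E.hasDeriv_tt x) (E.continuous_Utt.comp (Continuous.prodMk_right x))
    (by simpa using E.quasiperiodic_t hp hx 0) n

/-- The modes in a gap solve the Helmholtz equation. -/
lemma coef_Uxx_background (hΩ : 0 < Ω) {v₀ : ℝ} (hv : 0 < v₀)
    (h : ∀ x ∈ Ioo a b, ∀ t : ℝ,
      deriv (deriv (u x)) t - (v₀ : ℂ) ^ 2 * deriv (deriv fun y => u y t) x = 0)
    (n : ℤ) {x : ℝ} (hx : x ∈ Icc a b) :
    coef Ω ω n (fun t => E.Uxx (x, t))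
      = -(((ω + n * Ω) / v₀) ^ 2 * coef Ω ω n fun t => E.U (x, t)) := by
  have key : EqOn (fun x => coef Ω ω n (fun t => E.Uxx (x, t)))
      (fun x => -(((ω + n * Ω) / v₀) ^ 2 * coef Ω ω n fun t => E.U (x, t))) (Ioo a b) := by
    intro x hx
    have hv' : (v₀ : ℂ) ≠ 0 := by exact_mod_cast hv.ne'
    have e : (fun t => E.Utt (x, t)) = fun t => (v₀ : ℂ) ^ 2 * E.Uxx (x, t) := by
      funext t
      have h1 := h x hx t
      rw [show deriv (u x) = fun t => E.Ut (x, t) from funext (E.deriv_t hx), E.deriv_xx hx,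
        (E.hasDeriv_tt x t).deriv] at h1
      exact sub_eq_zero.1 h1
    have h2 := E.coef_Utt hp hΩ hx n
    rw [e, coef_const_mul, E.coef_Ut hp hΩ hx n] at h2
    dsimp only
    have h3 : coef Ω ω n (fun t => E.Uxx (x, t))
      = (I * (ω + n * Ω) * (I * (ω + n * Ω) * coef Ω ω n fun t => E.U (x, t))) / (v₀ : ℂ) ^ 2 := by
      rw [← h2, mul_div_cancel_left₀ _ (pow_ne_zero 2 hv')]
    rw [h3, div_pow]
    field_simp
    ring_nf
    rw [I_sq]; ring
  -- The wave equation is assumed inside the gap only; both sides are continuous in x, so the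
  -- identity extends to the end points, where the fluxes are taken.
  have := key.closure (continuous_coef E.continuous_Uxx n)
    ((continuous_const.mul (continuous_coef E.continuous_U n)).neg)
  rw [closure_Ioo E.lt.ne] at this
  exact this hx

/-- The equation of the modes in a resonator with modulated bulk modulus. -/
lemma coef_Uxx_resonator (hΩ : 0 < Ω) {κ : ℝ → ℝ} {r : ℝ} (hr : 0 < r) {c : ℤ → ℂ} {s : Finset ℤ}
    (hκ : ∀ t : ℝ, ((1 / κ t : ℝ) : ℂ) = ∑ l ∈ s, c l * exp (I * l * Ω * t))
    (h : ∀ x ∈ Ioo a b, ∀ t : ℝ, deriv (fun τ => ((1 / κ τ : ℝ) : ℂ) * deriv (u x) τ) t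
      - ((1 / r : ℝ) : ℂ) * deriv (deriv fun y => u y t) x = 0)
    (n : ℤ) {x : ℝ} (hx : x ∈ Icc a b) :
    coef Ω ω n (fun t => E.Uxx (x, t)) = -(r * ((ω + n * Ω) * ∑ l ∈ s,
      c l * ((ω + (n - l : ℤ) * Ω) * coef Ω ω (n - l) fun t => E.U (x, t)))) := by
  have key : EqOn (fun x => coef Ω ω n (fun t => E.Uxx (x, t)))
      (fun x => -(r * ((ω + n * Ω) * ∑ l ∈ s,
        c l * ((ω + (n - l : ℤ) * Ω) * coef Ω ω (n - l) fun t => E.U (x, t))))) (Ioo a b) := by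
    intro x hx
    dsimp only
    have hr' : (r : ℂ) ≠ 0 := by exact_mod_cast hr.ne'
    have hκd : ∀ t : ℝ, HasDerivAt (fun t : ℝ => ((1 / κ t : ℝ) : ℂ))
        (∑ l ∈ s, c l * (exp (I * l * Ω * t) * (I * l * Ω))) t := by
      intro t
      rw [show (fun t : ℝ => ((1 / κ t : ℝ) : ℂ)) = fun t : ℝ => ∑ l ∈ s, c l * exp (I * l * Ω * t)
        from funext hκ]
      refine HasDerivAt.fun_sum fun l _ => HasDerivAt.const_mul _ ?_
      simpa using ((ofRealCLM.hasDerivAt (x := t)).const_mul (I * l * Ω)).cexp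
    have hκc : Continuous fun t : ℝ => ((1 / κ t : ℝ) : ℂ) :=
      continuous_iff_continuousAt.2 fun t => (hκd t).continuousAt
    have hκp : ((1 / κ (2 * Real.pi / Ω) : ℝ) : ℂ) = ((1 / κ 0 : ℝ) : ℂ) := by
      rw [hκ, hκ]
      refine Finset.sum_congr rfl fun l _ => ?_
      have hΩ' : (Ω : ℂ) ≠ 0 := by exact_mod_cast hΩ.ne'
      have : I * l * Ω * (2 * Real.pi / Ω : ℝ) = l * (2 * Real.pi * I) := by
        push_cast; field_simp
      rw [this, exp_int_mul_two_pi_mul_I]; simp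
    have hUtc : Continuous fun t => E.Ut (x, t) := E.continuous_Ut.comp (Continuous.prodMk_right x)
    set g : ℝ → ℂ := fun t => ((1 / κ t : ℝ) : ℂ) * E.Ut (x, t) with hg
    -- The equation itself identifies the derivative of (1/κ) ∂_t u as a continuous function, so κ
    -- never has to be differentiated explicitly afterwards.
    have hgd : ∀ t, HasDerivAt g (((1 / r : ℝ) : ℂ) * E.Uxx (x, t)) t := by
      intro t
      have h1 := h x hx t
      rw [show deriv (u x) = fun t => E.Ut (x, t) from funext (E.deriv_t hx), E.deriv_xx hx] at h1
      rw [← sub_eq_zero.1 h1]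
      exact ((hκd t).fun_mul (E.hasDeriv_tt x t)).differentiableAt.hasDerivAt
    have h2 := coef_deriv (ω := ω) hΩ hgd
      (continuous_const.mul (E.continuous_Uxx.comp (Continuous.prodMk_right x))) (by
        have := E.quasiperiodic_t hp hx 0
        rw [zero_add] at this
        rw [hg]
        dsimp only
        rw [this, hκp]; ring) n
    rw [coef_const_mul, hg, coef_mul_sum (ω := ω) hκ hUtc] at h2
    have h3 : coef Ω ω n (fun t => E.Uxx (x, t))
        = r * (((1 / r : ℝ) : ℂ) * coef Ω ω n fun t => E.Uxx (x, t)) := by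
      rw [← mul_assoc, ← ofReal_mul, mul_one_div_cancel hr.ne', ofReal_one, one_mul]
    rw [h3, h2, ← mul_neg]
    congr 1
    simp only [Finset.mul_sum, ← Finset.sum_neg_distrib]
    refine Finset.sum_congr rfl fun l _ => ?_
    rw [E.coef_Ut hp hΩ hx]
    linear_combination (ω + n * Ω) * c l * (ω + (n - l : ℤ) * Ω)
      * coef Ω ω (n - l) (fun t => E.U (x, t)) * I_sq
  have := key.closure (continuous_coef E.continuous_Uxx n)
    ((continuous_const.mul (continuous_const.mul (continuous_finsetSum _ fun l _ =>
      continuous_const.mul (continuous_const.mul (continuous_coef E.continuous_U _))))).neg)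
  rw [closure_Ioo E.lt.ne] at this
  exact this hx

end Extension

end SpaceTimeResonators

end

/-! ### From a wave field to its mode system. -/

noncomputable section

namespace SpaceTimeResonators

open Set Filter Topology MeasureTheory

/-- Cauchy–Schwarz against the constant 1, derived from the nonnegativity of the variance ∫ (f -
μ)². -/
lemma integral_le_sqrt_mul_sqrt {f : ℝ → ℝ} {a b : ℝ} (hab : a < b) (hf : Continuous f) :
    ∫ x in a..b, f x ≤ √(b - a) * √(∫ x in a..b, f x ^ 2) := by
  have hpos : 0 < b - a := sub_pos.2 hab
  set J := ∫ x in a..b, f x with hJ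
  set μ := J / (b - a) with hμ
  have h0 : 0 ≤ ∫ x in a..b, (f x - μ) ^ 2 :=
    intervalIntegral.integral_nonneg hab.le fun x _ => sq_nonneg _
  have h1 : ∫ x in a..b, (f x - μ) ^ 2
      = (∫ x in a..b, f x ^ 2) - 2 * μ * J + (b - a) * μ ^ 2 := by
    have e : ∀ x, (f x - μ) ^ 2 = f x ^ 2 - 2 * μ * f x + μ ^ 2 := fun x => by ring
    simp only [e]
    have i1 : IntervalIntegrable (fun x => f x ^ 2) volume a b :=
      (hf.pow 2).intervalIntegrable _ _
    have i2 : IntervalIntegrable (fun x => 2 * μ * f x) volume a b :=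
      (continuous_const.mul hf).intervalIntegrable _ _
    rw [intervalIntegral.integral_add (i1.sub i2) (continuous_const.intervalIntegrable _ _),
      intervalIntegral.integral_sub i1 i2, intervalIntegral.integral_const_mul,
      intervalIntegral.integral_const, smul_eq_mul]
  have h2 : J ^ 2 ≤ (b - a) * ∫ x in a..b, f x ^ 2 := by
    have e : J = (b - a) * μ := by rw [hμ]; field_simp
    rw [h1] at h0
    have : 0 ≤ (b - a) * ((∫ x in a..b, f x ^ 2) - 2 * μ * J + (b - a) * μ ^ 2) := by positivity
    rw [e] at this ⊢
    nlinarith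
  rw [← Real.sqrt_mul hpos.le]
  exact Real.le_sqrt_of_sq_le h2

/-- Passing from cells to single resonators repeats each term N times. -/
lemma SumLE.comp_index {N : ℕ} [NeZero N] {f : ℤ × ℤ → ℝ} {S : ℝ} (hf : SumLE f S) :
    SumLE (fun p : ℤ × ℤ => f (p.1, (Chain.index (N := N) p.2).1)) (N * S) := by
  have h1 : Summable fun q : (ℤ × ℤ) × Fin N => f q.1 * (fun _ : Fin N => (1 : ℝ)) q.2 :=
    hf.2.1.mul_of_nonneg (f := f) (g := fun _ : Fin N => (1 : ℝ)) .of_finite hf.1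
      fun _ => zero_le_one
  let e : ℤ × ℤ ≃ (ℤ × ℤ) × Fin N :=
    ((Equiv.refl ℤ).prodCongr (Chain.index (N := N))).trans (Equiv.prodAssoc ℤ ℤ (Fin N)).symm
  have h2 : (fun p : ℤ × ℤ => f (p.1, (Chain.index (N := N) p.2).1))
      = fun p => (fun q : (ℤ × ℤ) × Fin N => f q.1 * (fun _ : Fin N => (1 : ℝ)) q.2) (e p) := by
    funext p; simp [e]
  refine ⟨fun p => hf.1 _, ?_, ?_⟩
  · rw [h2]; exact e.summable_iff.2 h1
  · rw [h2, e.tsum_eq (fun q : (ℤ × ℤ) × Fin N => f q.1 * (fun _ : Fin N => (1 : ℝ)) q.2),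
      h1.tsum_prod]
    simp only [mul_one, tsum_fintype, Finset.sum_const, Finset.card_univ, Fintype.card_fin,
      nsmul_eq_mul, tsum_mul_left]
    exact mul_le_mul_of_nonneg_left hf.2.2 (Nat.cast_nonneg _)

/-- The abstract mode system `X` consists of the modes of the wave field `u` in the chain. -/
structure ModeSystem.Represents {N : ℕ} [NeZero N] {G : Chain N} {v₀ c C : ℝ}
    (X : ModeSystem G.xl G.xr v₀ c C) (P : Material N) (ω : ℂ) (u : ℝ → ℝ → ℂ) : Prop where
  S_eq : X.S = size G P.Ω ω u
  w_eq : ∀ n : ℤ, X.w n = ω + n * P.Ω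
  δ_eq : ∀ k, X.δ k = P.δ (Chain.index (N := N) k).1 (Chain.index (N := N) k).2
  r_eq : ∀ k, X.r k = P.ρ (Chain.index (N := N) k).1 (Chain.index (N := N) k).2 / P.κr
  κ_add : ∀ k m : ℤ, X.κ (k + m * N) = X.κ k
  σ_add : ∀ k m : ℤ, X.σ (k + m * N) = X.σ k
  κ_eq : ∀ (i : Fin N) (t : ℝ), ((1 / P.κ i t : ℝ) : ℂ)
    = ∑ l ∈ X.band, X.κ i l * exp (I * l * P.Ω * t)
  σ_eq : ∀ (i : Fin N) (t : ℝ), ((1 / P.s i t : ℝ) : ℂ)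
    = ∑ l ∈ X.band, X.σ i l * exp (I * l * P.Ω * t)
  mode_eq : ∀ k n, ∀ x ∈ Ioo (G.xl k) (G.xr k), mode P.Ω ω u n x = X.A k n x
  summable : Summable fun p => (1 + ‖X.w p.1‖ ^ 2) * X.b p

/-- The constant of the mode system of a wave field in the regime of constant `C`. -/
def systemConst (N : ℕ) (h₁ C : ℝ) : ℝ := C + C ^ 2 + N * C + N * √h₁ * (1 + C)

section

variable {N : ℕ} {G : Chain N} {γ C d : ℝ} {M : ℕ} {P : Material N} {ω : ℂ} {u : ℝ → ℝ → ℂ}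

lemma modeNorm_nonneg (Ω : ℝ) (n m : ℤ) : 0 ≤ modeNorm G Ω ω u n m := Real.sqrt_nonneg _

lemma IsLocalised.summable_modeNorm {Ω : ℝ} (h : IsLocalised G Ω ω u) :
    SumLE (fun p : ℤ × ℤ => modeNorm G Ω ω u p.1 p.2) (size G Ω ω u) := by
  refine ⟨fun p => modeNorm_nonneg Ω _ _, ?_, le_rfl⟩
  refine Summable.of_nonneg_of_le (fun p => modeNorm_nonneg Ω _ _) (fun p => ?_) h
  exact le_mul_of_one_le_left (modeNorm_nonneg Ω _ _) (by linarith [sq_nonneg ‖ω + p.1 * Ω‖])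

lemma IsSubwavelength.sumLE_tail {Ω : ℝ} (hd : 0 < d) (hd1 : d ≤ 1) (hl : IsLocalised G Ω ω u)
    (h : IsSubwavelength G Ω ω u C γ d M) :
    SumLE (fun p : ℤ × ℤ => if (M : ℤ) < |p.1| then
      (1 + ‖ω + p.1 * Ω‖ ^ 2 / d) * modeNorm G Ω ω u p.1 p.2 else 0)
      (C * d ^ ((1 - γ) / 2) * size G Ω ω u) := by
  have h0 : ∀ p : ℤ × ℤ, 0 ≤ (1 + ‖ω + p.1 * Ω‖ ^ 2 / d) * modeNorm G Ω ω u p.1 p.2 := fun p =>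
    mul_nonneg (by positivity) (modeNorm_nonneg Ω _ _)
  refine ⟨fun p => by dsimp only; split_ifs; exacts [h0 p, le_rfl], ?_, h.tail_le⟩
  refine Summable.of_nonneg_of_le (fun p => by split_ifs; exacts [h0 p, le_rfl])
    (fun p => ?_) (hl.mul_left (1 / d))
  have h1 : (1 + ‖ω + p.1 * Ω‖ ^ 2 / d) * modeNorm G Ω ω u p.1 p.2
      ≤ 1 / d * ((1 + ‖ω + p.1 * Ω‖ ^ 2) * modeNorm G Ω ω u p.1 p.2) := by
    rw [← mul_assoc]
    refine mul_le_mul_of_nonneg_right ?_ (modeNorm_nonneg Ω _ _)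
    have : 1 ≤ 1 / d := by rwa [le_div_iff₀ hd, one_mul]
    rw [mul_add, mul_one, one_div_mul_eq_div]
    linarith
  split_ifs
  · exact h1
  · exact (h0 p).trans h1

lemma Material.IsHighContrast.C_pos (h : P.IsHighContrast C d M) : 0 < C := by
  have h1 := h.Ω_pos.trans_le h.Ω_le
  exact pos_of_mul_pos_left h1 (Real.sqrt_nonneg d)

lemma Material.IsHighContrast.δ_pos (hd : 0 < d) (h : P.IsHighContrast C d M) (m : ℤ) (i : Fin N) :
    0 < P.δ m i :=
  pos_of_mul_pos_right (hd.trans_le (h.δ_ge m i)) h.C_pos.le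

lemma rpow_half_sq (hd : 0 < d) : (d ^ ((1 - γ) / 2)) ^ 2 = d ^ (1 - γ) := by
  rw [← Real.rpow_natCast, ← Real.rpow_mul hd.le]
  congr 1
  push_cast; ring

/-- The modulation frequencies up to the order `M` are small. -/
lemma Material.IsHighContrast.mul_Ω_le (hd : 0 < d) (h : P.IsHighContrast C d M)
    (hM : (M : ℝ) ≤ C * d ^ (-γ / 2)) {l : ℤ} (hl : |l| ≤ M) :
    ‖(l : ℂ) * P.Ω‖ ≤ C ^ 2 * d ^ ((1 - γ) / 2) := by
  have hC := h.C_pos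
  have h1 : |(l : ℝ)| ≤ C * d ^ (-γ / 2) := by
    refine le_trans ?_ hM
    exact_mod_cast hl
  have h2 : d ^ ((1 - γ) / 2) = d ^ (-γ / 2) * √d := by
    rw [Real.sqrt_eq_rpow, ← Real.rpow_add hd]; congr 1; ring
  rw [norm_mul, norm_real, Real.norm_of_nonneg h.Ω_pos.le, norm_intCast, h2]
  calc |(l : ℝ)| * P.Ω ≤ (C * d ^ (-γ / 2)) * (C * √d) :=
        mul_le_mul h1 h.Ω_le h.Ω_pos.le (by positivity)
    _ = _ := by ring

/-- Translation into the frequency domain. The fields are Fourier coefficients of C² extensions from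
each resonator and gap, so that one-sided limits become values at end points. The constant is
independent of d, which makes the uniform bounds for mode systems applicable. -/
theorem exists_modeSystem [NeZero N] {v₀ h₀ h₁ c : ℝ} (hg : LengthBounds G.xl G.xr h₀ h₁)
    (hv : 0 < v₀) (hγ : γ ∈ Ioo (0 : ℝ) 1) (hd : 0 < d) (hd1 : d ≤ 1)
    (hsmall : 8 * (systemConst N h₁ C * d ^ ((1 - γ) / 2)) ≤ c)
    (hM : (M : ℝ) ≤ C * d ^ (-γ / 2)) (hP : P.IsHighContrast C d M)
    (hu : IsSolution G v₀ P ω u) (hl : IsLocalised G P.Ω ω u)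
    (hs : IsSubwavelength G P.Ω ω u C γ d M) :
    ∃ X : ModeSystem G.xl G.xr v₀ c (systemConst N h₁ C),
      X.ε = d ^ ((1 - γ) / 2) ∧ X.Represents P ω u := by
  have hC := hP.C_pos
  have hh1 : 0 ≤ √h₁ := Real.sqrt_nonneg _
  set C' := systemConst N h₁ C
  have hC'd : C' = C + C ^ 2 + N * C + N * √h₁ * (1 + C) := rfl
  have p1 : 0 ≤ C ^ 2 := sq_nonneg C
  have p2 : 0 ≤ N * C := by positivity
  have p3 : 0 ≤ N * √h₁ := by positivity
  have p4 : 0 ≤ N * √h₁ * C := by positivity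
  -- Uses of the summands: C for the material bounds, C + C² for the low frequencies |ω| + |nΩ|, N C
  -- for kernels summed over the resonators of a cell, N √h₁ for passing from L² on cells to L¹ on
  -- resonators, and N √h₁ C for the same in the tail.
  have hCC' : C ≤ C' := by rw [hC'd]; linarith
  have hNC' : N * C ≤ C' := by rw [hC'd]; linarith
  have hsq : C + C ^ 2 ≤ C' := by rw [hC'd]; linarith
  have hNh : N * √h₁ ≤ C' := by rw [hC'd]; linarith
  have hNhC : N * √h₁ * C ≤ C' := by rw [hC'd]; linarith
  set ε := d ^ ((1 - γ) / 2) with hε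
  have hεpos : 0 < ε := Real.rpow_pos_of_pos hd _
  have hshift : ∀ l : ℤ, |l| ≤ M → ‖(l : ℂ) * P.Ω‖ ≤ C ^ 2 * ε := fun l hl =>
    hP.mul_Ω_le hd hM hl
  have hE : ∀ k, Nonempty (Extension u (G.xl k) (G.xr k)) := fun k =>
    IsC2UpToBoundary.nonempty_extension (G.xl_lt_xr k) (by
      rw [G.xl_index k, G.xr_index k]; exact hu.c2_resonator _ _)
  have hF : ∀ k, Nonempty (Extension u (G.xr k) (G.xl (k + 1))) := fun k =>
    IsC2UpToBoundary.nonempty_extension (G.xr_lt_xl k) (hu.c2_background k)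
  have E := fun k => (hE k).some
  have F := fun k => (hF k).some
  choose cκ hcκ hκ using hP.κ_inv
  choose cσ hcσ hσ using hP.s_inv
  choose cs hcs hcs' hs' using hP.s_wiener
  set i : ℤ → Fin N := fun k => (Chain.index (N := N) k).2 with hi
  set m : ℤ → ℤ := fun k => (Chain.index (N := N) k).1 with hm
  -- Summing the kernels over the N resonators gives one majorant valid for all indices of the
  -- chain.
  have hsum : ∀ f : Fin N → ℤ → ℂ,
      (∀ i, ∑ l ∈ Finset.Icc (-(M : ℤ)) M, ‖f i l‖ ≤ C) →
      ∑ l ∈ Finset.Icc (-(M : ℤ)) M, ∑ i, ‖f i l‖ ≤ C' := fun f hf => by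
    rw [Finset.sum_comm]
    refine (Finset.sum_le_card_nsmul _ _ C fun i _ => hf i).trans ?_
    simpa using hNC'
  have hle : ∀ (f : Fin N → ℤ → ℂ) (k l : ℤ), ‖f (i k) l‖ ≤ ∑ i, ‖f i l‖ := fun f k l =>
    Finset.single_le_sum (f := fun i => ‖f i l‖) (fun i _ => norm_nonneg _) (Finset.mem_univ _)
  have hΩ := hP.Ω_pos
  have hκr := hP.κr_pos
  have hb : ∀ p : ℤ × ℤ, ∫ x in G.xl p.2..G.xr p.2, ‖coef P.Ω ω p.1 fun t => (E p.2).U (x, t)‖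
      ≤ √h₁ * modeNorm G P.Ω ω u p.1 (m p.2) := by
    rintro ⟨n, k⟩
    have hc := continuous_coef (Ω := P.Ω) (ω := ω) (E k).continuous_U n
    refine (integral_le_sqrt_mul_sqrt (G.xl_lt_xr k) hc.norm).trans ?_
    refine mul_le_mul (Real.sqrt_le_sqrt (hg.len_le k)) (Real.sqrt_le_sqrt ?_)
      (Real.sqrt_nonneg _) hh1
    have e : ∫ x in G.xl k..G.xr k, ‖coef P.Ω ω n fun t => (E k).U (x, t)‖ ^ 2
        = ∫ x in G.left (m k) (i k)..G.right (m k) (i k), ‖mode P.Ω ω u n x‖ ^ 2 := by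
      rw [← G.xl_index k, ← G.xr_index k]
      exact intervalIntegral.integral_congr_Ioo_of_le (G.xl_lt_xr k).le fun x hx => by
        rw [(E k).mode_eq n hx]
    rw [e]
    exact Finset.single_le_sum
      (f := fun i => ∫ x in G.left (m k) i..G.right (m k) i, ‖mode P.Ω ω u n x‖ ^ 2)
      (fun j _ => intervalIntegral.integral_nonneg
        (by rw [G.left_eq, G.right_eq]; exact (G.xl_lt_xr _).le) fun x _ => sq_nonneg _)
      (Finset.mem_univ (i k))
  have hb0 : ∀ p : ℤ × ℤ,
      0 ≤ ∫ x in G.xl p.2..G.xr p.2, ‖coef P.Ω ω p.1 fun t => (E p.2).U (x, t)‖ := fun p =>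
    intervalIntegral.integral_nonneg (G.xl_lt_xr _).le fun x _ => norm_nonneg _
  have hS0 : 0 ≤ size G P.Ω ω u := hl.summable_modeNorm.nonneg
  have hweight : Summable fun p : ℤ × ℤ => (1 + ‖ω + p.1 * P.Ω‖ ^ 2)
      * ∫ x in G.xl p.2..G.xr p.2, ‖coef P.Ω ω p.1 fun t => (E p.2).U (x, t)‖ := by
    have h1 : SumLE (fun p : ℤ × ℤ => (1 + ‖ω + p.1 * P.Ω‖ ^ 2) * modeNorm G P.Ω ω u p.1 p.2)
        (∑' p : ℤ × ℤ, (1 + ‖ω + p.1 * P.Ω‖ ^ 2) * modeNorm G P.Ω ω u p.1 p.2) :=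
      ⟨fun p => mul_nonneg (by positivity) (modeNorm_nonneg _ _ _), hl, le_rfl⟩
    refine Summable.of_nonneg_of_le (fun p => mul_nonneg (by positivity) (hb0 p)) (fun p => ?_)
      (((h1.comp_index (N := N)).const_mul hh1).2.1)
    rw [mul_left_comm]
    exact mul_le_mul_of_nonneg_left (hb p) (by positivity)
  refine ⟨{
    d := d
    ε := ε
    S := size G P.Ω ω u
    w := fun n => ω + n * P.Ω
    M := M
    A := fun k n x => coef P.Ω ω n fun t => (E k).U (x, t)
    A1 := fun k n x => coef P.Ω ω n fun t => (E k).Ux (x, t)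
    A2 := fun k n x => coef P.Ω ω n fun t => (E k).Uxx (x, t)
    B := fun k n x => coef P.Ω ω n fun t => (F k).U (x, t)
    B1 := fun k n x => coef P.Ω ω n fun t => (F k).Ux (x, t)
    B2 := fun k n x => coef P.Ω ω n fun t => (F k).Uxx (x, t)
    δ := fun k => P.δ (m k) (i k)
    r := fun k => P.ρ (m k) (i k) / P.κr
    κ := fun k => cκ (i k)
    σ := fun k => cσ (i k)
    s := fun k => cs (i k)
    cκ := fun l => ∑ i, ‖cκ i l‖
    cσ := fun l => ∑ i, ‖cσ i l‖
    cs := fun l => ∑ i, ‖cs i l‖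
    d_pos := hd
    ε_pos := hεpos
    ε_le_one := Real.rpow_le_one hd.le hd1 (by linarith [hγ.2])
    d_le := ?_
    S_nonneg := hS0
    small := hsmall
    shift := ?_
    low := ?_
    r_nonneg := fun k => div_nonneg (hP.ρ_pos _ _).le hκr.le
    r_le := fun k => by
      rw [div_le_iff₀ hκr]
      exact (hP.ρ_le _ _).trans (mul_le_mul_of_nonneg_right hCC' hκr.le)
    δ_le := fun k => (hP.δ_le _ _).trans (mul_le_mul_of_nonneg_right hCC' hd.le)
    δ_ge := fun k => (hP.δ_ge _ _).trans
      (mul_le_mul_of_nonneg_right hCC' (hP.δ_pos hd _ _).le)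
    κ_le := hle cκ
    σ_le := hle cσ
    s_le := hle cs
    cκ_sum := hsum cκ hcκ
    cσ_sum := hsum cσ hcσ
    cs_sum := ?_
    hasDeriv_A := fun k n x =>
      hasDerivAt_coef (E k).continuous_U (E k).continuous_Ux (E k).hasDeriv_x n x
    hasDeriv_A1 := fun k n x =>
      hasDerivAt_coef (E k).continuous_Ux (E k).continuous_Uxx (E k).hasDeriv_xx n x
    continuous_A2 := fun k n => continuous_coef (E k).continuous_Uxx n
    hasDeriv_B := fun k n x =>
      hasDerivAt_coef (F k).continuous_U (F k).continuous_Ux (F k).hasDeriv_x n x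
    hasDeriv_B1 := fun k n x =>
      hasDerivAt_coef (F k).continuous_Ux (F k).continuous_Uxx (F k).hasDeriv_xx n x
    resonator := ?_
    background := fun k n x hx =>
      (F k).coef_Uxx_background hu.periodic hΩ hv (hu.background k) n hx
    trace_right := ?_
    trace_left := ?_
    flux_right := ?_
    flux_left := ?_
    flux_right_inv := ?_
    sum_le := ?_
    tail_le := ?_ }, rfl, ?_⟩
  -- The bound d ≤ ε² reads d ≤ d^(1-γ), which holds as d ≤ 1 and γ > 0.
  · rw [hε, rpow_half_sq hd]
    conv_lhs => rw [← Real.rpow_one d]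
    exact Real.rpow_le_rpow_of_exponent_ge hd hd1 (by linarith [hγ.1])
  · intro n l hl
    have h1 : |l| ≤ M := abs_le.2 (Finset.mem_Icc.1 hl)
    have h2 := hshift l h1
    have e : ω + n * (P.Ω : ℂ) = (ω + (n - l : ℤ) * P.Ω) + l * P.Ω := by push_cast; ring
    rw [e]
    refine (norm_add_le _ _).trans (add_le_add le_rfl (h2.trans ?_))
    exact mul_le_mul_of_nonneg_right (by linarith) hεpos.le
  · intro n hn
    refine (norm_add_le _ _).trans ((add_le_add hs.ω_le (hshift n (not_lt.1 hn))).trans ?_)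
    rw [← add_mul]
    exact mul_le_mul_of_nonneg_right hsq hεpos.le
  · refine ⟨fun l => Finset.sum_nonneg fun i _ => norm_nonneg _,
      summable_sum fun i _ => hcs i, ?_⟩
    rw [Summable.tsum_finsetSum fun i _ => hcs i]
    refine (Finset.sum_le_card_nsmul _ _ C fun i _ => hcs' i).trans ?_
    simpa using hNC'
  · intro k n x hx
    refine (E k).coef_Uxx_resonator hu.periodic hΩ (div_pos (hP.ρ_pos _ _) hκr) (hκ (i k))
      (fun y hy t => ?_) n hx
    rw [G.xl_index k, G.xr_index k] at hy
    have := hu.resonator _ _ y hy t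
    rwa [one_div_div]
  · intro k n
    have e : (fun t => (F k).U (G.xr k, t))
        = fun t => ((1 / P.s (i k) t : ℝ) : ℂ) * (E k).U (G.xr k, t) := by
      funext t
      have h := hu.trace_right (m k) (i k) t
      rwa [← G.xr_index k, (F k).rightLim_u t, (E k).leftLim_u t] at h
    rw [e]
    exact coef_mul_sum (hσ (i k)) ((E k).continuous_U.comp (Continuous.prodMk_right _)) n
  · intro k n
    have e : (fun t => (F k).U (G.xl (k + 1), t))
        = fun t => ((1 / P.s (i (k + 1)) t : ℝ) : ℂ) * (E (k + 1)).U (G.xl (k + 1), t) := by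
      funext t
      have h := hu.trace_left (m (k + 1)) (i (k + 1)) t
      rwa [← G.xl_index (k + 1), (F k).leftLim_u t, (E (k + 1)).rightLim_u t] at h
    rw [e]
    exact coef_mul_sum (hσ (i (k + 1)))
      ((E (k + 1)).continuous_U.comp (Continuous.prodMk_right _)) n
  · intro k n
    have e : (fun t => (P.δ (m k) (i k) : ℂ) * (F k).Ux (G.xr k, t))
        = fun t => ((1 / P.s (i k) t : ℝ) : ℂ) * (E k).Ux (G.xr k, t) := by
      funext t
      have h := hu.flux_right (m k) (i k) t
      rwa [← G.xr_index k, (F k).rightLim_deriv t, (E k).leftLim_deriv t] at h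
    rw [← coef_const_mul, e]
    exact coef_mul_sum (hσ (i k)) ((E k).continuous_Ux.comp (Continuous.prodMk_right _)) n
  · intro k n
    have e : (fun t => (P.δ (m (k + 1)) (i (k + 1)) : ℂ) * (F k).Ux (G.xl (k + 1), t))
        = fun t => ((1 / P.s (i (k + 1)) t : ℝ) : ℂ) * (E (k + 1)).Ux (G.xl (k + 1), t) := by
      funext t
      have h := hu.flux_left (m (k + 1)) (i (k + 1)) t
      rwa [← G.xl_index (k + 1), (F k).leftLim_deriv t, (E (k + 1)).rightLim_deriv t] at h
    rw [← coef_const_mul, e]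
    exact coef_mul_sum (hσ (i (k + 1)))
      ((E (k + 1)).continuous_Ux.comp (Continuous.prodMk_right _)) n
  · intro k n
    -- The flux condition solved for the interior derivative: multiplication by s, not by 1/s, which
    -- calls for the Fourier series of s itself.
    have e : (fun t => (E k).Ux (G.xr k, t)) = fun t =>
        (P.δ (m k) (i k) : ℂ) * ((P.s (i k) t : ℂ) * (F k).Ux (G.xr k, t)) := by
      funext t
      have h := hu.flux_right (m k) (i k) t
      rw [← G.xr_index k, (F k).rightLim_deriv t, (E k).leftLim_deriv t] at h
      have hs0 : (P.s (i k) t : ℂ) ≠ 0 := by exact_mod_cast (hP.s_pos (i k) t).ne'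
      rw [mul_left_comm, h]
      push_cast
      field_simp
    rw [e, coef_const_mul]
    congr 1
    exact coef_mul_tsum (hcs (i k)) (hs' (i k))
      ((F k).continuous_Ux.comp (Continuous.prodMk_right _)) n
  · refine ((hl.summable_modeNorm.comp_index (N := N)).const_mul hh1).mono hb0 hb ?_
    rw [← mul_assoc, mul_comm √h₁]
    exact mul_le_mul_of_nonneg_right hNh hS0
  · refine (((hs.sumLE_tail hd hd1 hl).comp_index (N := N)).const_mul hh1).mono
      (fun p => ?_) (fun p => ?_) (T := C' * ε * size G P.Ω ω u) ?_
    · split_ifs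
      exacts [mul_nonneg (by positivity) (hb0 p), le_rfl]
    · dsimp only
      split_ifs
      · rw [mul_left_comm]
        exact mul_le_mul_of_nonneg_left (hb p) (by positivity)
      · rw [mul_zero]
    · have := mul_le_mul_of_nonneg_right hNhC (mul_nonneg hεpos.le hS0)
      calc _ = N * √h₁ * C * (ε * size G P.Ω ω u) := by ring
        _ ≤ _ := this
        _ = _ := by ring
  · refine ⟨rfl, fun n => rfl, fun k => rfl, fun k => rfl, fun k l => ?_, fun k l => ?_,
      fun j t => ?_, fun j t => ?_, fun k n x hx => (E k).mode_eq n hx, ?_⟩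
    · simp only [hi, Chain.index_add_mul]
    · simp only [hi, Chain.index_add_mul]
    · simp only [hi, Chain.index_val]; exact hκ j t
    · simp only [hi, Chain.index_val]; exact hσ j t
    · exact hweight

end

end SpaceTimeResonators

end

/-! ### Waves as time series, and Bloch sums of summable families. -/

noncomputable section

namespace SpaceTimeResonators

open Set Filter Topology

/-- The wave `∑_n p_n exp(i (ω + n Ω) t)`. -/
def timeSeries (Ω : ℝ) (ω : ℂ) (p : ℤ → ℂ) (t : ℝ) : ℂ :=
  ∑' n : ℤ, p n * exp (I * (ω + n * Ω) * t)

/-- The coefficients `p` of a wave are summable with the weight `(1 + |ω + n Ω|) ^ j`. -/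
def WeightedSummable (Ω : ℝ) (ω : ℂ) (j : ℕ) (p : ℤ → ℂ) : Prop :=
  Summable fun n : ℤ => (1 + ‖ω + n * Ω‖) ^ j * ‖p n‖

section TimeSeries

variable {Ω : ℝ} {ω : ℂ} {p q : ℤ → ℂ} {j : ℕ}

lemma norm_exp_quasifrequency (n : ℤ) (t : ℝ) :
    ‖exp (I * (ω + n * Ω) * t)‖ = ‖exp (I * ω * t)‖ := by
  have : I * (ω + n * Ω) * t = I * ω * t + ((n * Ω * t : ℝ) : ℂ) * I := by push_cast; ring
  rw [this, Complex.exp_add, norm_mul, norm_exp_ofReal_mul_I, mul_one]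

lemma WeightedSummable.mono {i : ℕ} (h : WeightedSummable Ω ω j p) (hij : i ≤ j) :
    WeightedSummable Ω ω i p :=
  Summable.of_nonneg_of_le (fun n => by positivity) (fun n => mul_le_mul_of_nonneg_right
    (pow_le_pow_right₀ (by linarith [norm_nonneg (ω + n * Ω)]) hij) (norm_nonneg _)) h

lemma WeightedSummable.norm (h : WeightedSummable Ω ω j p) : Summable fun n => ‖p n‖ := by
  simpa [WeightedSummable] using h.mono (Nat.zero_le j)

lemma WeightedSummable.freq_mul (h : WeightedSummable Ω ω (j + 1) p) :
    WeightedSummable Ω ω j fun n => I * (ω + n * Ω) * p n := by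
  refine Summable.of_nonneg_of_le (fun n => by positivity) (fun n => ?_) h
  rw [norm_mul, norm_mul, norm_I, one_mul, pow_succ, mul_assoc]
  gcongr
  linarith

/-- The weight is submultiplicative along shifts, 1 + |ω_n| ≤ (1 + |lΩ|)(1 + |ω_{n-l}|), and the
kernel is finite. -/
lemma WeightedSummable.conv (h : WeightedSummable Ω ω j p) (c : ℤ → ℂ) (s : Finset ℤ) :
    WeightedSummable Ω ω j fun n => ∑ l ∈ s, c l * p (n - l) := by
  have h1 : ∀ l : ℤ, Summable fun n : ℤ => (1 + ‖ω + n * Ω‖) ^ j * (‖c l‖ * ‖p (n - l)‖) := by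
    intro l
    have h2 := (((Equiv.subRight l).summable_iff.2 h).mul_left
      ((1 + ‖(l : ℂ) * Ω‖) ^ j * ‖c l‖))
    refine Summable.of_nonneg_of_le (fun n => by positivity) (fun n => ?_) h2
    have e : 1 + ‖ω + n * Ω‖ ≤ (1 + ‖(l : ℂ) * Ω‖) * (1 + ‖ω + (n - l : ℤ) * Ω‖) := by
      have h3 : ω + n * Ω = l * Ω + (ω + (n - l : ℤ) * Ω) := by push_cast; ring
      have := norm_add_le ((l : ℂ) * Ω) (ω + (n - l : ℤ) * Ω)
      rw [← h3] at this
      nlinarith [mul_nonneg (norm_nonneg ((l : ℂ) * Ω)) (norm_nonneg (ω + (n - l : ℤ) * Ω))]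
    simp only [comp_apply, Equiv.subRight_apply]
    calc (1 + ‖ω + n * Ω‖) ^ j * (‖c l‖ * ‖p (n - l)‖)
        ≤ ((1 + ‖(l : ℂ) * Ω‖) * (1 + ‖ω + (n - l : ℤ) * Ω‖)) ^ j * (‖c l‖ * ‖p (n - l)‖) := by
          gcongr
      _ = _ := by rw [mul_pow]; ring
  refine Summable.of_nonneg_of_le (fun n => by positivity) (fun n => ?_)
    (summable_sum fun l (_ : l ∈ s) => h1 l)
  rw [← Finset.mul_sum]
  refine mul_le_mul_of_nonneg_left ((norm_sum_le _ _).trans ?_) (by positivity)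
  exact Finset.sum_le_sum fun l _ => (norm_mul _ _).le

lemma summable_timeSeries (h : Summable fun n => ‖p n‖) (t : ℝ) :
    Summable fun n : ℤ => p n * exp (I * (ω + n * Ω) * t) :=
  Summable.of_norm (by simpa only [norm_mul, norm_exp_quasifrequency] using h.mul_right _)

lemma timeSeries_sub (hp : Summable fun n => ‖p n‖) (hq : Summable fun n => ‖q n‖) (t : ℝ) :
    timeSeries Ω ω p t - timeSeries Ω ω q t = timeSeries Ω ω (fun n => p n - q n) t := by
  simp only [timeSeries, sub_mul]
  exact ((summable_timeSeries hp t).tsum_sub (summable_timeSeries hq t)).symm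

lemma mul_timeSeries (z : ℂ) (t : ℝ) :
    z * timeSeries Ω ω p t = timeSeries Ω ω (fun n => z * p n) t := by
  simp only [timeSeries, mul_assoc z, tsum_mul_left]

lemma sum_timeSeries {ι : Type*} {s : Finset ι} {p : ι → ℤ → ℂ}
    (h : ∀ i ∈ s, Summable fun n => ‖p i n‖) (t : ℝ) :
    ∑ i ∈ s, timeSeries Ω ω (p i) t = timeSeries Ω ω (fun n => ∑ i ∈ s, p i n) t := by
  simp only [timeSeries, Finset.sum_mul]
  exact (Summable.tsum_finsetSum fun i hi => summable_timeSeries (h i hi) t).symm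

lemma norm_timeSeries_le {S : ℝ} (h : SumLE (fun n => ‖p n‖) S) (t : ℝ) :
    ‖timeSeries Ω ω p t‖ ≤ S * ‖exp (I * ω * t)‖ := by
  have h1 := h.2.1.mul_right ‖exp (I * ω * t)‖
  refine (tsum_of_norm_bounded h1.hasSum fun n => ?_).trans ?_
  · rw [norm_mul, norm_exp_quasifrequency]
  · rw [tsum_mul_right]
    exact mul_le_mul_of_nonneg_right h.2.2 (norm_nonneg _)

lemma trigSum_mul_timeSeries {c : ℤ → ℂ} {s : Finset ℤ} {g : ℂ} {t : ℝ}
    (hg : g = ∑ l ∈ s, c l * exp (I * l * Ω * t)) (hp : Summable fun n => ‖p n‖) :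
    g * timeSeries Ω ω p t = timeSeries Ω ω (fun n => ∑ l ∈ s, c l * p (n - l)) t := by
  have h1 : ∀ l : ℤ, (c l * exp (I * l * Ω * t)) * timeSeries Ω ω p t
      = timeSeries Ω ω (fun n => c l * p (n - l)) t := by
    intro l
    unfold timeSeries
    rw [← tsum_mul_left, ← (Equiv.subRight l).tsum_eq]
    refine tsum_congr fun n => ?_
    have : exp (I * (ω + n * Ω) * t)
        = exp (I * l * Ω * t) * exp (I * (ω + (n - l : ℤ) * Ω) * t) := by
      rw [← Complex.exp_add]; congr 1; push_cast; ring
    rw [this, Equiv.subRight_apply]; ring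
  rw [hg, Finset.sum_mul, Finset.sum_congr rfl fun l _ => h1 l, sum_timeSeries]
  intro l _
  simpa only [norm_mul, comp_def, Equiv.subRight_apply] using
    ((Equiv.subRight l).summable_iff (f := fun n => ‖p n‖).2 hp).mul_left ‖c l‖

lemma hasDerivAt_timeSeries (h : WeightedSummable Ω ω 1 p) (t : ℝ) :
    HasDerivAt (timeSeries Ω ω p) (timeSeries Ω ω (fun n => I * (ω + n * Ω) * p n) t) t := by
  have hp := h.norm
  have hq := (h.freq_mul (j := 0)).norm
  have hn : ∀ (n : ℤ) (y : ℝ), ‖exp (I * n * Ω * y)‖ = 1 := fun n y => by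
    rw [show I * n * Ω * y = ((n * Ω * y : ℝ) : ℂ) * I by push_cast; ring, norm_exp_ofReal_mul_I]
  -- Since ω is complex, exp(iωt) may be unbounded on ℝ. Once it is split off, the remaining
  -- exponentials are unimodular and the differentiated series is dominated uniformly in t.
  have hsplit : ∀ (r : ℤ → ℂ) (y : ℝ), timeSeries Ω ω r y
      = exp (I * ω * y) * ∑' n : ℤ, r n * exp (I * n * Ω * y) := by
    intro r y
    rw [timeSeries, ← tsum_mul_left]
    refine tsum_congr fun n => ?_
    rw [mul_left_comm, ← Complex.exp_add]
    congr 2; ring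
  have hs : ∀ (r : ℤ → ℂ) (y : ℝ), (Summable fun n => ‖r n‖) →
      Summable fun n : ℤ => r n * exp (I * n * Ω * y) := fun r y hr =>
    Summable.of_norm (by simpa [norm_mul, hn] using hr)
  have hΩp : Summable fun n : ℤ => ‖I * n * Ω * p n‖ := by
    refine Summable.of_nonneg_of_le (fun n => norm_nonneg _) (fun n => ?_)
      (hq.add (hp.mul_left ‖ω‖))
    have : I * n * Ω * p n = I * (ω + n * Ω) * p n - I * ω * p n := by ring
    rw [this]
    refine (norm_sub_le _ _).trans (le_of_eq ?_)
    simp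
  have hd := hasDerivAt_tsum (𝕜 := ℝ) (u := fun n => ‖I * n * Ω * p n‖)
    (g := fun (n : ℤ) (y : ℝ) => p n * exp (I * n * Ω * y))
    (g' := fun (n : ℤ) (y : ℝ) => (I * n * Ω * p n) * exp (I * n * Ω * y)) (y₀ := t) hΩp
    (fun n y => by
      have := (((ofRealCLM.hasDerivAt (x := y)).const_mul (I * n * Ω)).cexp).const_mul (p n)
      simp only [ofRealCLM_apply, ofReal_one, mul_one] at this
      exact this.congr_deriv (by ring))
    (fun n y => by rw [norm_mul, hn, mul_one]) (hs p t hp) t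
  have he : HasDerivAt (fun y : ℝ => exp (I * ω * y)) (exp (I * ω * t) * (I * ω)) t := by
    simpa using ((ofRealCLM.hasDerivAt (x := t)).const_mul (I * ω)).cexp
  rw [show timeSeries Ω ω p = fun y => _ from funext (hsplit p)]
  refine (he.fun_mul hd).congr_deriv ?_
  rw [hsplit, mul_assoc (exp _), ← mul_add, ← tsum_mul_left,
    ← (((hs p t hp).mul_left (I * ω)).tsum_add (hs _ t hΩp))]
  congr 1
  exact tsum_congr fun n => by ring

end TimeSeries

namespace Chain

variable {N : ℕ} (G : Chain N) (α : ℝ)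

lemma norm_exp_bloch (m : ℤ) : ‖exp (-(I * α * m * G.L))‖ = 1 := by
  rw [show -(I * α * m * G.L) = ((-(α * m * G.L) : ℝ) : ℂ) * I by push_cast; ring,
    norm_exp_ofReal_mul_I]

lemma summable_bloch {f : ℤ → ℂ} (hf : Summable fun k => ‖f k‖) (k : ℤ) :
    Summable fun m : ℤ => f (k + m * N) * exp (-(I * α * m * G.L)) := by
  refine Summable.of_norm ?_
  simp only [norm_mul, norm_exp_bloch, mul_one]
  refine hf.comp_injective (i := fun m : ℤ => k + m * N) fun a b h => ?_
  simpa [G.ne_zero] using h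

variable {G α}

lemma blochSum_congr {f g : ℤ → ℂ} {k : ℤ} (h : ∀ m : ℤ, f (k + m * N) = g (k + m * N)) :
    G.blochSum α f k = G.blochSum α g k :=
  tsum_congr fun m => by rw [h]

lemma blochSum_const_mul (z : ℂ) (f : ℤ → ℂ) (k : ℤ) :
    G.blochSum α (fun k => z * f k) k = z * G.blochSum α f k := by
  simp only [blochSum, mul_assoc z, tsum_mul_left]

lemma blochSum_sub {f g : ℤ → ℂ} (hf : Summable fun k => ‖f k‖) (hg : Summable fun k => ‖g k‖)
    (k : ℤ) : G.blochSum α (fun k => f k - g k) k = G.blochSum α f k - G.blochSum α g k := by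
  simp only [blochSum, sub_mul]
  exact (G.summable_bloch α hf k).tsum_sub (G.summable_bloch α hg k)

lemma blochSum_conv {f : ℤ → ℤ → ℂ} (hf : ∀ n, Summable fun k => ‖f n k‖) (s : Finset ℤ)
    (c : ℤ → ℂ) (n k : ℤ) : G.blochSum α (fun k => ∑ l ∈ s, c l * f (n - l) k) k
      = ∑ l ∈ s, c l * G.blochSum α (f (n - l)) k := by
  simp only [← blochSum_const_mul]
  simp only [blochSum, Finset.sum_mul]
  refine Summable.tsum_finsetSum fun l _ => ?_
  simpa only [mul_assoc (c l)] using (G.summable_bloch α (hf (n - l)) k).mul_left (c l)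

lemma injective_cell (G : Chain N) (k : ℤ) :
    Injective fun p : ℤ × ℤ => (p.1, k + p.2 * N) := by
  intro p q h
  have : (N : ℤ) ≠ 0 := by exact_mod_cast G.ne_zero
  simp only [Prod.mk.injEq, add_right_inj, mul_eq_mul_right_iff, this, or_false] at h
  exact Prod.ext h.1 h.2

/-- The phases are unimodular, so the triangle inequality bounds a Bloch sum by the sum over one
residue class of resonators. The weight ψ ≥ 1 retains the control of time derivatives. -/
lemma sumLE_blochSum {f : ℤ → ℤ → ℂ} {ψ : ℤ → ℝ} {S : ℝ} (hψ : ∀ n, 1 ≤ ψ n)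
    (h : SumLE (fun p : ℤ × ℤ => ψ p.1 * ‖f p.1 p.2‖) S) (k : ℤ) :
    SumLE (fun n => ψ n * ‖G.blochSum α (f n) k‖) S := by
  have h1 := h.comp_injective (G.injective_cell k)
  have hle : ∀ n, ψ n * ‖G.blochSum α (f n) k‖ ≤ ∑' m : ℤ, ψ n * ‖f n (k + m * N)‖ := by
    intro n
    have hψ0 : 0 < ψ n := zero_lt_one.trans_le (hψ n)
    have hs : Summable fun m : ℤ => ‖f n (k + m * N)‖ :=
      (summable_mul_left_iff hψ0.ne').1 (h1.2.1.prod_factor n)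
    rw [tsum_mul_left]
    refine mul_le_mul_of_nonneg_left (tsum_of_norm_bounded hs.hasSum fun m => ?_) hψ0.le
    rw [norm_mul, norm_exp_bloch, mul_one]
  have h2 : SumLE (fun n => ∑' m : ℤ, ψ n * ‖f n (k + m * N)‖) S :=
    ⟨fun n => tsum_nonneg fun m => h1.1 (n, m), h1.2.1.prod, by
      rw [← h1.2.1.tsum_prod]; exact h1.2.2⟩
  exact h2.mono (fun n => mul_nonneg (zero_le_one.trans (hψ n)) (norm_nonneg _)) hle le_rfl

end Chain

end SpaceTimeResonators

end

/-! ### Jumps of the flux and their Bloch sums. -/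

noncomputable section

namespace SpaceTimeResonators

open Set Filter Topology

namespace ModeSystem

variable {xl xr : ℤ → ℝ} {v₀ c C h₀ h₁ : ℝ} (X : ModeSystem xl xr v₀ c C)

lemma continuous_A (k n : ℤ) : Continuous (X.A k n) :=
  continuous_iff_continuousAt.2 fun x => (X.hasDeriv_A k n x).continuousAt

lemma norm_mean_le (hg : LengthBounds xl xr h₀ h₁) (k n : ℤ) :
    ‖X.mean k n‖ ≤ 1 / h₀ * X.b (n, k) := by
  have h0 := hg.pos
  have hlen := hg.le_len k
  have hle : xl k ≤ xr k := by linarith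
  rw [mean, norm_mul, norm_real, Real.norm_of_nonneg (by
    exact one_div_nonneg.2 (by linarith))]
  exact mul_le_mul (one_div_le_one_div_of_le h0 hlen)
    (intervalIntegral.norm_integral_le_integral_norm hle) (norm_nonneg _) (by positivity)

lemma integral_A (hg : LengthBounds xl xr h₀ h₁) (k n : ℤ) :
    ∫ x in xl k..xr k, X.A k n x = ((xr k - xl k : ℝ) : ℂ) * X.mean k n := by
  have hne : ((xr k - xl k : ℝ) : ℂ) ≠ 0 := by
    exact_mod_cast (lt_of_lt_of_le hg.pos (hg.le_len k)).ne'
  rw [mean, ← mul_assoc, one_div, ofReal_inv, mul_inv_cancel₀ hne, one_mul]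

/-- The flux through the boundary of a resonator, by the divergence theorem. -/
lemma A1_sub (hg : LengthBounds xl xr h₀ h₁) (k n : ℤ) : X.A1 k n (xl k) - X.A1 k n (xr k)
    = X.r k * (X.w n * ∑ l ∈ X.band, X.κ k l
      * (X.w (n - l) * (((xr k - xl k : ℝ) : ℂ) * X.mean k (n - l)))) := by
  have hle : xl k ≤ xr k := by linarith [hg.le_len k, hg.pos]
  have h1 := intervalIntegral.integral_eq_sub_of_hasDerivAt (fun x _ => X.hasDeriv_A1 k n x)
    ((X.continuous_A2 k n).intervalIntegrable (xl k) (xr k))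
  rw [← neg_sub, ← h1, intervalIntegral.integral_congr (g := fun x => -(X.r k * (X.w n *
    ∑ l ∈ X.band, X.κ k l * (X.w (n - l) * X.A k (n - l) x)))) fun x hx =>
      X.resonator k n x (by rwa [uIcc_of_le hle] at hx),
    intervalIntegral.integral_neg, neg_neg, intervalIntegral.integral_const_mul,
    intervalIntegral.integral_const_mul, intervalIntegral.integral_finsetSum fun l _ =>
      (((X.continuous_A k (n - l)).const_mul (X.w (n - l))).const_mul
        (X.κ k l)).intervalIntegrable _ _]
  simp only [intervalIntegral.integral_const_mul, X.integral_A hg]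

/-- The jump of the exterior flux across a resonator. -/
def fluxJump (k n : ℤ) : ℂ := X.B1 (k - 1) n (xl k) - X.B1 k n (xr k)

def outerJump (k n : ℤ) : ℂ := X.outerSlope (k - 1) n - X.outerSlope k n

/-- The Fourier modes of `-(ℓ / κ_r) ∂_t ((1 / κ) ∂_t v) (ρ / δ)`, up to the factor `κ_r`. -/
def momentum (k n : ℤ) : ℂ := -((xr k - xl k : ℝ) : ℂ) * (I * X.w n * ∑ l ∈ X.band, X.κ k l
  * (I * X.w (n - l) * (X.mean k (n - l) * ((X.r k / X.δ k : ℝ) : ℂ))))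

/-- An exact identity: the transmission condition brings in the interior flux, the divergence
theorem its mean values. All the approximation thus lies on the capacitance side of the equation. -/
lemma fluxJump_eq (hg : LengthBounds xl xr h₀ h₁) (hδ : ∀ k, X.δ k ≠ 0) (k n : ℤ) :
    X.fluxJump k n = ∑ l ∈ X.band, X.σ k l * X.momentum k (n - l) := by
  have hδ' : (X.δ k : ℂ) ≠ 0 := by exact_mod_cast hδ k
  have h1 := X.flux_left (k - 1) n
  simp only [sub_add_cancel] at h1
  refine mul_left_cancel₀ hδ' ?_
  rw [fluxJump, mul_sub, h1, X.flux_right k n, ← Finset.sum_sub_distrib, Finset.mul_sum]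
  refine Finset.sum_congr rfl fun l _ => ?_
  rw [← mul_sub, X.A1_sub hg, momentum]
  simp only [Finset.mul_sum]
  refine Finset.sum_congr rfl fun l' _ => ?_
  have e : (X.r k : ℂ) = X.δ k * ((X.r k / X.δ k : ℝ) : ℂ) := by
    push_cast; rw [mul_div_cancel₀ _ hδ']
  rw [e]
  -- The two factors I in `momentum`, one for each time derivative, produce the sign.
  linear_combination X.δ k * X.σ k l * ((X.r k / X.δ k : ℝ) : ℂ) * X.w (n - l) * X.κ k l'
    * X.w (n - l - l') * ((xr k - xl k : ℝ) : ℂ) * X.mean k (n - l - l') * I_sq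

lemma summable_outer (hg : LengthBounds xl xr h₀ h₁) :
    Summable fun p : ℤ × ℤ => ‖X.outer p.2 p.1‖ := by
  have h0 := hg.pos
  have hm : SumLE (fun p : ℤ × ℤ => ‖X.mean p.2 p.1‖) (1 / h₀ * (C * X.S)) :=
    (SumLE.const_mul X.sum_le (one_div_nonneg.2 h0.le)).mono (fun p => norm_nonneg _)
      (fun p => X.norm_mean_le hg p.2 p.1) le_rfl
  refine Summable.of_nonneg_of_le (fun p => norm_nonneg _) (fun p => ?_)
    (hm.finset_conv X.cσ_nonneg X.cσ_sum).2.1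
  refine (norm_sum_le _ _).trans (Finset.sum_le_sum fun l _ => ?_)
  rw [norm_mul]
  exact mul_le_mul_of_nonneg_right (X.σ_le _ _) (norm_nonneg _)

lemma summable_outerSlope (hg : LengthBounds xl xr h₀ h₁) :
    Summable fun p : ℤ × ℤ => ‖X.outerSlope p.2 p.1‖ := by
  have h0 := hg.pos
  have h1 := X.summable_outer hg
  have hinj : Injective fun p : ℤ × ℤ => (p.1, p.2 + 1) := by
    intro p q h
    simp only [Prod.mk.injEq, add_left_inj] at h
    exact Prod.ext h.1 h.2
  refine Summable.of_nonneg_of_le (fun p => norm_nonneg _) (fun p => ?_)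
    (((h1.comp_injective hinj).add h1).mul_left (1 / h₀))
  have hgap := hg.le_gap p.2
  rw [outerSlope, norm_div, norm_real, Real.norm_of_nonneg (by linarith), div_eq_inv_mul,
    ← one_div]
  exact mul_le_mul (one_div_le_one_div_of_le h0 hgap) (norm_sub_le _ _) (norm_nonneg _)
    (by positivity)

lemma summable_outerJump (hg : LengthBounds xl xr h₀ h₁) :
    Summable fun p : ℤ × ℤ => ‖X.outerJump p.2 p.1‖ := by
  have h1 := X.summable_outerSlope hg
  have hinj : Injective fun p : ℤ × ℤ => (p.1, p.2 - 1) := by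
    intro p q h
    simp only [Prod.mk.injEq, sub_left_inj] at h
    exact Prod.ext h.1 h.2
  exact Summable.of_nonneg_of_le (fun p => norm_nonneg _) (fun p => norm_sub_le _ _)
    ((h1.comp_injective hinj).add h1)

/-- The coefficients of the left-hand side of the capacitance equation. -/
lemma sum_capacitance_blochSum {N : ℕ} [NeZero N] {G : Chain N}
    (X : ModeSystem G.xl G.xr v₀ c C) (hg : LengthBounds G.xl G.xr h₀ h₁) (α : ℝ) (i : Fin N) (n : ℤ) :
    ∑ j, G.capacitance α i j * G.blochSum α (fun k => X.outer k n) j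
      = G.blochSum α (fun k => X.outerJump k n) i := by
  have ho : Summable fun k => ‖X.outer k n‖ := (X.summable_outer hg).prod_factor n
  have ho' : ∀ j : ℤ, Summable fun k => ‖X.outer (k + j) n‖ := fun j =>
    (Equiv.addRight j).summable_iff (f := fun k => ‖X.outer k n‖) |>.2 ho
  rw [G.sum_capacitance_mul]
  have hshift : ∀ j k : ℤ, G.blochSum α (fun k => X.outer k n) (k + j)
      = G.blochSum α (fun k => X.outer (k + j) n) k := fun j k =>
    tsum_congr fun m => by rw [add_right_comm]
  have h1 : ∀ k : ℤ, G.blochSum α (fun k => X.outerSlope k n) k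
      = (G.blochSum α (fun k => X.outer k n) (k + 1) - G.blochSum α (fun k => X.outer k n) k)
        / ((G.xl (k + 1) - G.xr k : ℝ) : ℂ) := by
    intro k
    rw [hshift, ← Chain.blochSum_sub (ho' 1) ho, div_eq_inv_mul, ← Chain.blochSum_const_mul]
    refine Chain.blochSum_congr fun m => ?_
    rw [outerSlope, add_right_comm, G.xl_add_mul, G.xr_add_mul, add_sub_add_right_eq_sub,
      div_eq_inv_mul]
  have hsl : Summable fun k => ‖X.outerSlope k n‖ := (X.summable_outerSlope hg).prod_factor n
  have hsl' : Summable fun k => ‖X.outerSlope (k - 1) n‖ :=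
    (Equiv.subRight 1).summable_iff (f := fun k => ‖X.outerSlope k n‖) |>.2 hsl
  have h2 : G.blochSum α (fun k => X.outerSlope (k - 1) n) i
      = G.blochSum α (fun k => X.outerSlope k n) ((i : ℤ) - 1) :=
    tsum_congr fun m => by rw [sub_add_eq_add_sub]
  simp only [outerJump]
  rw [Chain.blochSum_sub hsl' hsl, h2, h1, h1, sub_add_cancel]

end ModeSystem

namespace ModeSystem.Represents

variable {N : ℕ} [NeZero N] {G : Chain N} {v₀ c C h₀ h₁ : ℝ} {X : ModeSystem G.xl G.xr v₀ c C}
  {P : Material N} {ω : ℂ} {u : ℝ → ℝ → ℂ} (hX : X.Represents P ω u)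
  (hg : LengthBounds G.xl G.xr h₀ h₁)

include hX

lemma cellMode_eq (m : ℤ) (i : Fin N) (n : ℤ) :
    cellMode G P.Ω ω u m i n = X.mean (i + m * N) n := by
  rw [cellMode, mean, G.left_eq, G.right_eq, G.xr_add_mul, G.xl_add_mul, add_sub_add_right_eq_sub,
    ← G.xr_add_mul, ← G.xl_add_mul]
  congr 1
  exact intervalIntegral.integral_congr_Ioo_of_le (G.xl_lt_xr _).le fun x hx =>
    hX.mode_eq _ n x hx

lemma ratio_eq (hκr : 0 < P.κr) (m : ℤ) (i : Fin N) :
    P.ρ m i / P.δ m i = P.κr * (X.r (i + m * N) / X.δ (i + m * N)) := by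
  rw [hX.r_eq, hX.δ_eq, Chain.index_add_mul, Chain.index_val]
  simp only [zero_add]
  field_simp

include hg

/-- The square of the weight, for two time derivatives, is at most 2 (1 + |ω_n|²), which
localisation makes summable. Any bounded factor per resonator is harmless, in particular ρ/δ. -/
lemma summable_mean {a : ℤ → ℂ} {R : ℝ} (ha : ∀ k, ‖a k‖ ≤ R) : Summable fun p : ℤ × ℤ =>
    (1 + ‖ω + p.1 * P.Ω‖) ^ 2 * ‖X.mean p.2 p.1 * a p.2‖ := by
  have h0 := hg.pos
  have hR : 0 ≤ R := (norm_nonneg _).trans (ha 0)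
  refine Summable.of_nonneg_of_le (fun p => by positivity) (fun p => ?_)
    (hX.summable.mul_left (2 * (1 / h₀) * R))
  have hb := X.b_nonneg p
  rw [hX.w_eq, norm_mul]
  calc (1 + ‖ω + p.1 * P.Ω‖) ^ 2 * (‖X.mean p.2 p.1‖ * ‖a p.2‖)
      ≤ (2 * (1 + ‖ω + p.1 * P.Ω‖ ^ 2)) * (1 / h₀ * X.b p * R) := by
        gcongr
        · nlinarith [sq_nonneg (1 - ‖ω + p.1 * P.Ω‖)]
        · exact X.norm_mean_le hg p.2 p.1
        · exact ha _
    _ = _ := by ring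

lemma summable_mean_cell {a : ℤ → ℂ} {R : ℝ} (ha : ∀ k, ‖a k‖ ≤ R) (n : ℤ) :
    Summable fun k => ‖X.mean k n * a k‖ :=
  (summable_mul_left_iff (by positivity : (1 + ‖ω + n * P.Ω‖) ^ 2 ≠ 0)).1
    ((hX.summable_mean hg ha).prod_factor n)

lemma weightedSummable {a : ℤ → ℂ} {R : ℝ} (ha : ∀ k, ‖a k‖ ≤ R) (α : ℝ) (k : ℤ) :
    WeightedSummable P.Ω ω 2 fun n => G.blochSum α (fun k => X.mean k n * a k) k :=
  (Chain.sumLE_blochSum (f := fun n k => X.mean k n * a k)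
    (ψ := fun n => (1 + ‖ω + n * P.Ω‖) ^ 2)
    (fun n => one_le_pow₀ (by linarith [norm_nonneg (ω + n * P.Ω)]))
    ⟨fun p => by positivity, hX.summable_mean hg ha, le_rfl⟩ k).2.1

omit hg in
lemma blochWave_eq {a : ℤ → ℂ} (α : ℝ) (i : Fin N) {b : ℤ → ℝ}
    (hab : ∀ m : ℤ, (b m : ℂ) = a (i + m * N)) : blochWave G P.Ω ω u α i b
      = timeSeries P.Ω ω fun n => G.blochSum α (fun k => X.mean k n * a k) i := by
  funext t
  refine tsum_congr fun n => ?_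
  congr 1
  refine tsum_congr fun m => ?_
  rw [blochTerm, hX.cellMode_eq, hab]
  ring

lemma summable_blochTerm {a : ℤ → ℂ} {R : ℝ} (ha : ∀ k, ‖a k‖ ≤ R) (α : ℝ) (i : Fin N)
    {b : ℤ → ℝ} (hab : ∀ m : ℤ, (b m : ℂ) = a (i + m * N)) (t : ℝ) :
    Summable fun p : ℤ × ℤ => blochTerm G P.Ω ω u α i b p.1 p.2
      * exp (I * (ω + p.1 * P.Ω) * t) := by
  refine Summable.of_norm (Summable.of_nonneg_of_le (fun p => norm_nonneg _) (fun p => ?_)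
    (((hX.summable_mean hg ha).comp_injective (G.injective_cell i)).mul_right
      ‖exp (I * ω * t)‖))
  rw [norm_mul, norm_exp_quasifrequency]
  refine mul_le_mul_of_nonneg_right ?_ (norm_nonneg _)
  rw [blochTerm, hX.cellMode_eq, hab, mul_right_comm, norm_mul, Chain.norm_exp_bloch, mul_one]
  exact le_mul_of_one_le_left (norm_nonneg _)
    (one_le_pow₀ (by linarith [norm_nonneg (ω + p.1 * P.Ω)]))

/-- The coefficients of the right-hand side of the capacitance equation. -/
lemma blochSum_fluxJump {a : ℤ → ℂ} {R : ℝ} (ha : ∀ k, ‖a k‖ ≤ R)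
    (har : ∀ k, a k = P.κr * ((X.r k / X.δ k : ℝ) : ℂ)) (hκr : 0 < P.κr) (hδ : ∀ k, X.δ k ≠ 0)
    (α : ℝ) (i : Fin N) (n : ℤ) : G.blochSum α (fun k => X.fluxJump k n) i
      = ∑ l ∈ X.band, X.σ i l * (-((G.len i / P.κr : ℝ) : ℂ) * (I * (ω + (n - l : ℤ) * P.Ω)
        * ∑ l' ∈ X.band, X.κ i l' * (I * (ω + (n - l - l' : ℤ) * P.Ω)
          * G.blochSum α (fun k => X.mean k (n - l - l') * a k) i))) := by
  have hκr' : (P.κr : ℂ) ≠ 0 := by exact_mod_cast hκr.ne'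
  have hs : ∀ n, Summable fun k => ‖I * (ω + n * P.Ω) * (X.mean k n * a k)‖ := fun n => by
    simpa only [norm_mul] using (hX.summable_mean_cell hg ha n).mul_left ‖I * (ω + n * P.Ω)‖
  set Q : ℤ → ℤ → ℂ := fun n k => -((G.len i / P.κr : ℝ) : ℂ) * (I * (ω + n * P.Ω)
    * ∑ l ∈ X.band, X.κ i l * (I * (ω + (n - l : ℤ) * P.Ω) * (X.mean k (n - l) * a k))) with hQ
  have hQs : ∀ n, Summable fun k => ‖Q n k‖ := fun n => by
    refine Summable.norm (Summable.mul_left _ (Summable.mul_left _ (summable_sum fun l _ =>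
      Summable.mul_left _ ?_)))
    exact Summable.of_norm (hs (n - l))
  have h1 : G.blochSum α (fun k => X.fluxJump k n) i
      = G.blochSum α (fun k => ∑ l ∈ X.band, X.σ i l * Q (n - l) k) i := by
    refine Chain.blochSum_congr fun m => ?_
    rw [X.fluxJump_eq hg hδ, hX.σ_add]
    refine Finset.sum_congr rfl fun l _ => ?_
    congr 1
    have hlen : G.xr (i + m * N) - G.xl (i + m * N) = G.len i := by
      rw [G.xr_add_mul, G.xl_add_mul, add_sub_add_right_eq_sub, Chain.len]
    rw [hQ, momentum, hX.κ_add, hlen]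
    simp only [har, hX.w_eq, Finset.mul_sum]
    refine Finset.sum_congr rfl fun l' _ => ?_
    push_cast
    field_simp
  rw [h1, Chain.blochSum_conv hQs]
  refine Finset.sum_congr rfl fun l _ => ?_
  rw [hQ, Chain.blochSum_const_mul, Chain.blochSum_const_mul,
    Chain.blochSum_conv (f := fun n k => I * (ω + n * P.Ω) * (X.mean k n * a k)) hs]
  simp only [Chain.blochSum_const_mul]

end ModeSystem.Represents

end SpaceTimeResonators

end

/-! ### The capacitance equation of a represented wave field. -/

noncomputable section

namespace SpaceTimeResonators

open Set

variable {N : ℕ} [NeZero N] {G : Chain N} {v₀ c C h₀ h₁ : ℝ} {X : ModeSystem G.xl G.xr v₀ c C}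
  {P : Material N} {ω : ℂ} {u : ℝ → ℝ → ℂ}

/-- The capacitance equation of a mode system, with an error controlled by the deviation of the
jumps of the exterior flux from the jumps of the slopes of the mean values. -/
theorem ModeSystem.Represents.capacitance_equation (hX : X.Represents P ω u)
    (hg : LengthBounds G.xl G.xr h₀ h₁) {R T : ℝ} (hκr : 0 < P.κr)
    (hδ : ∀ k, X.δ k ≠ 0)
    (hR : ∀ k, ‖(P.κr : ℂ) * ((X.r k / X.δ k : ℝ) : ℂ)‖ ≤ R)
    (hT : SumLE (fun p : ℤ × ℤ => ‖X.fluxJump p.2 p.1 - X.outerJump p.2 p.1‖) T)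
    (α : ℝ) (i : Fin N) :
    (∀ t : ℝ, Summable fun p : ℤ × ℤ => blochTerm G P.Ω ω u α i (fun _ => 1) p.1 p.2
      * exp (I * (ω + p.1 * P.Ω) * t)) ∧
    (∀ t : ℝ, Summable fun p : ℤ × ℤ =>
      blochTerm G P.Ω ω u α i (fun m => P.ρ m i / P.δ m i) p.1 p.2
      * exp (I * (ω + p.1 * P.Ω) * t)) ∧
    Differentiable ℝ (blochWave G P.Ω ω u α i fun m => P.ρ m i / P.δ m i) ∧
    Differentiable ℝ (fun t => ((1 / P.κ i t : ℝ) : ℂ)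
      * deriv (blochWave G P.Ω ω u α i fun m => P.ρ m i / P.δ m i) t) ∧
    ∀ t : ℝ,
      ‖∑ j, G.capacitance α i j
          * (((1 / P.s j t : ℝ) : ℂ) * blochWave G P.Ω ω u α j (fun _ => 1) t)
        - -(((G.len i / (P.s i t * P.κr) : ℝ) : ℂ)
          * deriv (fun τ => ((1 / P.κ i τ : ℝ) : ℂ)
            * deriv (blochWave G P.Ω ω u α i fun m => P.ρ m i / P.δ m i) τ) t)‖
        ≤ T * ‖exp (I * ω * t)‖ := by
  set a : ℤ → ℂ := fun k => (P.κr : ℂ) * ((X.r k / X.δ k : ℝ) : ℂ) with ha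
  have hab : ∀ m : ℤ, ((P.ρ m i / P.δ m i : ℝ) : ℂ) = a (i + m * N) := fun m => by
    rw [hX.ratio_eq hκr, ha]; push_cast; ring
  have h1 : ∀ k : ℤ, ‖(fun _ : ℤ => (1 : ℂ)) k‖ ≤ 1 := fun k => by simp
  have h1b : ∀ (j : Fin N) (m : ℤ), (((fun _ => 1 : ℤ → ℝ) m : ℝ) : ℂ)
      = (fun _ : ℤ => (1 : ℂ)) (j + m * N) := fun j m => by simp
  set y : ℤ → ℂ := fun n => G.blochSum α (fun k => X.mean k n * a k) i with hy
  have hy2 : WeightedSummable P.Ω ω 2 y := hX.weightedSummable hg hR α i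
  have hY : (blochWave G P.Ω ω u α i fun m => P.ρ m i / P.δ m i) = timeSeries P.Ω ω y :=
    hX.blochWave_eq α i hab
  have hdY : deriv (timeSeries P.Ω ω y)
      = timeSeries P.Ω ω fun n => I * (ω + n * P.Ω) * y n :=
    funext fun t => (hasDerivAt_timeSeries (hy2.mono one_le_two) t).deriv
  have hy1 : WeightedSummable P.Ω ω 1 fun n => I * (ω + n * P.Ω) * y n := hy2.freq_mul
  have hκY : (fun t : ℝ => ((1 / P.κ i t : ℝ) : ℂ) * deriv (timeSeries P.Ω ω y) t)
      = timeSeries P.Ω ω fun n => ∑ l ∈ X.band, X.κ i l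
        * (I * (ω + (n - l : ℤ) * P.Ω) * y (n - l)) := by
    funext t
    rw [hdY, trigSum_mul_timeSeries (hX.κ_eq i t) hy1.norm]
  have hκ1 := hy1.conv (X.κ i) X.band
  refine ⟨hX.summable_blochTerm hg h1 α i (h1b i), hX.summable_blochTerm hg hR α i hab,
    ?_, ?_, fun t => ?_⟩
  · rw [hY]
    exact fun t => (hasDerivAt_timeSeries (hy2.mono one_le_two) t).differentiableAt
  · rw [hY, hκY]
    exact fun t => (hasDerivAt_timeSeries hκ1 t).differentiableAt
  have hO : SumLE (fun p : ℤ × ℤ => 1 * ‖X.outerJump p.2 p.1‖) _ :=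
    ⟨fun p => by positivity, by simpa using X.summable_outerJump hg, le_rfl⟩
  -- The flux jumps inherit summability from the slope jumps and from the error bound.
  have hF : SumLE (fun p : ℤ × ℤ => 1 * ‖X.fluxJump p.2 p.1‖) _ :=
    (hT.add hO).mono (fun p => by positivity) (fun p => by
      rw [one_mul, one_mul]
      have := norm_add_le (X.fluxJump p.2 p.1 - X.outerJump p.2 p.1) (X.outerJump p.2 p.1)
      rwa [sub_add_cancel] at this) le_rfl
  have hD : SumLE (fun p : ℤ × ℤ => 1 * ‖X.outerJump p.2 p.1 - X.fluxJump p.2 p.1‖) T := by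
    simpa only [one_mul, norm_sub_rev] using hT
  have hlhs : ∑ j, G.capacitance α i j
      * (((1 / P.s j t : ℝ) : ℂ) * blochWave G P.Ω ω u α j (fun _ => 1) t)
      = timeSeries P.Ω ω (fun n => G.blochSum α (fun k => X.outerJump k n) i) t := by
    have hj : ∀ j : Fin N, ((1 / P.s j t : ℝ) : ℂ) * blochWave G P.Ω ω u α j (fun _ => 1) t
        = timeSeries P.Ω ω (fun n => G.blochSum α (fun k => X.outer k n) j) t := by
      intro j
      rw [hX.blochWave_eq (a := fun _ => 1) α j (h1b j), trigSum_mul_timeSeries (hX.σ_eq j t)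
        (hX.weightedSummable hg h1 α j).norm]
      congr 1
      funext n
      rw [← Chain.blochSum_conv (f := fun n k => X.mean k n * 1)
        (hX.summable_mean_cell hg h1) X.band (X.σ j) n]
      refine Chain.blochSum_congr fun m => ?_
      simp only [mul_one, ModeSystem.outer, hX.σ_add]
    have ho : ∀ j : Fin N, Summable fun n => ‖G.blochSum α (fun k => X.outer k n) j‖ := by
      intro j
      have := (Chain.sumLE_blochSum (G := G) (α := α) (f := fun n k => X.outer k n)
        (ψ := fun _ => 1) (fun _ => le_rfl) ⟨fun p => by positivity,
          by simpa using X.summable_outer hg, le_rfl⟩ (j : ℤ)).2.1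
      simpa using this
    simp only [hj, mul_timeSeries]
    rw [sum_timeSeries fun j _ => by simpa only [norm_mul] using (ho j).mul_left _]
    congr 1
    funext n
    exact X.sum_capacitance_blochSum hg α i n
  have hrhs : -(((G.len i / (P.s i t * P.κr) : ℝ) : ℂ)
      * deriv (fun τ => ((1 / P.κ i τ : ℝ) : ℂ) * deriv (timeSeries P.Ω ω y) τ) t)
      = timeSeries P.Ω ω (fun n => G.blochSum α (fun k => X.fluxJump k n) i) t := by
    rw [hκY, (hasDerivAt_timeSeries hκ1 t).deriv]
    have e : ((G.len i / (P.s i t * P.κr) : ℝ) : ℂ)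
        = ((1 / P.s i t : ℝ) : ℂ) * ((G.len i / P.κr : ℝ) : ℂ) := by
      rw [← ofReal_mul]; congr 1; rw [div_mul_div_comm, one_mul]
    rw [e, mul_assoc, ← mul_neg, ← neg_mul, mul_timeSeries,
      trigSum_mul_timeSeries (hX.σ_eq i t) (by
        simpa only [norm_mul] using (hκ1.freq_mul (j := 0)).norm.mul_left _)]
    congr 1
    funext n
    rw [hX.blochSum_fluxJump hg hR (fun _ => rfl) hκr hδ]
  have hsO := Chain.sumLE_blochSum (G := G) (α := α) (f := fun n k => X.outerJump k n)
    (ψ := fun _ => 1) (fun _ => le_rfl) hO i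
  have hsF := Chain.sumLE_blochSum (G := G) (α := α) (f := fun n k => X.fluxJump k n)
    (ψ := fun _ => 1) (fun _ => le_rfl) hF i
  have hsD := Chain.sumLE_blochSum (G := G) (α := α)
    (f := fun n k => X.outerJump k n - X.fluxJump k n) (ψ := fun _ => 1) (fun _ => le_rfl) hD i
  simp only [one_mul] at hsO hsF hsD hO hF
  -- Both sides are now time series of Bloch sums, and their difference is the series of the Bloch
  -- sums of the flux error.
  rw [hY, hlhs, hrhs, timeSeries_sub hsO.2.1 hsF.2.1]
  refine norm_timeSeries_le ?_ t
  convert hsD using 3 with n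
  exact (Chain.blochSum_sub (hO.2.1.prod_factor n) (hF.2.1.prod_factor n) _).symm

end SpaceTimeResonators

end

/-! ### The main theorem: choice of the constants. -/

open SpaceTimeResonators in
theorem mainTheorem4 {N : ℕ} (G : Chain N) (v₀ : ℝ) (hv₀ : 0 < v₀)
    (γ : ℝ) (hγ : γ ∈ Set.Ioo (0 : ℝ) 1) (C : ℝ) :
    ∃ K d₀ : ℝ, 0 < d₀ ∧ ∀ d ∈ Set.Ioo 0 d₀, ∀ (M : ℕ), (M : ℝ) ≤ C * d ^ (-γ / 2) →
      ∀ (P : Material N), P.IsHighContrast C d M →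
      ∀ (ω : ℂ) (u : ℝ → ℝ → ℂ), IsSolution G v₀ P ω u → IsLocalised G P.Ω ω u →
        IsSubwavelength G P.Ω ω u C γ d M →
        -- the modes are approximately constant in the resonators
        (∀ (n m : ℤ) (i : Fin N), ∀ x ∈ Set.Ioo (G.left m i) (G.right m i),
          ‖mode P.Ω ω u n x - cellMode G P.Ω ω u m i n‖
            ≤ K * d ^ ((1 - γ) / 2) * size G P.Ω ω u) ∧
        -- the Bloch sums satisfy the capacitance equation at leading order
        ∀ α ∈ Set.Ioc (-(Real.pi / G.L)) (Real.pi / G.L), ∀ i : Fin N,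
          (∀ t : ℝ, Summable fun p : ℤ × ℤ => blochTerm G P.Ω ω u α i (fun _ => 1) p.1 p.2
            * Complex.exp (Complex.I * (ω + p.1 * P.Ω) * t)) ∧
          (∀ t : ℝ, Summable fun p : ℤ × ℤ =>
            blochTerm G P.Ω ω u α i (fun m => P.ρ m i / P.δ m i) p.1 p.2
            * Complex.exp (Complex.I * (ω + p.1 * P.Ω) * t)) ∧
          Differentiable ℝ (blochWave G P.Ω ω u α i fun m => P.ρ m i / P.δ m i) ∧
          Differentiable ℝ (fun t => ((1 / P.κ i t : ℝ) : ℂ)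
            * deriv (blochWave G P.Ω ω u α i fun m => P.ρ m i / P.δ m i) t) ∧
          ∀ t : ℝ,
            ‖∑ j, G.capacitance α i j
                * (((1 / P.s j t : ℝ) : ℂ) * blochWave G P.Ω ω u α j (fun _ => 1) t)
              - -(((G.len i / (P.s i t * P.κr) : ℝ) : ℂ)
                * deriv (fun τ => ((1 / P.κ i τ : ℝ) : ℂ)
                  * deriv (blochWave G P.Ω ω u α i fun m => P.ρ m i / P.δ m i) τ) t)‖
              ≤ K * d ^ ((1 - γ) / 2) * size G P.Ω ω u * ‖Complex.exp (Complex.I * ω * t)‖ := by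
  -- For C ≤ 0 the regime is empty, because 0 < Ω ≤ C √d.
  rcases le_or_gt C 0 with hC | hC
  · exact ⟨0, 1, one_pos, fun d _ M _ P hP => absurd hP.C_pos hC.not_gt⟩
  have : NeZero N := ⟨G.ne_zero⟩
  obtain ⟨h₀, h₁, hg⟩ := G.exists_lengthBounds
  have hh₁ : 0 < h₁ := by linarith [hg.pos, hg.le_len 0, hg.len_le 0]
  -- The cutoff satisfies c h₁/v₀ ≤ 1/2, which keeps frequencies up to c away from the resonances of
  -- every gap.
  obtain ⟨c, hc0, hc1, hc⟩ : ∃ c : ℝ, 0 < c ∧ c ≤ 1 ∧ (c / v₀) ^ 2 * h₁ ^ 2 ≤ 1 / 2 := by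
    have hq : 0 < v₀ / (2 * h₁) := by positivity
    refine ⟨min 1 (v₀ / (2 * h₁)), lt_min one_pos hq, min_le_left _ _, ?_⟩
    have hle : min 1 (v₀ / (2 * h₁)) / v₀ * h₁ ≤ 1 / 2 := by
      calc _ ≤ v₀ / (2 * h₁) / v₀ * h₁ := by gcongr; exact min_le_right _ _
        _ = 1 / 2 := by field_simp
    have h0 : 0 ≤ min 1 (v₀ / (2 * h₁)) / v₀ * h₁ := by positivity
    rw [← mul_pow]
    nlinarith
  have hC' : 0 < systemConst N h₁ C := by unfold systemConst; positivity
  obtain ⟨K₁, hK₁, hmean⟩ := ModeSystem.exists_norm_A_sub_mean_le hg hC'.le hv₀ hc0 hc1 hc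
  obtain ⟨K₂, hK₂, hflux⟩ := ModeSystem.sumBigO_flux_sub hg hC'.le hv₀ hc0 hc1 hc
  set s := (1 - γ) / 2 with hs
  have hs0 : 0 < s := by rw [hs]; linarith [hγ.2]
  set q := c / (8 * systemConst N h₁ C) with hq
  have hq0 : 0 < q := by positivity
  -- Below this threshold d^s ≤ q, which is the smallness condition 8 C' ε ≤ c of the mode systems
  -- with C' = `systemConst N h₁ C`.
  refine ⟨K₁ + K₂, min 1 (q ^ (1 / s)), lt_min one_pos (Real.rpow_pos_of_pos hq0 _), ?_⟩
  intro d hd M hM P hP ω u hu hl hsub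
  have hd0 : 0 < d := hd.1
  have hd1 : d ≤ 1 := (hd.2.trans_le (min_le_left _ _)).le
  have hdq : d ^ s ≤ q := by
    have h := Real.rpow_le_rpow hd0.le (hd.2.trans_le (min_le_right _ _)).le hs0.le
    rwa [← Real.rpow_mul hq0.le, one_div_mul_cancel hs0.ne', Real.rpow_one] at h
  have hsmall : 8 * (systemConst N h₁ C * d ^ s) ≤ c := by
    calc 8 * (systemConst N h₁ C * d ^ s) ≤ 8 * (systemConst N h₁ C * q) := by gcongr
      _ = c := by rw [hq]; field_simp
  obtain ⟨X, hXε, hX⟩ := exists_modeSystem hg hv₀ hγ hd0 hd1 hsmall hM hP hu hl hsub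
  have hεS : 0 ≤ d ^ s * size G P.Ω ω u :=
    mul_nonneg (Real.rpow_nonneg hd0.le _) hl.summable_modeNorm.nonneg
  refine ⟨fun n m i x hx => ?_, fun α _ i => ?_⟩
  · rw [G.left_eq, G.right_eq] at hx
    rw [hX.cellMode_eq, hX.mode_eq _ n x hx]
    refine (hmean X _ n x ⟨hx.1.le, hx.2.le⟩).trans ?_
    rw [hXε, hX.S_eq, mul_assoc]
    exact mul_le_mul_of_nonneg_right (by linarith) hεS
  · have hδ : ∀ k, 0 < X.δ k := fun k => by rw [hX.δ_eq]; exact hP.δ_pos hd0 _ _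
    have hT : SumLE (fun p : ℤ × ℤ => ‖X.fluxJump p.2 p.1 - X.outerJump p.2 p.1‖)
        ((K₁ + K₂) * d ^ s * size G P.Ω ω u) := by
      refine (hflux X).le_right ?_
      dsimp only
      rw [hXε, hX.S_eq, mul_assoc (K₁ + K₂)]
      exact mul_le_mul_of_nonneg_right (by linarith) hεS
    -- From ρ/κ_r ≤ C and 1/δ ≤ C/d. The bound may blow up as d → 0, since it serves convergence
    -- only and does not enter the error.
    refine hX.capacitance_equation hg (R := P.κr * (C * (C / d))) hP.κr_pos
      (fun k => (hδ k).ne') (fun k => ?_) hT α i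
    rw [norm_mul, norm_real, norm_real, Real.norm_of_nonneg hP.κr_pos.le,
      Real.norm_of_nonneg (div_nonneg (X.r_nonneg k) (hδ k).le)]
    refine mul_le_mul_of_nonneg_left ?_ hP.κr_pos.le
    rw [div_eq_mul_one_div]
    refine mul_le_mul ?_ ?_ (one_div_nonneg.2 (hδ k).le) hC.le
    · rw [hX.r_eq, div_le_iff₀ hP.κr_pos]; exact hP.ρ_le _ _
    · rw [hX.δ_eq, div_le_div_iff₀ (hP.δ_pos hd0 _ _) hd0, one_mul]; exact hP.δ_ge _ _
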